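/- Throughout, $k$ is a field, $\otimes=\otimes_k$, $H$ is a cocommutative Hopf algebra over $k$ with comultiplication $h\mapsto h_{(1)}\otimes h_{(2)}$, counit $\varepsilon$ and antipode $S$, and $A$ is a right $H$-comodule algebra with coaction $\rho(a)=a_{[0]}\otimes a_{[1]}$ and coinvariants $B=A^{\mathrm{co}H}=\{a\in A\mid \rho(a)=a\otimes 1\}$. We assume that $A$ is a faithfully flat $H$-Galois extension of $B$: the map $\mathrm{can}:A\otimes_BA\to A\otimes H$, $a\otimes_B a'\mapsto aa'_{[0]}\otimes a'_{[1]}$, is bijective and $A$ is faithfully flat as a left $B$-module. For $h\in H$ write $\mathrm{can}^{-1}(1\otimes h)=\sum_i l_i(h)\otimes_B r_i(h)$. **Picard group.** $B$-bimodules are left modules over $B^e=B\otimes B^{\mathrm{op}}$, with $(b\otimes b')m=bmb'$. A strict Morita context is $\underline M=(B,B,M,N,\alpha,\beta)$ with $B$-bimodules $M,N$ and $B$-bimodule isomorphisms $\alpha:M\otimes_BN\to B$, $\beta:N\otimes_BM\to B$ such that $\alpha(m\otimes n)m'=m\beta(n\otimes m')$ and $\beta(n\otimes m)n'=n\alpha(m\otimes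 n')$. An isomorphism of contexts is a pair of bimodule isomorphisms $M_1\cong M_2$, $N_1\cong N_2$ that respect $\alpha$ and $\beta$. $\mathrm{Pic}(B)$ is the set of isomorphism classes $[\underline M]$, a group under $$\underline M_1\otimes_B\underline M_2=(B,B,\,M_1\otimes_BM_2,\,N_2\otimes_BN_1,\ \alpha_1\circ(M_1\otimes_B\alpha_2\otimes_BN_1),\ \beta_2\circ(N_2\otimes_B\beta_1\otimes_BM_2)),$$ with unit $(B,B,B,B,B,B)$ and inverse $\underline M^{-1}=(B,B,N,M,\beta,\alpha)$. **The two functors to ${}_B\mathcal M_B^H$.** Let $$A^{\square e}=\Big\{\sum_k a_k\otimes a_k'\in A\otimes A\ \Big|\ \sum_k a_{k[0]}\otimes a'_k\otimes a_{k[1]}=\sum_k a_k\otimes a'_{k[0]}\otimes S(a'_{k[1]})\Big\},$$ with $B^e$-actions $(b\otimes b')(\sum_k a_k\otimes a'_k)(c\otimes c')=\sum_k ba_kc\otimes c'a'_kb'$ and $H$-coaction $\sum_k a_k\otimes a'_k\mapsto\sum_k a_{k[0]}\otimes a'_k\otimes a_{k[1]}$. For a $B$-bimodule $M$, the space $A^{\square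 e}\otimes_{B^e}M$ is a $B$-bimodule with a right $H$-coaction, both induced from $A^{\square e}$; $M\otimes H$ is a $B$-bimodule via $b(m\otimes h)b'=bmb'\otimes h$, with coaction $m\otimes h\mapsto m\otimes h_{(1)}\otimes h_{(2)}$. The category ${}_B\mathcal M_B^H$ has as morphisms the $H$-colinear $B$-bimodule maps. **Tensor products.** For $B$-bimodules $M,M'$ let $\kappa:(M\otimes_BM')\otimes H\to(M\otimes H)\otimes_B(M'\otimes H)$ be the (injective) map $m\otimes_B m'\otimes h\mapsto(m\otimes h_{(1)})\otimes_B(m'\otimes h_{(2)})$, and let $$g:A^{\square e}\otimes_{B^e}(M\otimes_BM')\to(A^{\square e}\otimes_{B^e}M)\otimes_B(A^{\square e}\otimes_{B^e}M'),$$ $$g\Big(\sum_k(a_k\otimes a'_k)\otimes_{B^e}(m\otimes_B m')\Big)=\sum_{i,k}\big((a_{k[0]}\otimes l_i(a_{k[1]}))\otimes_{B^e}m\big)\otimes_B\big((r_i(a_{k[1]})\otimes a'_k)\otimes_{B^e}m'\big),$$ where $\sum_{i,k}(a_{k[0]}\otimes l_i(a_{k[1]}))\otimes_B(r_i(a_{k[1]})\otimes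 a'_k)$ is regarded as an element of $A^{\square e}\otimes_BA^{\square e}$. Given isomorphisms $\varphi_M:A^{\square e}\otimes_{B^e}M\to M\otimes H$ and $\varphi_{M'}:A^{\square e}\otimes_{B^e}M'\to M'\otimes H$ in ${}_B\mathcal M_B^H$, let $\varphi_{M\otimes_BM'}:A^{\square e}\otimes_{B^e}(M\otimes_BM')\to(M\otimes_BM')\otimes H$ be the map determined by $\kappa\circ\varphi_{M\otimes_BM'}=(\varphi_M\otimes_B\varphi_{M'})\circ g$. Let further $\varphi_B:A^{\square e}\otimes_{B^e}B\to B\otimes H$ be the map $\sum_k(a_k\otimes a'_k)\otimes_{B^e}b\mapsto\sum_k a_{k[0]}ba'_k\otimes a_{k[1]}$. **$H$-stability.** A strict Morita context $\underline M=(B,B,M,N,\alpha,\beta)$ is called $H$-stable if there exist isomorphisms $\varphi_M:A^{\square e}\otimes_{B^e}M\to M\otimes H$ and $\varphi_N:A^{\square e}\otimes_{B^e}N\to N\otimes H$ in ${}_B\mathcal M_B^H$ such that $$(\alpha\otimes H)\circ\varphi_{M\otimes_BN}=\varphi_B\circ(A^{\square e}\otimes_{B^e}\alpha),\qquad(\beta\otimes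 H)\circ\varphi_{N\otimes_BM}=\varphi_B\circ(A^{\square e}\otimes_{B^e}\beta).$$ **Theorem.** $H$-stability of $\underline M$ depends only on the class $[\underline M]$, and $$\mathrm{Pic}(B)^H=\{[\underline M]\in\mathrm{Pic}(B)\mid\underline M\text{ is }H\text{-stable}\}$$ is a subgroup of $\mathrm{Pic}(B)$. -/

import Mathlib

open scoped TensorProduct
open MulOpposite (op unop)

namespace HopfPic

universe u v w

section BalancedTensor

variable {k : Type*} [Field k] {R : Type*} [Ring R] [Algebra k R]
  {M M' N N' P : Type*} [AddCommGroup M] [Module k M] [AddCommGroup M'] [Module k M']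
  [AddCommGroup N] [Module k N] [AddCommGroup N'] [Module k N'] [AddCommGroup P] [Module k P]

/-- The relations `m r ⊗ n - m ⊗ r n` that define the tensor product over `R`. -/
def balancedRel (r : Rᵐᵒᵖ →ₐ[k] Module.End k M) (l : R →ₐ[k] Module.End k N) :
    Submodule k (M ⊗[k] N) :=
  Submodule.span k {t | ∃ (m : M) (x : R) (n : N), t = r (op x) m ⊗ₜ n - m ⊗ₜ l x n}

/-- The tensor product `M ⊗_R N` over a (noncommutative) `k`-algebra `R` of a right `R`-module `M`
and a left `R`-module `N`.  The module structures are given by the algebra maps `r` and `l`. -/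
abbrev BTensor (r : Rᵐᵒᵖ →ₐ[k] Module.End k M) (l : R →ₐ[k] Module.End k N) :=
  (M ⊗[k] N) ⧸ balancedRel r l

namespace BTensor

/-- The class `m ⊗_R n`. -/
def mk (r : Rᵐᵒᵖ →ₐ[k] Module.End k M) (l : R →ₐ[k] Module.End k N) :
    M →ₗ[k] N →ₗ[k] BTensor r l :=
  (TensorProduct.mk k M N).compr₂ (balancedRel r l).mkQ

variable {r : Rᵐᵒᵖ →ₐ[k] Module.End k M} {l : R →ₐ[k] Module.End k N}
  {r' : Rᵐᵒᵖ →ₐ[k] Module.End k M'} {l' : R →ₐ[k] Module.End k N'}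

theorem mk_balanced (m : M) (x : R) (n : N) : mk r l (r (op x) m) n = mk r l m (l x n) := by
  have : r (op x) m ⊗ₜ n - m ⊗ₜ l x n ∈ balancedRel r l := Submodule.subset_span ⟨m, x, n, rfl⟩
  exact (Submodule.Quotient.eq _).2 this

/-- A balanced bilinear map induces a map on `M ⊗_R N`. -/
def lift (f : M →ₗ[k] N →ₗ[k] P) (hf : ∀ m x n, f (r (op x) m) n = f m (l x n)) :
    BTensor r l →ₗ[k] P :=
  (balancedRel r l).liftQ (TensorProduct.lift f) (by
    rw [balancedRel, Submodule.span_le]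
    rintro _ ⟨m, x, n, rfl⟩
    simp [hf])

@[simp] theorem lift_mk (f : M →ₗ[k] N →ₗ[k] P) (hf : ∀ m x n, f (r (op x) m) n = f m (l x n))
    (m : M) (n : N) : lift f hf (mk r l m n) = f m n := by
  simp [lift, mk]

theorem hom_ext {f g : BTensor r l →ₗ[k] P} (h : ∀ m n, f (mk r l m n) = g (mk r l m n)) :
    f = g := by
  apply Submodule.linearMap_qext
  apply TensorProduct.ext'
  exact h

@[elab_as_elim]
theorem induction_on {p : BTensor r l → Prop} (z : BTensor r l)
    (tmul : ∀ m n, p (mk r l m n)) (add : ∀ x y, p x → p y → p (x + y)) : p z := by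
  obtain ⟨z, rfl⟩ := Submodule.mkQ_surjective _ z
  induction z using TensorProduct.induction_on with
  | zero => simpa using tmul 0 0
  | tmul m n => exact tmul m n
  | add x y hx hy => rw [map_add]; exact add _ _ hx hy

/-- The map `f ⊗_R g` for a right `R`-linear `f` and a left `R`-linear `g`. -/
def map (f : M →ₗ[k] M') (g : N →ₗ[k] N') (hf : ∀ x m, f (r (op x) m) = r' (op x) (f m))
    (hg : ∀ x n, g (l x n) = l' x (g n)) : BTensor r l →ₗ[k] BTensor r' l' :=
  lift ((mk r' l').compl₁₂ f g) (fun m x n => by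
    simp only [LinearMap.compl₁₂_apply, hf, hg, mk_balanced])

@[simp] theorem map_mk (f : M →ₗ[k] M') (g : N →ₗ[k] N')
    (hf : ∀ x m, f (r (op x) m) = r' (op x) (f m))
    (hg : ∀ x n, g (l x n) = l' x (g n)) (m : M) (n : N) :
    map (l := l) (l' := l') f g hf hg (mk r l m n) = mk r' l' (f m) (g n) := by
  simp [map]

variable {S : Type*} [Ring S] [Algebra k S]

/-- An action of `S` on `M` by right `R`-linear maps induces an action of `S` on `M ⊗_R N`. -/
def actLeft (f : S →ₐ[k] Module.End k M) (hf : ∀ s x m, f s (r (op x) m) = r (op x) (f s m))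
    (l : R →ₐ[k] Module.End k N) : S →ₐ[k] Module.End k (BTensor r l) where
  toFun s := map (f s) LinearMap.id (hf s) (fun _ _ => rfl)
  map_one' := hom_ext fun m n => by simp
  map_mul' b c := hom_ext fun m n => by simp
  map_zero' := hom_ext fun m n => by simp
  map_add' b c := hom_ext fun m n => by simp
  commutes' a := hom_ext fun m n => by simp [Algebra.algebraMap_eq_smul_one]

@[simp] theorem actLeft_mk (f : S →ₐ[k] Module.End k M)
    (hf : ∀ s x m, f s (r (op x) m) = r (op x) (f s m)) (s : S) (m : M) (n : N) :
    actLeft f hf l s (mk r l m n) = mk r l (f s m) n := rfl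

/-- An action of `S` on `N` by left `R`-linear maps induces an action of `S` on `M ⊗_R N`. -/
def actRight (r : Rᵐᵒᵖ →ₐ[k] Module.End k M) (f : S →ₐ[k] Module.End k N)
    (hf : ∀ s x n, f s (l x n) = l x (f s n)) : S →ₐ[k] Module.End k (BTensor r l) where
  toFun s := map LinearMap.id (f s) (fun _ _ => rfl) (hf s)
  map_one' := hom_ext fun m n => by simp
  map_mul' b c := hom_ext fun m n => by simp
  map_zero' := hom_ext fun m n => by simp
  map_add' b c := hom_ext fun m n => by simp
  commutes' a := hom_ext fun m n => by simp [Algebra.algebraMap_eq_smul_one]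

@[simp] theorem actRight_mk (f : S →ₐ[k] Module.End k N)
    (hf : ∀ s x n, f s (l x n) = l x (f s n)) (s : S) (m : M) (n : N) :
    actRight r f hf s (mk r l m n) = mk r l m (f s n) := rfl

theorem actLeft_comm {T : Type*} [Ring T] [Algebra k T] (f : S →ₐ[k] Module.End k M)
    (hf : ∀ s x m, f s (r (op x) m) = r (op x) (f s m)) (g : T →ₐ[k] Module.End k M)
    (hg : ∀ t x m, g t (r (op x) m) = r (op x) (g t m)) (h : ∀ s t m, f s (g t m) = g t (f s m))
    (s : S) (t : T) (z : BTensor r l) :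
    actLeft f hf l s (actLeft g hg l t z) = actLeft g hg l t (actLeft f hf l s z) := by
  induction z using induction_on with
  | tmul m n => rw [actLeft_mk, actLeft_mk, actLeft_mk, actLeft_mk, h]
  | add x y hx hy => rw [map_add, map_add, map_add, map_add, hx, hy]

end BTensor

end BalancedTensor

/-- Bimodules over a `k`-algebra `B` (with `k` acting centrally), that is, modules over
`B ⊗ Bᵐᵒᵖ`. -/
structure Bimodule (k : Type u) (B : Type v) [Field k] [Ring B] [Algebra k B] where
  carrier : Type v
  [addCommGroup : AddCommGroup carrier]
  [module : Module k carrier]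
  /-- the left action `m ↦ b m` -/
  left : B →ₐ[k] Module.End k carrier
  /-- the right action `m ↦ m b` -/
  right : Bᵐᵒᵖ →ₐ[k] Module.End k carrier
  comm : ∀ b c m, left b (right c m) = right c (left b m)

attribute [instance] Bimodule.addCommGroup Bimodule.module

namespace Bimodule

variable {k : Type u} {B : Type v} [Field k] [Ring B] [Algebra k B]

/-- Isomorphisms of `B`-bimodules. -/
structure Iso (M N : Bimodule k B) extends M.carrier ≃ₗ[k] N.carrier where
  map_left : ∀ b m, toFun (M.left b m) = N.left b (toFun m)
  map_right : ∀ b m, toFun (M.right b m) = N.right b (toFun m)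

variable {M N P Q M' N' : Bimodule k B}

instance : CoeFun (Iso M N) (fun _ => M.carrier → N.carrier) := ⟨fun f => f.toLinearEquiv⟩

theorem Iso.left' (f : Iso M N) (b : B) (m : M.carrier) : f (M.left b m) = N.left b (f m) :=
  f.map_left b m

theorem Iso.right' (f : Iso M N) (b : Bᵐᵒᵖ) (m : M.carrier) : f (M.right b m) = N.right b (f m) :=
  f.map_right b m

def Iso.refl (M : Bimodule k B) : Iso M M where
  toLinearEquiv := LinearEquiv.refl k _
  map_left _ _ := rfl
  map_right _ _ := rfl

def Iso.symm (f : Iso M N) : Iso N M where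
  toLinearEquiv := f.toLinearEquiv.symm
  map_left b n := by
    apply f.toLinearEquiv.injective
    have := f.left' b (f.toLinearEquiv.symm n)
    simpa using this.symm
  map_right b n := by
    apply f.toLinearEquiv.injective
    have := f.right' b (f.toLinearEquiv.symm n)
    simpa using this.symm

def Iso.trans (f : Iso M N) (g : Iso N P) : Iso M P where
  toLinearEquiv := f.toLinearEquiv.trans g.toLinearEquiv
  map_left b m := by
    show g (f _) = P.left b (g (f m))
    rw [f.left', g.left']
  map_right b m := by
    show g (f _) = P.right b (g (f m))
    rw [f.right', g.right']

/-- `B` as a bimodule over itself. -/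
def unit (k : Type u) (B : Type v) [Field k] [Ring B] [Algebra k B] : Bimodule k B where
  carrier := B
  left := Algebra.lsmul k k B
  right := Algebra.lsmul k k B
  comm b c m := by
    show b * (m * c.unop) = b * m * c.unop
    rw [mul_assoc]

/-- The bimodule `M ⊗_B N`. -/
def tensor (M N : Bimodule k B) : Bimodule k B where
  carrier := BTensor M.right N.left
  left := BTensor.actLeft M.left (fun b x m => M.comm b (op x) m) N.left
  right := BTensor.actRight M.right N.right (fun b x n => (N.comm x b n).symm)
  comm b c z := by
    induction z using BTensor.induction_on with
    | tmul m n => rfl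
    | add x y hx hy => rw [map_add, map_add, map_add, map_add, hx, hy]

/-- The class `m ⊗_B n`. -/
def tmul (M N : Bimodule k B) : M.carrier →ₗ[k] N.carrier →ₗ[k] (M.tensor N).carrier :=
  BTensor.mk M.right N.left

theorem tmul_balanced (m : M.carrier) (b : B) (n : N.carrier) :
    tmul M N (M.right (op b) m) n = tmul M N m (N.left b n) := BTensor.mk_balanced m b n

@[simp] theorem tensor_left (b : B) (m : M.carrier) (n : N.carrier) :
    (M.tensor N).left b (tmul M N m n) = tmul M N (M.left b m) n :=
  rfl

@[simp] theorem tensor_right (b : Bᵐᵒᵖ) (m : M.carrier) (n : N.carrier) :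
    (M.tensor N).right b (tmul M N m n) = tmul M N m (N.right b n) :=
  rfl

@[simp] theorem unit_left (b : B) (m : B) : (unit k B).left b m = b * m := rfl

@[simp] theorem unit_right (b : Bᵐᵒᵖ) (m : B) : (unit k B).right b m = m * b.unop := rfl

@[elab_as_elim]
theorem tensor_induction {p : (M.tensor N).carrier → Prop} (z : (M.tensor N).carrier)
    (tmul : ∀ m n, p (tmul M N m n)) (add : ∀ x y, p x → p y → p (x + y)) : p z :=
  BTensor.induction_on z tmul add

theorem tensor_hom_ext {X : Type*} [AddCommGroup X] [Module k X]
    {f g : (M.tensor N).carrier →ₗ[k] X}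
    (h : ∀ m n, f (tmul M N m n) = g (tmul M N m n)) : f = g :=
  BTensor.hom_ext h

/-- A balanced bilinear map induces a map on `M ⊗_B N`. -/
def tensorLift {X : Type*} [AddCommGroup X] [Module k X]
    (f : M.carrier →ₗ[k] N.carrier →ₗ[k] X)
    (hf : ∀ m b n, f (M.right (op b) m) n = f m (N.left b n)) : (M.tensor N).carrier →ₗ[k] X :=
  BTensor.lift f hf

@[simp] theorem tensorLift_tmul {X : Type*} [AddCommGroup X] [Module k X]
    (f : M.carrier →ₗ[k] N.carrier →ₗ[k] X)
    (hf : ∀ m b n, f (M.right (op b) m) n = f m (N.left b n)) (m : M.carrier) (n : N.carrier) :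
    tensorLift f hf (tmul M N m n) = f m n :=
  rfl

/-- An isomorphism of bimodules from mutually inverse maps. -/
def Iso.mk' (f : M.carrier →ₗ[k] N.carrier) (g : N.carrier →ₗ[k] M.carrier)
    (hfg : f ∘ₗ g = LinearMap.id) (hgf : g ∘ₗ f = LinearMap.id)
    (hl : ∀ b, f ∘ₗ M.left b = N.left b ∘ₗ f) (hr : ∀ b, f ∘ₗ M.right b = N.right b ∘ₗ f) :
    Iso M N where
  toLinearEquiv := LinearEquiv.ofLinearMap f g hfg hgf
  map_left b m := LinearMap.congr_fun (hl b) m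
  map_right b m := LinearMap.congr_fun (hr b) m

/-- `f ⊗_B g` for bimodule isomorphisms `f`, `g`. -/
def Iso.tensor (f : Iso M M') (g : Iso N N') : Iso (M.tensor N) (M'.tensor N') :=
  Iso.mk'
    (tensorLift ((tmul M' N').compl₁₂ f.toLinearEquiv.toLinearMap g.toLinearEquiv.toLinearMap)
      (fun m b n => by simp [f.right', g.left', tmul_balanced]))
    (tensorLift ((tmul M N).compl₁₂ f.symm.toLinearEquiv.toLinearMap
      g.symm.toLinearEquiv.toLinearMap)
      (fun m b n => by simp [f.symm.right', g.symm.left', tmul_balanced]))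
    (tensor_hom_ext fun m n => by simp [Iso.symm])
    (tensor_hom_ext fun m n => by simp [Iso.symm])
    (fun b => tensor_hom_ext fun m n => by simp [f.left'])
    (fun b => tensor_hom_ext fun m n => by simp [g.right'])

@[simp] theorem Iso.tensor_tmul (f : Iso M M') (g : Iso N N') (m : M.carrier) (n : N.carrier) :
    (f.tensor g) (tmul M N m n) = tmul M' N' (f m) (g n) :=
  rfl

/-- `(M ⊗_B N) ⊗_B P ≅ M ⊗_B (N ⊗_B P)`. -/
def assoc (M N P : Bimodule k B) : Iso ((M.tensor N).tensor P) (M.tensor (N.tensor P)) :=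
  Iso.mk'
    (tensorLift (tensorLift
        (LinearMap.mk₂ k (fun m n => (tmul M (N.tensor P) m) ∘ₗ (tmul N P n))
          (fun _ _ _ => by ext; simp) (fun _ _ _ => by ext; simp)
          (fun _ _ _ => by ext; simp) (fun _ _ _ => by ext; simp))
        (fun m b n => by ext p; simp [tmul_balanced]))
      (fun z b p => by
        induction z using tensor_induction with
        | tmul m n => simp [tmul_balanced]
        | add x y hx hy => simp only [map_add, LinearMap.add_apply, hx, hy]))
    (tensorLift (LinearMap.flip (tensorLift
        (LinearMap.mk₂ k (fun n p => (tmul (M.tensor N) P).flip p ∘ₗ (tmul M N).flip n)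
          (fun _ _ _ => by ext; simp) (fun _ _ _ => by ext; simp)
          (fun _ _ _ => by ext; simp) (fun _ _ _ => by ext; simp))
        (fun n b p => by ext m; simp [← tmul_balanced])))
      (fun m b z => by
        induction z using tensor_induction with
        | tmul n p => simp [tmul_balanced]
        | add x y hx hy => simp only [map_add, hx, hy]))
    (tensor_hom_ext fun m z => by
      induction z using tensor_induction with
      | tmul n p => simp
      | add x y hx hy => simp only [map_add, hx, hy])
    (tensor_hom_ext fun z p => by
      induction z using tensor_induction with
      | tmul m n => simp
      | add x y hx hy => simp only [map_add, LinearMap.add_apply, hx, hy])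
    (fun b => tensor_hom_ext fun z p => by
      induction z using tensor_induction with
      | tmul m n => simp
      | add x y hx hy => simp only [map_add, LinearMap.add_apply, hx, hy])
    (fun b => tensor_hom_ext fun z p => by
      induction z using tensor_induction with
      | tmul m n => simp
      | add x y hx hy => simp only [map_add, LinearMap.add_apply, hx, hy])

@[simp] theorem assoc_tmul (m : M.carrier) (n : N.carrier) (p : P.carrier) :
    assoc M N P (tmul (M.tensor N) P (tmul M N m n) p) =
      tmul M (N.tensor P) m (tmul N P n p) := by
  rfl

@[simp] theorem assoc_symm_tmul (m : M.carrier) (n : N.carrier) (p : P.carrier) :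
    (assoc M N P).symm (tmul M (N.tensor P) m (tmul N P n p)) =
      tmul (M.tensor N) P (tmul M N m n) p := by
  rfl

/-- `B ⊗_B M ≅ M`. -/
def leftUnitor (M : Bimodule k B) : Iso ((unit k B).tensor M) M :=
  Iso.mk'
    (tensorLift (M := unit k B) M.left.toLinearMap (fun (m : B) b n => by
      show M.left (m * b) n = M.left m (M.left b n)
      simp))
    (tmul (unit k B) M (1 : B))
    (LinearMap.ext fun m => by
      show M.left (1 : B) m = m
      simp)
    (tensor_hom_ext fun (b : B) m => by
      have := tmul_balanced (M := unit k B) (N := M) (1 : B) b m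
      refine this.symm.trans ?_
      show tmul (unit k B) M ((1 : B) * b) m = tmul (unit k B) M b m
      rw [one_mul])
    (fun b => tensor_hom_ext fun (c : B) m => by
      show M.left (b * c) m = M.left b (M.left c m)
      simp)
    (fun b => tensor_hom_ext fun (c : B) m => M.comm c b m)

@[simp] theorem leftUnitor_tmul (b : B) (m : M.carrier) :
    leftUnitor M (tmul (unit k B) M b m) = M.left b m :=
  rfl

/-- `M ⊗_B B ≅ M`. -/
def rightUnitor (M : Bimodule k B) : Iso (M.tensor (unit k B)) M :=
  Iso.mk'
    (tensorLift (N := unit k B)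
      (M.right.toLinearMap ∘ₗ (MulOpposite.opLinearEquiv k).toLinearMap).flip
      (fun m b (n : B) => by
        show M.right (op n) (M.right (op b) m) = M.right (op (b * n)) m
        simp))
    ((tmul M (unit k B)).flip (1 : B))
    (LinearMap.ext fun m => by
      show M.right (op (1 : B)) m = m
      simp)
    (tensor_hom_ext fun m (b : B) => by
      have := tmul_balanced (M := M) (N := unit k B) m b (1 : B)
      refine this.trans ?_
      show tmul M (unit k B) m (b * (1 : B)) = tmul M (unit k B) m b
      rw [mul_one])
    (fun b => tensor_hom_ext fun m (c : B) => (M.comm b (op c) m).symm)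
    (fun b => tensor_hom_ext fun m (c : B) => by
      show M.right (op (c * b.unop)) m = M.right b (M.right (op c) m)
      simp)

@[simp] theorem rightUnitor_tmul (m : M.carrier) (b : B) :
    rightUnitor M (tmul M (unit k B) m b) = M.right (op b) m :=
  rfl

/-- An isomorphism onto the bimodule `B`, as a linear map with values in `B`. -/
def Iso.val (f : Iso M (unit k B)) : M.carrier →ₗ[k] B := f.toLinearEquiv.toLinearMap

theorem Iso.val_left (f : Iso M (unit k B)) (b : B) (m : M.carrier) :
    f.val (M.left b m) = b * f.val m := f.left' b m

theorem Iso.val_right (f : Iso M (unit k B)) (b : B) (m : M.carrier) :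
    f.val (M.right (op b) m) = f.val m * b := f.right' (op b) m

theorem tensor_val_left (f : Iso (M.tensor N) (unit k B)) (b : B) (m : M.carrier)
    (n : N.carrier) : f.val (tmul M N (M.left b m) n) = b * f.val (tmul M N m n) :=
  f.val_left b (tmul M N m n)

theorem tensor_val_right (f : Iso (M.tensor N) (unit k B)) (b : B) (m : M.carrier)
    (n : N.carrier) : f.val (tmul M N m (N.right (op b) n)) = f.val (tmul M N m n) * b :=
  f.val_right b (tmul M N m n)

theorem Iso.apply_symm_apply (f : Iso M N) (n : N.carrier) : f (f.symm n) = n :=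
  f.toLinearEquiv.apply_symm_apply n

theorem Iso.symm_apply_apply (f : Iso M N) (m : M.carrier) : f.symm (f m) = m :=
  f.toLinearEquiv.symm_apply_apply m

end Bimodule

/-- Strict Morita contexts `(B, B, M, N, α, β)`. -/
structure StrictMoritaContext (k : Type u) (B : Type v) [Field k] [Ring B] [Algebra k B] where
  M : Bimodule k B
  N : Bimodule k B
  α : (M.tensor N).Iso (Bimodule.unit k B)
  β : (N.tensor M).Iso (Bimodule.unit k B)
  /-- `α(m ⊗ n) m' = m β(n ⊗ m')` -/
  assoc_left : ∀ m n m', M.left (α.val (Bimodule.tmul M N m n)) m' =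
    M.right (op (β.val (Bimodule.tmul N M n m'))) m
  /-- `β(n ⊗ m) n' = n α(m ⊗ n')` -/
  assoc_right : ∀ n m n', N.left (β.val (Bimodule.tmul N M n m)) n' =
    N.right (op (α.val (Bimodule.tmul M N m n'))) n

namespace StrictMoritaContext

open Bimodule

variable {k : Type u} {B : Type v} [Field k] [Ring B] [Algebra k B]

/-- Two strict Morita contexts are isomorphic if there are bimodule isomorphisms `μ : M ≅ M'` and
`ν : N ≅ N'` with `α = α' ∘ (μ ⊗ ν)` and `β = β' ∘ (ν ⊗ μ)`. -/
def Isomorphic (X Y : StrictMoritaContext k B) : Prop :=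
  ∃ (μ : X.M.Iso Y.M) (ν : X.N.Iso Y.N),
    (∀ m n, X.α.val (tmul X.M X.N m n) = Y.α.val (tmul Y.M Y.N (μ m) (ν n))) ∧
    (∀ n m, X.β.val (tmul X.N X.M n m) = Y.β.val (tmul Y.N Y.M (ν n) (μ m)))

/-- The unit context `(B, B, B, B, B, B)`. -/
def one (k : Type u) (B : Type v) [Field k] [Ring B] [Algebra k B] : StrictMoritaContext k B where
  M := unit k B
  N := unit k B
  α := leftUnitor (unit k B)
  β := leftUnitor (unit k B)
  assoc_left (m n m' : B) := mul_assoc m n m'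
  assoc_right (m n m' : B) := mul_assoc m n m'

/-- The inverse context `(B, B, N, M, β, α)`. -/
def inv (X : StrictMoritaContext k B) : StrictMoritaContext k B where
  M := X.N
  N := X.M
  α := X.β
  β := X.α
  assoc_left := X.assoc_right
  assoc_right := X.assoc_left

/-- The isomorphism `(M₁ ⊗ M₂) ⊗ (N₂ ⊗ N₁) ≅ M₁ ⊗ (M₂ ⊗ N₂) ⊗ N₁ ≅ M₁ ⊗ N₁ ≅ B` built from
`α₂` and `α₁`. -/
def contract {M₁ N₁ M₂ N₂ : Bimodule k B} (α₁ : (M₁.tensor N₁).Iso (unit k B))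
    (α₂ : (M₂.tensor N₂).Iso (unit k B)) :
    ((M₁.tensor M₂).tensor (N₂.tensor N₁)).Iso (unit k B) :=
  (assoc M₁ M₂ (N₂.tensor N₁)).trans
    (((Iso.refl M₁).tensor ((assoc M₂ N₂ N₁).symm.trans
      ((α₂.tensor (Iso.refl N₁)).trans (leftUnitor N₁)))).trans α₁)

theorem contract_tmul {M₁ N₁ M₂ N₂ : Bimodule k B} (α₁ : (M₁.tensor N₁).Iso (unit k B))
    (α₂ : (M₂.tensor N₂).Iso (unit k B)) (m₁ : M₁.carrier) (m₂ : M₂.carrier) (n₂ : N₂.carrier)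
    (n₁ : N₁.carrier) :
    (contract α₁ α₂).val (tmul _ _ (tmul M₁ M₂ m₁ m₂) (tmul N₂ N₁ n₂ n₁)) =
      α₁.val (tmul M₁ N₁ m₁ (N₁.left (α₂.val (tmul M₂ N₂ m₂ n₂)) n₁)) :=
  rfl

theorem contract_assoc (X Y : StrictMoritaContext k B)
    (z : (X.M.tensor Y.M).carrier) (w : (Y.N.tensor X.N).carrier) (z' : (X.M.tensor Y.M).carrier) :
    (X.M.tensor Y.M).left ((contract X.α Y.α).val (tmul _ _ z w)) z' =
      (X.M.tensor Y.M).right (op ((contract Y.β X.β).val (tmul _ _ w z'))) z := by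
  induction z using tensor_induction with
  | add x y hx hy => simp only [map_add, LinearMap.add_apply, hx, hy]
  | tmul m₁ m₂ =>
  induction w using tensor_induction with
  | add x y hx hy => simp only [map_add, LinearMap.add_apply, MulOpposite.op_add, hx, hy]
  | tmul n₂ n₁ =>
  induction z' using tensor_induction with
  | add x y hx hy => simp only [map_add, MulOpposite.op_add, LinearMap.add_apply, hx, hy]
  | tmul m₁' m₂' =>
    rw [contract_tmul, contract_tmul, tensor_left, tensor_right, X.assoc_left, ← Y.assoc_left,
      tmul_balanced, tensor_val_left, map_mul]
    rfl

/-- The tensor product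
`(B, B, M₁ ⊗ M₂, N₂ ⊗ N₁, α₁ ∘ (M₁ ⊗ α₂ ⊗ N₁), β₂ ∘ (N₂ ⊗ β₁ ⊗ M₂))`. -/
def mul (X Y : StrictMoritaContext k B) : StrictMoritaContext k B where
  M := X.M.tensor Y.M
  N := Y.N.tensor X.N
  α := contract X.α Y.α
  β := contract Y.β X.β
  assoc_left := contract_assoc X Y
  assoc_right := contract_assoc Y.inv X.inv

theorem Isomorphic.refl (X : StrictMoritaContext k B) : X.Isomorphic X :=
  ⟨Iso.refl _, Iso.refl _, fun _ _ => rfl, fun _ _ => rfl⟩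

theorem Isomorphic.symm {X Y : StrictMoritaContext k B} (h : X.Isomorphic Y) : Y.Isomorphic X := by
  obtain ⟨μ, ν, h₁, h₂⟩ := h
  refine ⟨μ.symm, ν.symm, fun m n => ?_, fun n m => ?_⟩
  · rw [h₁, Iso.apply_symm_apply, Iso.apply_symm_apply]
  · rw [h₂, Iso.apply_symm_apply, Iso.apply_symm_apply]

theorem Isomorphic.trans {X Y Z : StrictMoritaContext k B} (h : X.Isomorphic Y)
    (h' : Y.Isomorphic Z) : X.Isomorphic Z := by
  obtain ⟨μ, ν, h₁, h₂⟩ := h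
  obtain ⟨μ', ν', h₁', h₂'⟩ := h'
  exact ⟨μ.trans μ', ν.trans ν', fun m n => (h₁ m n).trans (h₁' _ _),
    fun n m => (h₂ n m).trans (h₂' _ _)⟩

instance setoid (k : Type u) (B : Type v) [Field k] [Ring B] [Algebra k B] :
    Setoid (StrictMoritaContext k B) where
  r := Isomorphic
  iseqv := ⟨Isomorphic.refl, Isomorphic.symm, Isomorphic.trans⟩

theorem contract_congr {M₁ N₁ M₂ N₂ M₁' N₁' M₂' N₂' : Bimodule k B}
    {α₁ : (M₁.tensor N₁).Iso (unit k B)} {α₂ : (M₂.tensor N₂).Iso (unit k B)}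
    {α₁' : (M₁'.tensor N₁').Iso (unit k B)} {α₂' : (M₂'.tensor N₂').Iso (unit k B)}
    (μ₁ : M₁.Iso M₁') (ν₁ : N₁.Iso N₁') (μ₂ : M₂.Iso M₂') (ν₂ : N₂.Iso N₂')
    (h₁ : ∀ m n, α₁.val (tmul M₁ N₁ m n) = α₁'.val (tmul M₁' N₁' (μ₁ m) (ν₁ n)))
    (h₂ : ∀ m n, α₂.val (tmul M₂ N₂ m n) = α₂'.val (tmul M₂' N₂' (μ₂ m) (ν₂ n)))
    (z : (M₁.tensor M₂).carrier) (w : (N₂.tensor N₁).carrier) :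
    (contract α₁ α₂).val (tmul _ _ z w) =
      (contract α₁' α₂').val (tmul _ _ ((μ₁.tensor μ₂) z) ((ν₂.tensor ν₁) w)) := by
  induction z using tensor_induction with
  | add x y hx hy => simp only [map_add, LinearMap.add_apply, hx, hy]
  | tmul m₁ m₂ =>
  induction w using tensor_induction with
  | add x y hx hy => simp only [map_add, hx, hy]
  | tmul n₂ n₁ =>
    rw [contract_tmul, Iso.tensor_tmul, Iso.tensor_tmul, contract_tmul, h₁, h₂, Iso.left']

theorem mul_congr {X X' Y Y' : StrictMoritaContext k B} (h : X.Isomorphic X')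
    (h' : Y.Isomorphic Y') : (X.mul Y).Isomorphic (X'.mul Y') := by
  obtain ⟨μ, ν, h₁, h₂⟩ := h
  obtain ⟨μ', ν', h₁', h₂'⟩ := h'
  exact ⟨μ.tensor μ', ν'.tensor ν, contract_congr μ ν μ' ν' h₁ h₁',
    contract_congr ν' μ' ν μ h₂' h₂⟩

theorem inv_congr {X Y : StrictMoritaContext k B} (h : X.Isomorphic Y) :
    X.inv.Isomorphic Y.inv := by
  obtain ⟨μ, ν, h₁, h₂⟩ := h
  exact ⟨ν, μ, h₂, h₁⟩

theorem contract_contract {M₁ N₁ M₂ N₂ M₃ N₃ : Bimodule k B} (α₁ : (M₁.tensor N₁).Iso (unit k B))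
    (α₂ : (M₂.tensor N₂).Iso (unit k B)) (α₃ : (M₃.tensor N₃).Iso (unit k B))
    (z : ((M₁.tensor M₂).tensor M₃).carrier) (w : (N₃.tensor (N₂.tensor N₁)).carrier) :
    (contract (contract α₁ α₂) α₃).val (tmul _ _ z w) =
      (contract α₁ (contract α₂ α₃)).val
        (tmul _ _ (assoc M₁ M₂ M₃ z) ((assoc N₃ N₂ N₁).symm w)) := by
  induction z using tensor_induction with
  | add x y hx hy => simp only [map_add, LinearMap.add_apply, hx, hy]
  | tmul z m₃ =>
  induction z using tensor_induction with
  | add x y hx hy => simp only [map_add, LinearMap.add_apply, hx, hy]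
  | tmul m₁ m₂ =>
  induction w using tensor_induction with
  | add x y hx hy => simp only [map_add, hx, hy]
  | tmul n₃ w =>
  induction w using tensor_induction with
  | add x y hx hy => simp only [map_add, hx, hy]
  | tmul n₂ n₁ =>
    rw [assoc_tmul, assoc_symm_tmul, contract_tmul, contract_tmul, contract_tmul, tensor_left,
      contract_tmul]

theorem mul_assoc_iso (X Y Z : StrictMoritaContext k B) :
    ((X.mul Y).mul Z).Isomorphic (X.mul (Y.mul Z)) := by
  refine ⟨assoc _ _ _, (assoc _ _ _).symm, fun z w => contract_contract _ _ _ z w, fun w z => ?_⟩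
  have := contract_contract Z.β Y.β X.β ((assoc _ _ _).symm w) (assoc _ _ _ z)
  have h₁ := (assoc Z.N Y.N X.N).apply_symm_apply w
  have h₂ := (assoc X.M Y.M Z.M).symm_apply_apply z
  exact ((congrArg₂ (fun a b => (contract Z.β (contract Y.β X.β)).val (tmul _ _ a b))
    h₁ h₂).symm.trans this.symm)

theorem contract_unit_left {M N : Bimodule k B} (α : (M.tensor N).Iso (unit k B))
    (z : ((unit k B).tensor M).carrier) (w : (N.tensor (unit k B)).carrier) :
    (contract (leftUnitor (unit k B)) α).val (tmul _ _ z w) =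
      α.val (tmul M N (leftUnitor M z) (rightUnitor N w)) := by
  induction z using tensor_induction with
  | add x y hx hy => simp only [map_add, LinearMap.add_apply, hx, hy]
  | tmul b m =>
  induction w using tensor_induction with
  | add x y hx hy => simp only [map_add, hx, hy]
  | tmul n c =>
    have h₁ := tensor_val_left α b m (N.right (op (c : B)) n)
    have h₂ := tensor_val_right α c m n
    rw [h₂] at h₁
    exact h₁.symm

theorem contract_unit_right {M N : Bimodule k B} (α : (M.tensor N).Iso (unit k B))
    (z : (M.tensor (unit k B)).carrier) (w : ((unit k B).tensor N).carrier) :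
    (contract α (leftUnitor (unit k B))).val (tmul _ _ z w) =
      α.val (tmul M N (rightUnitor M z) (leftUnitor N w)) := by
  induction z using tensor_induction with
  | add x y hx hy => simp only [map_add, LinearMap.add_apply, hx, hy]
  | tmul m b =>
  induction w using tensor_induction with
  | add x y hx hy => simp only [map_add, hx, hy]
  | tmul c n =>
    have h₁ := tmul_balanced m b (N.left (c : B) n)
    have h₂ : ∀ b c : B, N.left (b * c) n = N.left b (N.left c n) := fun b c => by simp
    exact (congrArg α.val (h₁.trans (congrArg (tmul M N m) (h₂ b c).symm))).symm

theorem one_mul_iso (X : StrictMoritaContext k B) : ((one k B).mul X).Isomorphic X :=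
  ⟨leftUnitor _, rightUnitor _, contract_unit_left X.α, contract_unit_right X.β⟩

theorem mul_one_iso (X : StrictMoritaContext k B) : (X.mul (one k B)).Isomorphic X :=
  ⟨rightUnitor _, leftUnitor _, contract_unit_right X.α, contract_unit_left X.β⟩

theorem inv_mul_iso (X : StrictMoritaContext k B) : (X.inv.mul X).Isomorphic (one k B) := by
  have h : ∀ z w, (contract X.β X.α).val (tmul _ _ z w) = (X.β.val z * X.β.val w : B) := by
    intro z w
    induction z using tensor_induction with
    | add x y hx hy => simp only [map_add, LinearMap.add_apply, hx, hy, add_mul]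
    | tmul n m =>
    induction w using tensor_induction with
    | add x y hx hy => simp only [map_add, hx, hy, mul_add]
    | tmul n' m' =>
      rw [contract_tmul, X.assoc_left, tensor_val_right]
  exact ⟨X.β, X.β, h, h⟩

end StrictMoritaContext

/-- The Picard group of the `k`-algebra `B`: isomorphism classes of strict Morita contexts. -/
def Pic (k : Type u) (B : Type v) [Field k] [Ring B] [Algebra k B] :=
  Quotient (StrictMoritaContext.setoid k B)

namespace Pic

variable {k : Type u} {B : Type v} [Field k] [Ring B] [Algebra k B]

/-- The class `[X]` of a strict Morita context. -/
def mk (X : StrictMoritaContext k B) : Pic k B := Quotient.mk _ X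

instance : Group (Pic k B) where
  mul := Quotient.map₂ StrictMoritaContext.mul fun _ _ h _ _ h' =>
    StrictMoritaContext.mul_congr h h'
  one := mk (StrictMoritaContext.one k B)
  inv := Quotient.map StrictMoritaContext.inv fun _ _ h => StrictMoritaContext.inv_congr h
  mul_assoc := by
    rintro ⟨X⟩ ⟨Y⟩ ⟨Z⟩
    exact Quotient.sound (StrictMoritaContext.mul_assoc_iso X Y Z)
  one_mul := by
    rintro ⟨X⟩
    exact Quotient.sound (StrictMoritaContext.one_mul_iso X)
  mul_one := by
    rintro ⟨X⟩
    exact Quotient.sound (StrictMoritaContext.mul_one_iso X)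
  inv_mul_cancel := by
    rintro ⟨X⟩
    exact Quotient.sound (StrictMoritaContext.inv_mul_iso X)

end Pic

section Coactions

variable {k : Type*} [Field k] {M N H : Type*} [AddCommGroup M] [Module k M] [AddCommGroup N]
  [Module k N] [AddCommGroup H] [Module k H]

/-- The map `m ⊗ n ↦ m₀ ⊗ n ⊗ m₁` for a map `ρ : m ↦ m₀ ⊗ m₁`. -/
noncomputable def coactFst (N : Type*) [AddCommGroup N] [Module k N] (ρ : M →ₗ[k] M ⊗[k] H) :
    M ⊗[k] N →ₗ[k] (M ⊗[k] N) ⊗[k] H :=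
  (TensorProduct.rightComm k M H N).toLinearMap ∘ₗ ρ.rTensor N

/-- The map `m ⊗ n ↦ m ⊗ n₀ ⊗ n₁` for a map `ρ : n ↦ n₀ ⊗ n₁`. -/
noncomputable def coactSnd (M : Type*) [AddCommGroup M] [Module k M] (ρ : N →ₗ[k] N ⊗[k] H) :
    M ⊗[k] N →ₗ[k] (M ⊗[k] N) ⊗[k] H :=
  (TensorProduct.assoc k M N H).symm.toLinearMap ∘ₗ ρ.lTensor M

theorem coactFst_tmul (ρ : M →ₗ[k] M ⊗[k] H) (m : M) (n : N) :
    coactFst N ρ (m ⊗ₜ n) = ((TensorProduct.mk k M N).flip n).rTensor H (ρ m) := by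
  have h : ∀ s : M ⊗[k] H, TensorProduct.rightComm k M H N (s ⊗ₜ n) =
      ((TensorProduct.mk k M N).flip n).rTensor H s := by
    intro s
    induction s using TensorProduct.induction_on with
    | zero => simp
    | add x y hx hy => simp only [map_add, TensorProduct.add_tmul, hx, hy]
    | tmul => rfl
  exact h _

theorem coactSnd_tmul (ρ : N →ₗ[k] N ⊗[k] H) (m : M) (n : N) :
    coactSnd M ρ (m ⊗ₜ n) = (TensorProduct.mk k M N m).rTensor H (ρ n) := by
  have h : ∀ s : N ⊗[k] H, (TensorProduct.assoc k M N H).symm (m ⊗ₜ s) =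
      (TensorProduct.mk k M N m).rTensor H s := by
    intro s
    induction s using TensorProduct.induction_on with
    | zero => simp
    | add x y hx hy => simp only [map_add, TensorProduct.tmul_add, hx, hy]
    | tmul => rfl
  exact h _

theorem coactFst_coassoc (ρ : M →ₗ[k] M ⊗[k] H) (Δ : H →ₗ[k] H ⊗[k] H)
    (h : ∀ m, TensorProduct.assoc k M H H (ρ.rTensor H (ρ m)) = Δ.lTensor M (ρ m))
    (x : M ⊗[k] N) :
    TensorProduct.assoc k _ H H ((coactFst N ρ).rTensor H (coactFst N ρ x)) =
      Δ.lTensor _ (coactFst N ρ x) := by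
  induction x using TensorProduct.induction_on with
  | zero => simp
  | add x y hx hy => simp only [map_add, hx, hy]
  | tmul m n =>
    have h₁ : ∀ s : M ⊗[k] H, TensorProduct.assoc k _ H H ((coactFst N ρ).rTensor H
        (((TensorProduct.mk k M N).flip n).rTensor H s)) =
        ((TensorProduct.mk k M N).flip n).rTensor (H ⊗[k] H)
          (TensorProduct.assoc k M H H (ρ.rTensor H s)) := by
      intro s
      induction s using TensorProduct.induction_on with
      | zero => simp
      | add x y hx hy => simp only [map_add, hx, hy]
      | tmul m h =>
        have h₂ : ∀ t : M ⊗[k] H, TensorProduct.assoc k _ H H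
            ((((TensorProduct.mk k M N).flip n).rTensor H t) ⊗ₜ[k] h) =
          ((TensorProduct.mk k M N).flip n).rTensor (H ⊗[k] H)
            (TensorProduct.assoc k M H H (t ⊗ₜ[k] h)) := by
          intro t
          induction t using TensorProduct.induction_on with
          | zero => simp
          | add x y hx hy => simp only [map_add, TensorProduct.add_tmul, hx, hy]
          | tmul => rfl
        rw [LinearMap.rTensor_tmul, LinearMap.rTensor_tmul, LinearMap.rTensor_tmul, ← h₂,
          LinearMap.flip_apply, TensorProduct.mk_apply, coactFst_tmul]
    rw [coactFst_tmul, h₁, h]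
    exact LinearMap.congr_fun ((LinearMap.rTensor_comp_lTensor _ _ _).trans
      (LinearMap.lTensor_comp_rTensor _ _ _).symm) (ρ m)

theorem coactSnd_coactFst (ρ : M →ₗ[k] M ⊗[k] H) (ρ' : N →ₗ[k] N ⊗[k] H) (x : M ⊗[k] N) :
    TensorProduct.assoc k _ H H ((coactSnd M ρ').rTensor H (coactFst N ρ x)) =
      (TensorProduct.comm k H H).toLinearMap.lTensor _
        (TensorProduct.assoc k _ H H ((coactFst N ρ).rTensor H (coactSnd M ρ' x))) := by
  induction x using TensorProduct.induction_on with
  | zero => simp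
  | add x y hx hy => simp only [map_add, hx, hy]
  | tmul m n =>
    rw [coactFst_tmul, coactSnd_tmul]
    have hL : ∀ s : M ⊗[k] H, TensorProduct.assoc k _ H H ((coactSnd M ρ').rTensor H
        (((TensorProduct.mk k M N).flip n).rTensor H s)) =
        (TensorProduct.comm k H H).toLinearMap.lTensor _
          (TensorProduct.tensorTensorTensorComm k M H N H (s ⊗ₜ ρ' n)) := by
      intro s
      induction s using TensorProduct.induction_on with
      | zero => simp
      | add x y hx hy => simp only [map_add, TensorProduct.add_tmul, hx, hy]
      | tmul b h =>
        have h₂ : ∀ t : N ⊗[k] H, TensorProduct.assoc k _ H H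
            ((TensorProduct.mk k M N b).rTensor H t ⊗ₜ[k] h) =
          (TensorProduct.comm k H H).toLinearMap.lTensor _
            (TensorProduct.tensorTensorTensorComm k M H N H ((b ⊗ₜ h) ⊗ₜ t)) := by
          intro t
          induction t using TensorProduct.induction_on with
          | zero => simp
          | add x y hx hy =>
            simp only [map_add, TensorProduct.add_tmul, TensorProduct.tmul_add, hx, hy]
          | tmul => rfl
        rw [← h₂ (ρ' n), LinearMap.rTensor_tmul, LinearMap.flip_apply, TensorProduct.mk_apply,
          LinearMap.rTensor_tmul, coactSnd_tmul]
    have hR : ∀ t : N ⊗[k] H, TensorProduct.assoc k _ H H ((coactFst N ρ).rTensor H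
        ((TensorProduct.mk k M N m).rTensor H t)) =
          TensorProduct.tensorTensorTensorComm k M H N H (ρ m ⊗ₜ t) := by
      intro t
      induction t using TensorProduct.induction_on with
      | zero => simp
      | add x y hx hy => simp only [map_add, TensorProduct.tmul_add, hx, hy]
      | tmul b h =>
        have h₂ : ∀ s : M ⊗[k] H, TensorProduct.assoc k _ H H
            ((((TensorProduct.mk k M N).flip b).rTensor H s) ⊗ₜ[k] h) =
            TensorProduct.tensorTensorTensorComm k M H N H (s ⊗ₜ (b ⊗ₜ h)) := by
          intro s
          induction s using TensorProduct.induction_on with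
          | zero => simp
          | add x y hx hy => simp only [map_add, TensorProduct.add_tmul, hx, hy]
          | tmul => rfl
        rw [LinearMap.rTensor_tmul, LinearMap.rTensor_tmul, TensorProduct.mk_apply, coactFst_tmul,
          h₂]
    rw [hL, hR]

theorem coactFst_map_fst (ρ : M →ₗ[k] M ⊗[k] H) (f : M →ₗ[k] M)
    (hf : ∀ m, ρ (f m) = f.rTensor H (ρ m)) (x : M ⊗[k] N) :
    coactFst N ρ (f.rTensor N x) = (f.rTensor N).rTensor H (coactFst N ρ x) := by
  induction x using TensorProduct.induction_on with
  | zero => simp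
  | add x y hx hy => simp only [map_add, hx, hy]
  | tmul m n =>
    rw [LinearMap.rTensor_tmul, coactFst_tmul, coactFst_tmul, hf,
      ← LinearMap.rTensor_comp_apply, ← LinearMap.rTensor_comp_apply]
    rfl

theorem coactFst_map_snd (ρ : M →ₗ[k] M ⊗[k] H) (f : N →ₗ[k] N) (x : M ⊗[k] N) :
    coactFst N ρ (f.lTensor M x) = (f.lTensor M).rTensor H (coactFst N ρ x) := by
  induction x using TensorProduct.induction_on with
  | zero => simp
  | add x y hx hy => simp only [map_add, hx, hy]
  | tmul m n =>
    rw [LinearMap.lTensor_tmul, coactFst_tmul, coactFst_tmul, ← LinearMap.rTensor_comp_apply]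
    rfl

theorem coactSnd_map_fst (ρ : N →ₗ[k] N ⊗[k] H) (f : M →ₗ[k] M) (x : M ⊗[k] N) :
    coactSnd M ρ (f.rTensor N x) = (f.rTensor N).rTensor H (coactSnd M ρ x) := by
  induction x using TensorProduct.induction_on with
  | zero => simp
  | add x y hx hy => simp only [map_add, hx, hy]
  | tmul m n =>
    rw [LinearMap.rTensor_tmul, coactSnd_tmul, coactSnd_tmul, ← LinearMap.rTensor_comp_apply]
    rfl

theorem coactSnd_map_snd (ρ : N →ₗ[k] N ⊗[k] H) (f : N →ₗ[k] N)
    (hf : ∀ n, ρ (f n) = f.rTensor H (ρ n)) (x : M ⊗[k] N) :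
    coactSnd M ρ (f.lTensor M x) = (f.lTensor M).rTensor H (coactSnd M ρ x) := by
  induction x using TensorProduct.induction_on with
  | zero => simp
  | add x y hx hy => simp only [map_add, hx, hy]
  | tmul m n =>
    rw [LinearMap.lTensor_tmul, coactSnd_tmul, coactSnd_tmul, hf,
      ← LinearMap.rTensor_comp_apply, ← LinearMap.rTensor_comp_apply]
    rfl

end Coactions
theorem Bimodule.commute {k : Type u} {B : Type v} [Field k] [Ring B] [Algebra k B]
    (M : Bimodule k B) (b : B) (c : Bᵐᵒᵖ) : Commute (M.left b) (M.right c) :=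
  LinearMap.ext (M.comm b c)

/-- A `B`-bimodule as a left module over `B^e = B ⊗ Bᵐᵒᵖ`: `(b ⊗ b') m = b m b'`. -/
noncomputable def Bimodule.env {k : Type u} {B : Type v} [Field k] [Ring B] [Algebra k B]
    (M : Bimodule k B) : B ⊗[k] Bᵐᵒᵖ →ₐ[k] Module.End k M.carrier :=
  Algebra.TensorProduct.lift M.left M.right M.commute

@[simp] theorem Bimodule.env_tmul {k : Type u} {B : Type v} [Field k] [Ring B] [Algebra k B]
    (M : Bimodule k B) (b : B) (c : Bᵐᵒᵖ) (m : M.carrier) :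
    M.env (b ⊗ₜ c) m = M.left b (M.right c m) := by
  exact congrArg (fun f => f m) (Algebra.TensorProduct.lift_tmul _ _ M.commute b c)

theorem Bimodule.Iso.env {k : Type u} {B : Type v} [Field k] [Ring B] [Algebra k B]
    {M N : Bimodule k B} (f : M.Iso N) (s : B ⊗[k] Bᵐᵒᵖ) (m : M.carrier) :
    f.toLinearEquiv (M.env s m) = N.env s (f.toLinearEquiv m) := by
  induction s using TensorProduct.induction_on with
  | zero => simp
  | add s t hs ht => simp only [map_add, LinearMap.add_apply, hs, ht]
  | tmul b c =>
    rw [env_tmul, env_tmul]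
    exact (f.left' b _).trans (congrArg _ (f.right' c m))

section Hopf

open Coalgebra (comul counit)

/-- A right `H`-comodule algebra structure on `A`, with coaction `a ↦ a₀ ⊗ a₁`. -/
structure ComoduleAlgebra (k : Type u) (H : Type w) (A : Type v) [Field k] [Ring H]
    [HopfAlgebra k H] [Ring A] [Algebra k A] where
  coact : A →ₐ[k] A ⊗[k] H
  coassoc : ∀ a, TensorProduct.assoc k A H H (coact.toLinearMap.rTensor H (coact a)) =
    (comul (R := k) (A := H)).lTensor A (coact a)
  counit : ∀ a, TensorProduct.rid k A ((counit (R := k) (A := H)).lTensor A (coact a)) = a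

/-- A left `R`-module `N` (given by `l`) is faithfully flat if `- ⊗_R N` preserves injectivity of
maps of right `R`-modules, and `X ⊗_R N = 0` only if `X = 0`. -/
def IsFaithfullyFlat {k : Type u} {R : Type v} {N : Type*} [Field k] [Ring R] [Algebra k R]
    [AddCommGroup N] [Module k N] (l : R →ₐ[k] Module.End k N) : Prop :=
  (∀ (X Y : Type v) [AddCommGroup X] [Module k X] [AddCommGroup Y] [Module k Y]
    (r : Rᵐᵒᵖ →ₐ[k] Module.End k X) (r' : Rᵐᵒᵖ →ₐ[k] Module.End k Y) (f : X →ₗ[k] Y)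
    (hf : ∀ b x, f (r (op b) x) = r' (op b) (f x)), Function.Injective f →
      Function.Injective
        (BTensor.map (l := l) (l' := l) f LinearMap.id hf fun _ _ => rfl)) ∧
  ∀ (X : Type v) [AddCommGroup X] [Module k X] (r : Rᵐᵒᵖ →ₐ[k] Module.End k X),
    Subsingleton (BTensor r l) → Subsingleton X

namespace ComoduleAlgebra

variable {k : Type u} {H : Type w} {A : Type v} [Field k] [Ring H] [HopfAlgebra k H]
  [Ring A] [Algebra k A] (δ : ComoduleAlgebra k H A)

/-- The subalgebra `A^{co H} = {a | a₀ ⊗ a₁ = a ⊗ 1}` of coinvariants. -/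
def coinv : Subalgebra k A :=
  AlgHom.equalizer δ.coact (Algebra.TensorProduct.includeLeft : A →ₐ[k] A ⊗[k] H)

theorem coact_coinv (b : δ.coinv) : δ.coact b = (b : A) ⊗ₜ[k] (1 : H) := b.2

/-- `A` as a left module over its coinvariants. -/
def leftB : δ.coinv →ₐ[k] Module.End k A := (Algebra.lmul k A).comp δ.coinv.val

/-- `A` as a right module over its coinvariants. -/
def rightB : δ.coinvᵐᵒᵖ →ₐ[k] Module.End k A :=
  (Algebra.lsmul k k A).comp (AlgHom.op δ.coinv.val)

/-- The canonical map `A ⊗_B A → A ⊗ H`, `a ⊗ a' ↦ a a'₀ ⊗ a'₁`. -/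
def can : BTensor δ.rightB δ.leftB →ₗ[k] A ⊗[k] H :=
  BTensor.lift
    (((LinearMap.mul k (A ⊗[k] H)).comp
      (Algebra.TensorProduct.includeLeft : A →ₐ[k] A ⊗[k] H).toLinearMap).compl₂
        δ.coact.toLinearMap)
    (fun a b a' => by
      show ((a * (b : A)) ⊗ₜ[k] (1 : H)) * δ.coact a' = (a ⊗ₜ[k] (1 : H)) * δ.coact ((b : A) * a')
      rw [map_mul, coact_coinv, ← mul_assoc, Algebra.TensorProduct.tmul_mul_tmul, mul_one])

/-- `A` is a faithfully flat `H`-Galois extension of `B = A^{co H}`: the canonical map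
is bijective and `A` is faithfully flat as a left `B`-module. -/
structure IsFaithfullyFlatGalois : Prop where
  can_bijective : Function.Bijective δ.can
  faithfullyFlat : IsFaithfullyFlat δ.leftB

/-- The map `a ⊗ a' ↦ a₀ ⊗ a' ⊗ a₁` on `A ⊗ A`. -/
noncomputable def coactLeft : A ⊗[k] A →ₗ[k] (A ⊗[k] A) ⊗[k] H :=
  coactFst A δ.coact.toLinearMap

/-- The map `a ↦ a₀ ⊗ S(a₁)`, the coaction of `H` on `Aᵒᵖ`. -/
noncomputable def coactOp : A →ₗ[k] A ⊗[k] H :=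
  (HopfAlgebra.antipode k).lTensor A ∘ₗ δ.coact.toLinearMap

/-- The map `a ⊗ a' ↦ a ⊗ a'₀ ⊗ S(a'₁)` on `A ⊗ A`. -/
noncomputable def coactRight : A ⊗[k] A →ₗ[k] (A ⊗[k] A) ⊗[k] H := coactSnd A δ.coactOp

/-- The cotensor product `A^{□e} = A □_H Aᵒᵖ`, where `H` coacts on `Aᵒᵖ` by `a ↦ a₀ ⊗ S(a₁)`.
It is regarded as a subspace of `A ⊗ A`. -/
noncomputable def box : Submodule k (A ⊗[k] A) := LinearMap.eqLocus δ.coactLeft δ.coactRight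

theorem coactLeft_tmul (a a' : A) :
    δ.coactLeft (a ⊗ₜ a') = ((TensorProduct.mk k A A).flip a').rTensor H (δ.coact a) :=
  coactFst_tmul _ _ _

theorem coactRight_tmul (a a' : A) :
    δ.coactRight (a ⊗ₜ a') = (TensorProduct.mk k A A a).rTensor H
      ((HopfAlgebra.antipode k).lTensor A (δ.coact a')) :=
  coactSnd_tmul _ _ _

theorem rTensor_box_injective : Function.Injective (δ.box.subtype.rTensor H) :=
  Module.Flat.rTensor_preserves_injective_linearMap _ Subtype.val_injective

section Actions

variable {S : Type*} [Ring S] [Algebra k S]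

/-- The action of `S` on `A` is `H`-colinear for the trivial coaction on `S`. -/
def IsColinear (σ : S →ₐ[k] Module.End k A) : Prop :=
  ∀ s a, δ.coact (σ s a) = (σ s).rTensor H (δ.coact a)

theorem isColinear_leftB : δ.IsColinear δ.leftB := by
  intro b a
  show δ.coact ((b : A) * a) = _
  rw [map_mul, coact_coinv]
  induction δ.coact a using TensorProduct.induction_on with
  | zero => simp
  | add x y hx hy => simp only [map_add, mul_add, hx, hy]
  | tmul a h => simp [leftB]

theorem isColinear_rightB : δ.IsColinear δ.rightB := by
  intro b a
  show δ.coact (a * (b.unop : A)) = _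
  rw [map_mul, coact_coinv]
  induction δ.coact a using TensorProduct.induction_on with
  | zero => simp
  | add x y hx hy => simp only [map_add, add_mul, hx, hy]
  | tmul a h => simp [rightB]

variable {δ}

theorem IsColinear.coactLeft_fst {σ : S →ₐ[k] Module.End k A} (hσ : δ.IsColinear σ) (s : S)
    (x : A ⊗[k] A) :
    δ.coactLeft ((σ s).rTensor A x) = ((σ s).rTensor A).rTensor H (δ.coactLeft x) :=
  coactFst_map_fst δ.coact.toLinearMap (σ s) (hσ s) x

theorem IsColinear.coactLeft_snd (σ : S →ₐ[k] Module.End k A) (s : S)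
    (x : A ⊗[k] A) :
    δ.coactLeft ((σ s).lTensor A x) = ((σ s).lTensor A).rTensor H (δ.coactLeft x) :=
  coactFst_map_snd δ.coact.toLinearMap (σ s) x

theorem IsColinear.coactRight_fst (σ : S →ₐ[k] Module.End k A) (s : S)
    (x : A ⊗[k] A) :
    δ.coactRight ((σ s).rTensor A x) = ((σ s).rTensor A).rTensor H (δ.coactRight x) :=
  coactSnd_map_fst δ.coactOp (σ s) x

theorem IsColinear.coactRight_snd {σ : S →ₐ[k] Module.End k A} (hσ : δ.IsColinear σ) (s : S)
    (x : A ⊗[k] A) :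
    δ.coactRight ((σ s).lTensor A x) = ((σ s).lTensor A).rTensor H (δ.coactRight x) := by
  refine coactSnd_map_snd δ.coactOp (σ s) (fun a => ?_) x
  refine (congrArg ((HopfAlgebra.antipode k).lTensor A) (hσ s a)).trans ?_
  exact LinearMap.congr_fun ((LinearMap.lTensor_comp_rTensor _ _ _).trans
    (LinearMap.rTensor_comp_lTensor _ _ _).symm) (δ.coact a)

/-- The action on `A^{□e}` induced by a colinear action on the first tensor factor. -/
noncomputable def boxFst (σ : S →ₐ[k] Module.End k A) (hσ : δ.IsColinear σ) :
    S →ₐ[k] Module.End k δ.box where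
  toFun s := ((σ s).rTensor A).restrict (p := δ.box) (q := δ.box) (fun x hx => by
    show δ.coactLeft _ = δ.coactRight _
    have hx : δ.coactLeft x = δ.coactRight x := hx
    rw [hσ.coactLeft_fst, IsColinear.coactRight_fst, hx])
  map_one' := by ext x; simp [Module.End.one_eq_id]
  map_mul' s t := by ext x; simp [LinearMap.rTensor_mul]
  map_zero' := by ext x; simp
  map_add' s t := by ext x; simp [LinearMap.rTensor_add]
  commutes' c := by ext x; simp [Algebra.algebraMap_eq_smul_one, LinearMap.rTensor_smul,
    Module.End.one_eq_id]

/-- The action on `A^{□e}` induced by a colinear action on the second tensor factor. -/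
noncomputable def boxSnd (σ : S →ₐ[k] Module.End k A) (hσ : δ.IsColinear σ) :
    S →ₐ[k] Module.End k δ.box where
  toFun s := ((σ s).lTensor A).restrict (p := δ.box) (q := δ.box) (fun x hx => by
    show δ.coactLeft _ = δ.coactRight _
    have hx : δ.coactLeft x = δ.coactRight x := hx
    rw [hσ.coactRight_snd, IsColinear.coactLeft_snd, hx])
  map_one' := by ext x; simp [Module.End.one_eq_id]
  map_mul' s t := by ext x; simp [LinearMap.lTensor_mul]
  map_zero' := by ext x; simp
  map_add' s t := by ext x; simp [LinearMap.lTensor_add]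
  commutes' c := by ext x; simp [Algebra.algebraMap_eq_smul_one, LinearMap.lTensor_smul,
    Module.End.one_eq_id]

@[simp] theorem boxFst_coe (σ : S →ₐ[k] Module.End k A) (hσ : δ.IsColinear σ) (s : S) (x : δ.box) :
    (boxFst σ hσ s x : A ⊗[k] A) = (σ s).rTensor A x := rfl

@[simp] theorem boxSnd_coe (σ : S →ₐ[k] Module.End k A) (hσ : δ.IsColinear σ) (s : S) (x : δ.box) :
    (boxSnd σ hσ s x : A ⊗[k] A) = (σ s).lTensor A x := rfl

theorem boxFst_boxSnd {T : Type*} [Ring T] [Algebra k T] (σ : S →ₐ[k] Module.End k A)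
    (hσ : δ.IsColinear σ) (τ : T →ₐ[k] Module.End k A) (hτ : δ.IsColinear τ) (s : S) (t : T)
    (x : δ.box) : boxFst σ hσ s (boxSnd τ hτ t x) = boxSnd τ hτ t (boxFst σ hσ s x) := by
  ext
  simp only [boxFst_coe, boxSnd_coe]
  rw [← LinearMap.comp_apply, ← LinearMap.comp_apply, LinearMap.rTensor_comp_lTensor,
    LinearMap.lTensor_comp_rTensor]

end Actions

theorem leftB_rightB (b : δ.coinv) (c : δ.coinvᵐᵒᵖ) (a : A) :
    δ.leftB b (δ.rightB c a) = δ.rightB c (δ.leftB b a) :=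
  (mul_assoc (b : A) a (c.unop : A)).symm

/-- The left `B`-action `b (∑ a ⊗ a') = ∑ b a ⊗ a'` on `A^{□e}`. -/
noncomputable def boxLeft : δ.coinv →ₐ[k] Module.End k δ.box :=
  boxFst δ.leftB δ.isColinear_leftB

/-- The right `B`-action `(∑ a ⊗ a') b = ∑ a ⊗ a' b` on `A^{□e}`. -/
noncomputable def boxRight : δ.coinvᵐᵒᵖ →ₐ[k] Module.End k δ.box :=
  boxSnd δ.rightB δ.isColinear_rightB

theorem boxInner_commute (b : δ.coinv) (c : δ.coinvᵐᵒᵖ) :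
    Commute (AlgHom.opComm.symm (boxFst δ.rightB δ.isColinear_rightB) b)
      (AlgHom.op (boxSnd δ.leftB δ.isColinear_leftB) c) := by
  apply MulOpposite.unop_injective
  apply LinearMap.ext
  intro x
  exact (boxFst_boxSnd δ.rightB δ.isColinear_rightB δ.leftB δ.isColinear_leftB
    (op b) c.unop x).symm

/-- The right action `(∑ a ⊗ a') (c ⊗ c') = ∑ a c ⊗ c' a'` of `B^e = B ⊗ Bᵐᵒᵖ` on `A^{□e}`. -/
noncomputable def boxInner :
    (δ.coinv ⊗[k] δ.coinvᵐᵒᵖ)ᵐᵒᵖ →ₐ[k] Module.End k δ.box :=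
  AlgHom.opComm (Algebra.TensorProduct.lift
    (AlgHom.opComm.symm (boxFst δ.rightB δ.isColinear_rightB))
    (AlgHom.op (boxSnd δ.leftB δ.isColinear_leftB)) δ.boxInner_commute)

theorem boxInner_tmul (c : δ.coinv) (c' : δ.coinvᵐᵒᵖ) (x : δ.box) :
    δ.boxInner (op (c ⊗ₜ c')) x = boxSnd δ.leftB δ.isColinear_leftB c'.unop
      (boxFst δ.rightB δ.isColinear_rightB (op c) x) := by
  have h : δ.boxInner (op (c ⊗ₜ c')) = boxSnd δ.leftB δ.isColinear_leftB c'.unop *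
      boxFst δ.rightB δ.isColinear_rightB (op c) := by
    apply MulOpposite.op_injective
    exact Algebra.TensorProduct.lift_tmul _ _ δ.boxInner_commute c c'
  rw [h]
  rfl

theorem boxLeft_boxInner (b : δ.coinv) (s : δ.coinv ⊗[k] δ.coinvᵐᵒᵖ) (x : δ.box) :
    δ.boxLeft b (δ.boxInner (op s) x) = δ.boxInner (op s) (δ.boxLeft b x) := by
  induction s using TensorProduct.induction_on with
  | zero => simp
  | add s t hs ht =>
    rw [MulOpposite.op_add, map_add, LinearMap.add_apply, map_add, hs, ht, LinearMap.add_apply]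
  | tmul c c' =>
    rw [boxInner_tmul, boxInner_tmul, boxLeft, boxFst_boxSnd]
    congr 1
    ext
    simp only [boxFst_coe, ← LinearMap.rTensor_comp_apply]
    congr 2
    ext a
    exact δ.leftB_rightB b (op c) a

theorem boxRight_boxInner (b : δ.coinvᵐᵒᵖ) (s : δ.coinv ⊗[k] δ.coinvᵐᵒᵖ) (x : δ.box) :
    δ.boxRight b (δ.boxInner (op s) x) = δ.boxInner (op s) (δ.boxRight b x) := by
  induction s using TensorProduct.induction_on with
  | zero => simp
  | add s t hs ht =>
    rw [MulOpposite.op_add, map_add, LinearMap.add_apply, map_add, hs, ht, LinearMap.add_apply]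
  | tmul c c' =>
    rw [boxInner_tmul, boxInner_tmul, boxRight, boxFst_boxSnd]
    ext
    simp only [boxSnd_coe, ← LinearMap.lTensor_comp_apply]
    congr 2
    ext a
    exact (δ.leftB_rightB c'.unop b a).symm

/-- The `B`-bimodule `A^{□e} ⊗_{B^e} M`. -/
noncomputable def boxTensor (M : Bimodule k δ.coinv) : Bimodule k δ.coinv where
  carrier := BTensor δ.boxInner M.env
  left := BTensor.actLeft δ.boxLeft δ.boxLeft_boxInner M.env
  right := BTensor.actLeft δ.boxRight δ.boxRight_boxInner M.env
  comm := BTensor.actLeft_comm _ _ _ _ (boxFst_boxSnd _ _ _ _)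

/-- The class `x ⊗_{B^e} m`. -/
noncomputable def boxMk (M : Bimodule k δ.coinv) :
    δ.box →ₗ[k] M.carrier →ₗ[k] (δ.boxTensor M).carrier :=
  BTensor.mk δ.boxInner M.env

theorem boxMk_balanced (M : Bimodule k δ.coinv) (x : δ.box) (s : δ.coinv ⊗[k] δ.coinvᵐᵒᵖ)
    (m : M.carrier) : δ.boxMk M (δ.boxInner (op s) x) m = δ.boxMk M x (M.env s m) :=
  BTensor.mk_balanced x s m

/-- The map `A^{□e} ⊗_{B^e} f` for a morphism `f` of `B`-bimodules. -/
noncomputable def boxTensorMap {M N : Bimodule k δ.coinv} (f : M.Iso N) :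
    (δ.boxTensor M).carrier →ₗ[k] (δ.boxTensor N).carrier :=
  BTensor.map LinearMap.id f.toLinearEquiv.toLinearMap (fun _ _ => rfl) f.env

variable [Coalgebra.IsCocomm k H]

theorem coactLeft_mem_range (x : δ.box) :
    δ.coactLeft x ∈ LinearMap.range (δ.box.subtype.rTensor H) := by
  have hx : δ.coactLeft x = δ.coactRight x := x.2
  have hex : Function.Exact δ.box.subtype (δ.coactLeft - δ.coactRight) := by
    intro y
    rw [LinearMap.sub_apply, sub_eq_zero]
    exact ⟨fun h => ⟨⟨y, h⟩, rfl⟩, by rintro ⟨z, rfl⟩; exact z.2⟩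
  refine (Module.Flat.rTensor_exact H hex _).1 ?_
  have hs : (δ.coactLeft - δ.coactRight).rTensor H (δ.coactLeft x) =
      δ.coactLeft.rTensor H (δ.coactLeft x) - δ.coactRight.rTensor H (δ.coactLeft x) := by
    rw [LinearMap.rTensor_sub]; rfl
  refine hs.trans (sub_eq_zero.2 ?_)
  apply (TensorProduct.assoc k _ H H).injective
  have h₁ := coactFst_coassoc δ.coact.toLinearMap (comul (R := k) (A := H)) δ.coassoc x.1 (N := A)
  have h₂ : TensorProduct.assoc k _ H H (δ.coactRight.rTensor H (δ.coactLeft x)) =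
      (TensorProduct.comm k H H).toLinearMap.lTensor _
        (TensorProduct.assoc k _ H H (δ.coactLeft.rTensor H (δ.coactRight x))) :=
    coactSnd_coactFst δ.coact.toLinearMap δ.coactOp x.1
  rw [h₂, ← hx]
  refine h₁.trans (Eq.trans ?_ (congrArg _ h₁.symm))
  rw [← LinearMap.lTensor_comp_apply, Coalgebra.comm_comp_comul]

/-- The coaction of `H` on `A^{□e}`, the restriction of `a ⊗ a' ↦ a₀ ⊗ a' ⊗ a₁`. -/
noncomputable def boxCoact : δ.box →ₗ[k] δ.box ⊗[k] H :=
  (LinearEquiv.ofInjective _ δ.rTensor_box_injective).symm.toLinearMap ∘ₗ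
    (δ.coactLeft ∘ₗ δ.box.subtype).codRestrict _ δ.coactLeft_mem_range

theorem boxCoact_spec (x : δ.box) :
    δ.box.subtype.rTensor H (δ.boxCoact x) = δ.coactLeft x := by
  have := LinearEquiv.apply_symm_apply (LinearEquiv.ofInjective _ δ.rTensor_box_injective)
    ((δ.coactLeft ∘ₗ δ.box.subtype).codRestrict _ δ.coactLeft_mem_range x)
  exact congrArg Subtype.val this

/-- An endomorphism of `A^{□e}` is `H`-colinear. -/
theorem boxCoact_of_coactLeft (f : A ⊗[k] A →ₗ[k] A ⊗[k] A) (g : δ.box →ₗ[k] δ.box)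
    (hfg : ∀ x, (g x : A ⊗[k] A) = f x)
    (hf : ∀ x, δ.coactLeft (f x) = f.rTensor H (δ.coactLeft x)) (x : δ.box) :
    δ.boxCoact (g x) = g.rTensor H (δ.boxCoact x) := by
  apply δ.rTensor_box_injective
  have h : δ.box.subtype ∘ₗ g = f ∘ₗ δ.box.subtype := LinearMap.ext hfg
  rw [boxCoact_spec, hfg, hf, ← LinearMap.rTensor_comp_apply, h, LinearMap.rTensor_comp_apply,
    boxCoact_spec]

theorem boxCoact_boxInner (s : δ.coinv ⊗[k] δ.coinvᵐᵒᵖ) (x : δ.box) :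
    δ.boxCoact (δ.boxInner (op s) x) = (δ.boxInner (op s)).rTensor H (δ.boxCoact x) := by
  induction s using TensorProduct.induction_on with
  | zero => simp
  | add s t hs ht =>
    rw [MulOpposite.op_add, map_add, LinearMap.add_apply, map_add, hs, ht, LinearMap.rTensor_add,
      LinearMap.add_apply]
  | tmul c c' =>
    refine δ.boxCoact_of_coactLeft
      ((δ.leftB c'.unop).lTensor A ∘ₗ (δ.rightB (op c)).rTensor A) _ (fun x => ?_) (fun x => ?_) x
    · rw [boxInner_tmul, boxSnd_coe, boxFst_coe]
      rfl
    · rw [LinearMap.comp_apply, IsColinear.coactLeft_snd, δ.isColinear_rightB.coactLeft_fst,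
        ← LinearMap.rTensor_comp_apply]

/-- The coaction `x ⊗_{B^e} m ↦ (x₀ ⊗_{B^e} m) ⊗ x₁` on `A^{□e} ⊗_{B^e} M`. -/
noncomputable def boxTensorCoact (M : Bimodule k δ.coinv) :
    (δ.boxTensor M).carrier →ₗ[k] (δ.boxTensor M).carrier ⊗[k] H :=
  BTensor.lift ((LinearMap.rTensorHom H ∘ₗ (δ.boxMk M).flip).flip ∘ₗ δ.boxCoact) (by
    intro x s m
    show ((δ.boxMk M).flip m).rTensor H (δ.boxCoact (δ.boxInner (op s) x)) =
      ((δ.boxMk M).flip (M.env s m)).rTensor H (δ.boxCoact x)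
    rw [boxCoact_boxInner, ← LinearMap.rTensor_comp_apply]
    congr 2
    ext x
    exact δ.boxMk_balanced M x s m)

theorem boxTensorCoact_boxMk (M : Bimodule k δ.coinv) (x : δ.box) (m : M.carrier) :
    δ.boxTensorCoact M (δ.boxMk M x m) = ((δ.boxMk M).flip m).rTensor H (δ.boxCoact x) := rfl

/-- The map `a ⊗ a' ↦ a b a'`. -/
noncomputable def sandwich (b : A) : A ⊗[k] A →ₗ[k] A :=
  TensorProduct.lift ((LinearMap.mul k A).comp (LinearMap.mulRight k b))

@[simp] theorem sandwich_tmul (b a a' : A) :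
    sandwich (k := k) b (a ⊗ₜ a') = a * b * a' := rfl

theorem antipode_comp_coact (a : A) :
    (TensorProduct.lift ((LinearMap.mul k H).flip.compl₂ (HopfAlgebra.antipode k))).lTensor A
      (TensorProduct.assoc k A H H (δ.coact.toLinearMap.rTensor H (δ.coact a))) = a ⊗ₜ 1 := by
  have h : TensorProduct.lift ((LinearMap.mul k H).flip.compl₂ (HopfAlgebra.antipode k)) ∘ₗ
      comul (R := k) (A := H) = Algebra.linearMap k H ∘ₗ Coalgebra.counit (R := k) (A := H) := by
    rw [← HopfAlgebra.mul_antipode_rTensor_comul]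
    conv_rhs => rw [← Coalgebra.comm_comp_comul]
    rw [← LinearMap.comp_assoc, ← LinearMap.comp_assoc]
    congr 1
    ext x y
    rfl
  rw [δ.coassoc, ← LinearMap.lTensor_comp_apply, h, LinearMap.lTensor_comp_apply]
  have h₁ : (Coalgebra.counit (R := k) (A := H)).lTensor A (δ.coact a) = a ⊗ₜ 1 := by
    apply (TensorProduct.rid k A).injective
    rw [δ.counit]
    simp
  rw [h₁]
  simp

theorem coact_sandwich (x : δ.box) (b : δ.coinv) :
    δ.coact (sandwich (b : A) (x : A ⊗[k] A)) = sandwich (b : A) (x : A ⊗[k] A) ⊗ₜ 1 := by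
  let W : (A ⊗[k] A) ⊗[k] H →ₗ[k] A ⊗[k] H :=
    TensorProduct.lift ((LinearMap.mul k (A ⊗[k] H)).compl₂ δ.coact.toLinearMap) ∘ₗ
      ((LinearMap.mulRight k (b : A)).rTensor H).rTensor A ∘ₗ
        (TensorProduct.rightComm k A A H).toLinearMap
  have hW : ∀ a a' h, W ((a ⊗ₜ a') ⊗ₜ h) = ((a * (b : A)) ⊗ₜ h) * δ.coact a' := fun _ _ _ => rfl
  have hL : ∀ y : A ⊗[k] A, W (δ.coactLeft y) = δ.coact (sandwich (b : A) y) := by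
    intro y
    induction y using TensorProduct.induction_on with
    | zero => simp
    | add y z hy hz => simp only [map_add, hy, hz]
    | tmul a a' =>
      rw [coactLeft_tmul, sandwich_tmul, map_mul, map_mul, coact_coinv]
      induction δ.coact a using TensorProduct.induction_on with
      | zero => simp
      | add y z hy hz => simp only [map_add, add_mul, hy, hz]
      | tmul c h => simp [hW]
  have hR : ∀ y : A ⊗[k] A, W (δ.coactRight y) = sandwich (b : A) y ⊗ₜ 1 := by
    intro y
    induction y using TensorProduct.induction_on with
    | zero => simp
    | add y z hy hz => simp only [map_add, TensorProduct.add_tmul, hy, hz]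
    | tmul a a' =>
      have h₁ : ∀ s : A ⊗[k] H, W ((TensorProduct.mk k A A a).rTensor H
          ((HopfAlgebra.antipode k).lTensor A s)) = ((a * (b : A)) ⊗ₜ 1) *
          (TensorProduct.lift ((LinearMap.mul k H).flip.compl₂ (HopfAlgebra.antipode k))).lTensor A
            (TensorProduct.assoc k A H H (δ.coact.toLinearMap.rTensor H s)) := by
        intro s
        induction s using TensorProduct.induction_on with
        | zero => simp
        | add y z hy hz => simp only [map_add, mul_add, hy, hz]
        | tmul c h =>
          have h₂ : ∀ t : A ⊗[k] H, ((a * (b : A)) ⊗ₜ[k] (HopfAlgebra.antipode k h)) * t =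
              ((a * (b : A)) ⊗ₜ 1) * (TensorProduct.lift ((LinearMap.mul k H).flip.compl₂
                (HopfAlgebra.antipode k))).lTensor A (TensorProduct.assoc k A H H (t ⊗ₜ h)) := by
            intro t
            induction t using TensorProduct.induction_on with
            | zero => simp
            | add y z hy hz => simp only [map_add, TensorProduct.add_tmul, mul_add, hy, hz]
            | tmul => simp
          exact h₂ (δ.coact c)
      rw [coactRight_tmul, h₁, antipode_comp_coact]
      simp
  have hx : δ.coactLeft x = δ.coactRight x := x.2
  rw [← hL, hx, hR]

/-- The action `(∑ a ⊗ a') b = ∑ a b a'` of `A^{□e}` on `B`. -/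
noncomputable def boxAct : δ.box →ₗ[k] δ.coinv →ₗ[k] δ.coinv :=
  LinearMap.mk₂ k (fun x b => ⟨sandwich (b : A) (x : A ⊗[k] A), δ.coact_sandwich x b⟩)
    (fun x y b => Subtype.ext (map_add _ _ _))
    (fun c x b => Subtype.ext (map_smul _ _ _))
    (fun x b c => Subtype.ext (by
      show sandwich ((b : A) + c) (x : A ⊗[k] A) = sandwich (b : A) x.1 + sandwich (c : A) x.1
      induction x.1 using TensorProduct.induction_on with
      | zero => simp
      | add y z hy hz => simp only [map_add, hy, hz]; abel
      | tmul a a' => simp [mul_add, add_mul]))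
    (fun c x b => Subtype.ext (by
      show sandwich (c • (b : A)) (x : A ⊗[k] A) = c • sandwich (b : A) x.1
      induction x.1 using TensorProduct.induction_on with
      | zero => simp
      | add y z hy hz => simp only [map_add, hy, hz, smul_add]
      | tmul a a' => simp))

/-- The same action, on the unit bimodule. -/
noncomputable def boxActUnit :
    δ.box →ₗ[k] (Bimodule.unit k δ.coinv).carrier →ₗ[k] δ.coinv := δ.boxAct

theorem boxActUnit_boxInner (x : δ.box) (s : δ.coinv ⊗[k] δ.coinvᵐᵒᵖ)
    (b : (Bimodule.unit k δ.coinv).carrier) :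
    δ.boxActUnit (δ.boxInner (op s) x) b =
      δ.boxActUnit x ((Bimodule.unit k δ.coinv).env s b) := by
  induction s using TensorProduct.induction_on with
  | zero => simp
  | add s t hs ht =>
    rw [MulOpposite.op_add, map_add, LinearMap.add_apply, map_add, LinearMap.add_apply, hs, ht,
      map_add, LinearMap.add_apply, map_add]
  | tmul c c' =>
    rw [boxInner_tmul, Bimodule.env_tmul]
    change δ.coinv at b
    apply Subtype.ext
    show sandwich (b : A) ((δ.leftB c'.unop).lTensor A ((δ.rightB (op c)).rTensor A x.1)) =
      sandwich ((c : A) * ((b : A) * (c'.unop : A))) x.1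
    induction x.1 using TensorProduct.induction_on with
    | zero => simp
    | add y z hy hz => simp only [map_add, hy, hz]
    | tmul a a' =>
      show a * (c : A) * (b : A) * ((c'.unop : A) * a') =
        a * ((c : A) * ((b : A) * (c'.unop : A))) * a'
      simp only [mul_assoc]

/-- The map `φ_B : A^{□e} ⊗_{B^e} B → B ⊗ H`, `∑ (a ⊗ a') ⊗ b ↦ ∑ a₀ b a' ⊗ a₁`. -/
noncomputable def unitStable :
    (δ.boxTensor (Bimodule.unit k δ.coinv)).carrier →ₗ[k] δ.coinv ⊗[k] H :=
  (BTensor.lift δ.boxActUnit δ.boxActUnit_boxInner).rTensor H ∘ₗ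
    δ.boxTensorCoact (Bimodule.unit k δ.coinv)

end ComoduleAlgebra

namespace Bimodule

variable {k : Type u} {B : Type v} [Field k] [Ring B] [Algebra k B] {M N M' N' : Bimodule k B}

/-- The left `B`-action `b (m ⊗ h) = b m ⊗ h` on `M ⊗ H`. -/
noncomputable def leftH (M : Bimodule k B) (H : Type w) [AddCommGroup H] [Module k H] :
    B →ₐ[k] Module.End k (M.carrier ⊗[k] H) :=
  (Module.End.rTensorAlgHom k M.carrier H).comp M.left

/-- The right `B`-action `(m ⊗ h) b = m b ⊗ h` on `M ⊗ H`. -/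
noncomputable def rightH (M : Bimodule k B) (H : Type w) [AddCommGroup H] [Module k H] :
    Bᵐᵒᵖ →ₐ[k] Module.End k (M.carrier ⊗[k] H) :=
  (Module.End.rTensorAlgHom k M.carrier H).comp M.right

variable (M N) (H : Type w) [Ring H] [HopfAlgebra k H]

/-- The map `(m ⊗ n) ⊗ h ↦ (m ⊗ h₁) ⊗_B (n ⊗ h₂)`, for the tensor product of vector spaces. -/
noncomputable def preKappa :
    (M.carrier ⊗[k] N.carrier) ⊗[k] H →ₗ[k] BTensor (M.rightH H) (N.leftH H) :=
  TensorProduct.lift (BTensor.mk (M.rightH H) (N.leftH H)) ∘ₗ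
    (TensorProduct.tensorTensorTensorComm k M.carrier N.carrier H H).toLinearMap ∘ₗ
      (comul (R := k) (A := H)).lTensor _

theorem preKappa_balanced (m : M.carrier) (b : B) (n : N.carrier) (h : H) :
    preKappa M N H ((M.right (op b) m ⊗ₜ n) ⊗ₜ h) = preKappa M N H ((m ⊗ₜ N.left b n) ⊗ₜ h) := by
  simp only [preKappa, LinearMap.comp_apply, LinearMap.lTensor_tmul]
  induction comul (R := k) h using TensorProduct.induction_on with
  | zero => simp
  | add x y hx hy => simp only [TensorProduct.tmul_add, map_add, hx, hy]
  | tmul h h' =>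
    exact BTensor.mk_balanced (r := M.rightH H) (l := N.leftH H) (m ⊗ₜ h) b (n ⊗ₜ h')

/-- The map `κ : (M ⊗_B N) ⊗ H → (M ⊗ H) ⊗_B (N ⊗ H)`,
`m ⊗_B n ⊗ h ↦ (m ⊗ h₁) ⊗_B (n ⊗ h₂)`. -/
noncomputable def kappa :
    (M.tensor N).carrier ⊗[k] H →ₗ[k] BTensor (M.rightH H) (N.leftH H) :=
  TensorProduct.lift (BTensor.lift
    (TensorProduct.curry (TensorProduct.curry (preKappa M N H)))
    (fun m b n => LinearMap.ext (preKappa_balanced M N H m b n)))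

end Bimodule

namespace ComoduleAlgebra

variable {k : Type u} {H : Type w} {A : Type v} [Field k] [Ring H] [HopfAlgebra k H]
  [Ring A] [Algebra k A] (δ : ComoduleAlgebra k H A)

/-- The map `γ : H → A ⊗_B A`, `h ↦ can⁻¹(1 ⊗ h)`, written `∑ l(h) ⊗_B r(h)`. -/
noncomputable def gamma (hA : δ.IsFaithfullyFlatGalois) :
    H →ₗ[k] BTensor δ.rightB δ.leftB :=
  (LinearEquiv.ofBijective δ.can hA.can_bijective).symm.toLinearMap ∘ₗ TensorProduct.mk k A H 1

/-- The right `B`-action `(a ⊗ a') b = a ⊗ a' b` on `A ⊗ A`. -/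
noncomputable def rightAA : δ.coinvᵐᵒᵖ →ₐ[k] Module.End k (A ⊗[k] A) :=
  (Module.End.lTensorAlgHom k A A).comp δ.rightB

/-- The left `B`-action `b (a ⊗ a') = b a ⊗ a'` on `A ⊗ A`. -/
noncomputable def leftAA : δ.coinv →ₐ[k] Module.End k (A ⊗[k] A) :=
  (Module.End.rTensorAlgHom k A A).comp δ.leftB

/-- The map `(a ⊗ a') ⊗ (l ⊗ r) ↦ (a ⊗ l) ⊗_B (r ⊗ a')`. -/
noncomputable def preInsert :
    (A ⊗[k] A) ⊗[k] (A ⊗[k] A) →ₗ[k] BTensor δ.rightAA δ.leftAA :=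
  TensorProduct.lift (BTensor.mk δ.rightAA δ.leftAA) ∘ₗ
    (TensorProduct.comm k A A).toLinearMap.lTensor (A ⊗[k] A) ∘ₗ
      (TensorProduct.tensorTensorTensorComm k A A A A).toLinearMap

theorem preInsert_tmul (a a' l r : A) : δ.preInsert ((a ⊗ₜ a') ⊗ₜ (l ⊗ₜ r)) =
    BTensor.mk δ.rightAA δ.leftAA (a ⊗ₜ l) (r ⊗ₜ a') := rfl

theorem preInsert_balanced (l : A) (b : δ.coinv) (r : A) (x : A ⊗[k] A) :
    δ.preInsert (x ⊗ₜ (δ.rightB (op b) l ⊗ₜ r)) = δ.preInsert (x ⊗ₜ (l ⊗ₜ δ.leftB b r)) := by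
  induction x using TensorProduct.induction_on with
  | zero => simp
  | add x y hx hy => simp only [TensorProduct.add_tmul, map_add, hx, hy]
  | tmul a a' =>
    exact BTensor.mk_balanced (r := δ.rightAA) (l := δ.leftAA) (a ⊗ₜ l) b (r ⊗ₜ a')

/-- The map `l ⊗_B r ↦ (a ⊗ a' ↦ (a ⊗ l) ⊗_B (r ⊗ a'))`. -/
noncomputable def insert :
    BTensor δ.rightB δ.leftB →ₗ[k] A ⊗[k] A →ₗ[k] BTensor δ.rightAA δ.leftAA :=
  BTensor.lift
    (TensorProduct.curry (TensorProduct.curry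
      (δ.preInsert ∘ₗ (TensorProduct.comm k (A ⊗[k] A) (A ⊗[k] A)).toLinearMap)))
    (fun l b r => LinearMap.ext (δ.preInsert_balanced l b r))

theorem insert_mk (l r a a' : A) : δ.insert (BTensor.mk δ.rightB δ.leftB l r) (a ⊗ₜ a') =
    BTensor.mk δ.rightAA δ.leftAA (a ⊗ₜ l) (r ⊗ₜ a') := rfl

/-- The map `∑ a ⊗ a' ↦ ∑ (a₀ ⊗ l(a₁)) ⊗_B (r(a₁) ⊗ a')`. -/
noncomputable def split (hA : δ.IsFaithfullyFlatGalois) :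
    A ⊗[k] A →ₗ[k] BTensor δ.rightAA δ.leftAA :=
  TensorProduct.lift (δ.insert.flip.compl₂ (δ.gamma hA)) ∘ₗ δ.coactLeft

/-- The map `A^{□e} ⊗_B A^{□e} → (A ⊗ A) ⊗_B (A ⊗ A)` induced by the inclusion. -/
noncomputable def boxIncl : BTensor δ.boxRight δ.boxLeft →ₗ[k] BTensor δ.rightAA δ.leftAA :=
  BTensor.map δ.box.subtype δ.box.subtype (fun _ _ => rfl) (fun _ _ => rfl)

/-- The map `A^{□e} ⊗_B A^{□e} → (A^{□e} ⊗_{B^e} M) ⊗_B (A^{□e} ⊗_{B^e} M')`,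
`x ⊗_B y ↦ (x ⊗ m) ⊗_B (y ⊗ m')`. -/
noncomputable def boxInsert (M M' : Bimodule k δ.coinv) (m : M.carrier) (m' : M'.carrier) :
    BTensor δ.boxRight δ.boxLeft →ₗ[k] ((δ.boxTensor M).tensor (δ.boxTensor M')).carrier :=
  BTensor.map ((δ.boxMk M).flip m) ((δ.boxMk M').flip m') (fun _ _ => rfl) (fun _ _ => rfl)

/-- `g` is the canonical map `A^{□e} ⊗_{B^e} (M ⊗_B M') →
(A^{□e} ⊗_{B^e} M) ⊗_B (A^{□e} ⊗_{B^e} M')`,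
`∑ (a ⊗ a') ⊗ (m ⊗ m') ↦ ∑ ((a₀ ⊗ l(a₁)) ⊗ m) ⊗_B ((r(a₁) ⊗ a') ⊗ m')`.  The element
`∑ (a₀ ⊗ l(a₁)) ⊗_B (r(a₁) ⊗ a')` is read here in `A^{□e} ⊗_B A^{□e}`: it is the element `y` which
is mapped to `∑ (a₀ ⊗ l(a₁)) ⊗_B (r(a₁) ⊗ a')` in `(A ⊗ A) ⊗_B (A ⊗ A)`. -/
def IsSplitMap (hA : δ.IsFaithfullyFlatGalois) (M M' : Bimodule k δ.coinv)
    (g : (δ.boxTensor (M.tensor M')).carrier →ₗ[k]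
      ((δ.boxTensor M).tensor (δ.boxTensor M')).carrier) : Prop :=
  ∀ (x : δ.box) (m : M.carrier) (m' : M'.carrier), ∃ y : BTensor δ.boxRight δ.boxLeft,
    δ.boxIncl y = δ.split hA x ∧
      g (δ.boxMk (M.tensor M') x (Bimodule.tmul M M' m m')) = δ.boxInsert M M' m m' y

variable [Coalgebra.IsCocomm k H]

/-- Isomorphisms `φ_M : A^{□e} ⊗_{B^e} M → M ⊗ H` of `B`-bimodules that are right `H`-colinear. -/
structure StableIso (M : Bimodule k δ.coinv) extends
    (δ.boxTensor M).carrier ≃ₗ[k] M.carrier ⊗[k] H where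
  map_left : ∀ b z, toFun ((δ.boxTensor M).left b z) = M.leftH H b (toFun z)
  map_right : ∀ b z, toFun ((δ.boxTensor M).right b z) = M.rightH H b (toFun z)
  colinear : ∀ z, TensorProduct.assoc k M.carrier H H
      (toLinearEquiv.toLinearMap.rTensor H (δ.boxTensorCoact M z)) =
    (comul (R := k) (A := H)).lTensor M.carrier (toFun z)

variable {δ}

/-- The map `φ_M ⊗_B φ_{M'}`. -/
noncomputable def StableIso.tensorMap {M M' : Bimodule k δ.coinv} (φ : δ.StableIso M)
    (φ' : δ.StableIso M') : ((δ.boxTensor M).tensor (δ.boxTensor M')).carrier →ₗ[k]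
      BTensor (M.rightH H) (M'.leftH H) :=
  BTensor.map φ.toLinearEquiv.toLinearMap φ'.toLinearEquiv.toLinearMap
    (fun b => φ.map_right (op b)) φ'.map_left

/-- `ψ : A^{□e} ⊗_{B^e} (M ⊗_B M') → (M ⊗_B M') ⊗ H` is the map `φ_{M ⊗_B M'}` determined by `φ_M`
and `φ_{M'}`, that is, `κ ∘ ψ = (φ_M ⊗_B φ_{M'}) ∘ g`. -/
def IsTensorStable (hA : δ.IsFaithfullyFlatGalois) {M M' : Bimodule k δ.coinv}
    (φ : δ.StableIso M) (φ' : δ.StableIso M')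
    (ψ : (δ.boxTensor (M.tensor M')).carrier →ₗ[k] (M.tensor M').carrier ⊗[k] H) : Prop :=
  ∃ g, δ.IsSplitMap hA M M' g ∧ Bimodule.kappa M M' H ∘ₗ ψ = φ.tensorMap φ' ∘ₗ g

/-- The commutative square `(α ⊗ H) ∘ φ_{M ⊗_B M'} = φ_B ∘ (A^{□e} ⊗_{B^e} α)`. -/
def IsCompatible (hA : δ.IsFaithfullyFlatGalois) {M M' : Bimodule k δ.coinv}
    (φ : δ.StableIso M) (φ' : δ.StableIso M')
    (α : (M.tensor M').Iso (Bimodule.unit k δ.coinv)) : Prop :=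
  ∃ ψ : (δ.boxTensor (M.tensor M')).carrier →ₗ[k] (M.tensor M').carrier ⊗[k] H,
    IsTensorStable hA φ φ' ψ ∧
      α.val.rTensor H ∘ₗ ψ = δ.unitStable ∘ₗ δ.boxTensorMap α

/-- A strict Morita context `(B, B, M, N, α, β)` is `H`-stable if there are isomorphisms
`φ_M : A^{□e} ⊗_{B^e} M → M ⊗ H` and `φ_N : A^{□e} ⊗_{B^e} N → N ⊗ H` in `_B M_B^H`
that are compatible with `α` and with `β`. -/
def IsHStable (hA : δ.IsFaithfullyFlatGalois) (X : StrictMoritaContext k δ.coinv) : Prop :=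
  ∃ (φM : δ.StableIso X.M) (φN : δ.StableIso X.N),
    IsCompatible hA φM φN X.α ∧ IsCompatible hA φN φM X.β

end ComoduleAlgebra
end Hopf
end HopfPic

/-!
`H`-stability can be described without isomorphisms. A colinear map `A^{□e} ⊗_{B^e} M → M ⊗ H` is
determined by its composite with `id ⊗ ε`, a `B`-bimodule map `x ⊗ m ↦ x m` to `M` (`BoxAction`),
from which it is recovered as `x ⊗ m ↦ x₀ m ⊗ x₁` (`BoxAction.coext`, `StableIso.coext_action`).
In these terms `φ_{M ⊗_B M'}` is `x (m ⊗ m') = x₁ m ⊗ x₂ m'`, where `x ↦ x₁ ⊗_B x₂` denotes the map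
`A^{□e} → A^{□e} ⊗_B A^{□e}`, `a ⊗ a' ↦ (a₀ ⊗ l(a₁)) ⊗_B (r(a₁) ⊗ a')`, and `φ_B` is the action
`x(b) = ∑ a b a'` of `x = ∑ a ⊗ a'` on `B`. Compatibility with `α` becomes the equation
`α(x₁ m ⊗ x₂ n) = x(α(m ⊗ n))` (`isCompatible_iff`). The proof has three ingredients.

*The comultiplication.* The map `spl`, `a ⊗ a' ↦ (a₀ ⊗ l(a₁)) ⊗_B (r(a₁) ⊗ a')`, is defined on all
of `A ⊗ A` and is coassociative there (`assoc_splFst_spl`). Multiplying the last two factors gives a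
descent datum `desc` on `A ⊗ A` along the faithfully flat extension `B → A`, and the Galois map
shows that `A^{□e}` consists of the elements on which the descent datum is trivial
(`mem_box_iff`). Hence `A^{□e} ⊗_B A ≅ A ⊗ A` (`boxMul_bijective`), and `spl` restricts to a map
`boxComul` from `A^{□e}` to `A^{□e} ⊗_B A^{□e}` (`spl_mem_range`). It is coassociative
(`comulFst_boxComul`) and has the counit properties `x₁(b) x₂ = ∑ a b ⊗ a'` and
`x₁ x₂(b) = ∑ a ⊗ b a'` for `x = ∑ a ⊗ a'` (`actFst_boxComul`, `actSnd_boxComul`). Thus the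
bimodules with an action form a monoidal category (`BoxAction.equivariant_assoc`,
`BoxAction.equivariant_leftUnitor`).

*The unit.* The map `φ_B` is bijective (`unitAction_coext_bijective`): up to the inclusion
`B ⊗ H → A ⊗ H`, it is the restriction of the bijection `a ⊗_B c ↦ a₀ c ⊗ a₁` from `A ⊗_B A` to
`A ⊗ H` to the elements with trivial descent datum.

*Bijectivity is automatic.* Let `M` and `N` carry actions for which `α` and `β` are compatible. As
`φ_B` is bijective, so is the map that belongs to `M ⊗_B N ≅ B`. For surjectivity of
`A^{□e} ⊗_{B^e} M → M ⊗ H`, write `m ⊗ h` as a contraction, by `β`, of the element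
`α⁻¹(1) ⊗ h` of `(M ⊗_B N) ⊗ H` with `m` (`BoxAction.coext_surjective`). For injectivity, put
`L = M ⊗_B N`, so that `L ⊗_B M ≅ M`. The kernel for `L ⊗_B M` is contained in the kernel of
`x ⊗ (l ⊗ m) ↦ (x₁ ⊗ l) ⊗_B x₂ m`, since the map that belongs to `L` is bijective
(`BoxAction.slide_eq_zero`), and `(x₁ ⊗ m) β(x₂ n ⊗ x₃ m') = x ⊗ m β(n ⊗ m')` recovers
`x ⊗ (α(m ⊗ n) m')` from the image of `x ⊗ ((m ⊗ n) ⊗ m')` (`BoxAction.unslide_slide`).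

So a context is `H`-stable exactly when `M` and `N` carry actions that are compatible with `α` and
`β` (`isHStable_iff`). Such actions exist on the unit context, can be transported along isomorphisms
of contexts, and can be tensored; the inverse context has the same two actions in the opposite
order. This gives the subgroup `stablePic`.
-/

namespace HopfPic

universe u v w

open Coalgebra (comul)

/-! ### Modules over a noncommutative algebra that are faithfully flat -/

namespace BTensor

section Maps

variable {k : Type*} [Field k] {R : Type*} [Ring R] [Algebra k R]
  {M M' N N' : Type*} [AddCommGroup M] [Module k M] [AddCommGroup M'] [Module k M']
  [AddCommGroup N] [Module k N] [AddCommGroup N'] [Module k N']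
  {r : Rᵐᵒᵖ →ₐ[k] Module.End k M} {l : R →ₐ[k] Module.End k N}
  {r' : Rᵐᵒᵖ →ₐ[k] Module.End k M'} {l' : R →ₐ[k] Module.End k N'}

theorem map_bijective (f : M ≃ₗ[k] M') (g : N ≃ₗ[k] N')
    (hf : ∀ x m, f (r (op x) m) = r' (op x) (f m)) (hg : ∀ x n, g (l x n) = l' x (g n)) :
    Function.Bijective (map (l := l) (l' := l') f.toLinearMap g.toLinearMap hf hg) := by
  have hf' : ∀ x m, f.symm (r' (op x) m) = r (op x) (f.symm m) := fun x m => by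
    apply f.injective
    rw [hf, f.apply_symm_apply, f.apply_symm_apply]
  have hg' : ∀ x n, g.symm (l' x n) = l x (g.symm n) := fun x n => by
    apply g.injective
    rw [hg, g.apply_symm_apply, g.apply_symm_apply]
  refine Function.bijective_iff_has_inverse.2
    ⟨map f.symm.toLinearMap g.symm.toLinearMap hf' hg', fun z => ?_, fun z => ?_⟩
  · induction z using induction_on with
    | tmul m n => simp
    | add x y hx hy => rw [map_add, map_add, hx, hy]
  · induction z using induction_on with
    | tmul m n => simp
    | add x y hx hy => rw [map_add, map_add, hx, hy]

/-- The right action on a submodule that is stable under the action. -/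
def subAct (r : Rᵐᵒᵖ →ₐ[k] Module.End k M) (K : Submodule k M) (hK : ∀ b, ∀ x ∈ K, r b x ∈ K) :
    Rᵐᵒᵖ →ₐ[k] Module.End k K where
  toFun b := (r b).restrict (hK b)
  map_one' := by ext; simp
  map_mul' a b := by ext; simp
  map_zero' := by ext; simp
  map_add' a b := by ext; simp
  commutes' a := by ext; simp [Algebra.algebraMap_eq_smul_one]

/-- The right action on the quotient by a submodule that is stable under the action. -/
def quotAct (r : Rᵐᵒᵖ →ₐ[k] Module.End k M) (K : Submodule k M) (hK : ∀ b, ∀ x ∈ K, r b x ∈ K) :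
    Rᵐᵒᵖ →ₐ[k] Module.End k (M ⧸ K) where
  toFun b := K.mapQ K (r b) (hK b)
  map_one' := by ext; simp
  map_mul' a b := by ext; simp
  map_zero' := by ext; simp
  map_add' a b := by ext; simp
  commutes' a := by ext; simp [Algebra.algebraMap_eq_smul_one]

end Maps

section Flat

variable {k : Type u} {R : Type v} [Field k] [Ring R] [Algebra k R]
  {N : Type*} [AddCommGroup N] [Module k N] {l : R →ₐ[k] Module.End k N}
  {X Y : Type v} [AddCommGroup X] [Module k X] [AddCommGroup Y] [Module k Y]
  {r : Rᵐᵒᵖ →ₐ[k] Module.End k X} {r' : Rᵐᵒᵖ →ₐ[k] Module.End k Y}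

/-- Tensoring with a flat module preserves exactness at `X` of `K → X → Y`. -/
theorem mem_range_map_of_flat (hl : IsFaithfullyFlat l) {K : Type*} [AddCommGroup K] [Module k K]
    {rK : Rᵐᵒᵖ →ₐ[k] Module.End k K} (i : K →ₗ[k] X)
    (hi : ∀ b x, i (rK (op b) x) = r (op b) (i x)) (d : X →ₗ[k] Y)
    (hd : ∀ b x, d (r (op b) x) = r' (op b) (d x)) (hker : ∀ x, d x = 0 → ∃ y, i y = x)
    (z : BTensor r l) (hz : map (l := l) (l' := l) d LinearMap.id hd (fun _ _ => rfl) z = 0) :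
    ∃ y, map (l := l) (l' := l) i LinearMap.id hi (fun _ _ => rfl) y = z := by
  let K₀ := LinearMap.ker d
  have hK₀ : ∀ b, ∀ x ∈ K₀, r b x ∈ K₀ := by
    intro b x hx
    have := hd b.unop x
    rw [LinearMap.mem_ker] at hx ⊢
    rw [hx, map_zero] at this
    exact this
  let rQ := quotAct r K₀ hK₀
  let dQ : X ⧸ K₀ →ₗ[k] Y := K₀.liftQ d le_rfl
  have hdQ : ∀ b x, dQ (rQ (op b) x) = r' (op b) (dQ x) := by
    intro b x
    obtain ⟨x, rfl⟩ := K₀.mkQ_surjective x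
    exact hd b x
  have hinj : Function.Injective dQ :=
    LinearMap.ker_eq_bot.1 (Submodule.ker_liftQ_eq_bot _ _ _ le_rfl)
  have hinj' := hl.1 _ _ rQ r' dQ hdQ hinj
  have hz' : map (r' := rQ) (l := l) (l' := l) K₀.mkQ LinearMap.id (fun _ _ => rfl)
      (fun _ _ => rfl) z = 0 := by
    apply hinj'
    rw [map_zero, ← hz]
    clear hz
    induction z using induction_on with
    | tmul m n => rfl
    | add x y hx hy => rw [map_add, map_add, map_add, hx, hy]
  let T := LinearMap.range (map (l := l) (l' := l) i LinearMap.id hi (fun _ _ => rfl))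
  let f₀ : X →ₗ[k] N →ₗ[k] (BTensor r l ⧸ T) := (mk r l).compr₂ T.mkQ
  have hf₀ : K₀ ≤ LinearMap.ker f₀ := by
    intro x hx
    obtain ⟨y, rfl⟩ := hker x hx
    rw [LinearMap.mem_ker]
    ext n
    exact (Submodule.Quotient.mk_eq_zero T).2 ⟨mk rK l y n, by simp⟩
  let f : BTensor rQ l →ₗ[k] (BTensor r l ⧸ T) := lift (K₀.liftQ f₀ hf₀) (by
    intro x b n
    obtain ⟨x, rfl⟩ := K₀.mkQ_surjective x
    exact congrArg T.mkQ (mk_balanced x b n))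
  have hf : ∀ z, f (map (r' := rQ) (l := l) (l' := l) K₀.mkQ LinearMap.id (fun _ _ => rfl)
      (fun _ _ => rfl) z) = T.mkQ z := by
    intro z
    induction z using induction_on with
    | tmul m n => rfl
    | add x y hx hy => rw [map_add, map_add, map_add, hx, hy]
  have := hf z
  rw [hz', map_zero] at this
  exact (Submodule.Quotient.mk_eq_zero T).1 this.symm

/-- A faithfully flat module reflects surjectivity. -/
theorem surjective_of_map (hl : IsFaithfullyFlat l) {X : Type*} [AddCommGroup X] [Module k X]
    {r : Rᵐᵒᵖ →ₐ[k] Module.End k X} (f : X →ₗ[k] Y)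
    (hf : ∀ b x, f (r (op b) x) = r' (op b) (f x))
    (h : Function.Surjective (map (l := l) (l' := l) f LinearMap.id hf (fun _ _ => rfl))) :
    Function.Surjective f := by
  let T := LinearMap.range f
  have hT : ∀ b, ∀ x ∈ T, r' b x ∈ T := by
    rintro b _ ⟨x, rfl⟩
    exact ⟨_, hf b.unop x⟩
  have hs : ∀ z : BTensor (quotAct r' T hT) l, z = 0 := by
    intro z
    induction z using induction_on with
    | add x y hx hy => rw [hx, hy, add_zero]
    | tmul y n =>
      obtain ⟨y, rfl⟩ := T.mkQ_surjective y
      have h₁ : ∀ w, map (r' := quotAct r' T hT) (l := l) (l' := l) T.mkQ LinearMap.id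
          (fun _ _ => rfl) (fun _ _ => rfl)
            (map (l := l) (l' := l) f LinearMap.id hf (fun _ _ => rfl) w) = 0 := by
        intro w
        induction w using induction_on with
        | add x y hx hy => rw [map_add, map_add, hx, hy, add_zero]
        | tmul x n =>
          have : T.mkQ (f x) = 0 := (Submodule.Quotient.mk_eq_zero T).2 ⟨x, rfl⟩
          change mk (quotAct r' T hT) l (T.mkQ (f x)) n = 0
          rw [this, map_zero, LinearMap.zero_apply]
      obtain ⟨w, hw⟩ := h (mk r' l y n)
      have h₂ := h₁ w
      rw [hw] at h₂
      exact h₂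
  have := hl.2 _ (quotAct r' T hT) ⟨fun x y => (hs x).trans (hs y).symm⟩
  intro y
  exact (Submodule.Quotient.mk_eq_zero T).1 (Subsingleton.elim (T.mkQ y) 0)

/-- A faithfully flat module reflects injectivity. -/
theorem injective_of_map (hl : IsFaithfullyFlat l) {Y : Type*} [AddCommGroup Y] [Module k Y]
    {r' : Rᵐᵒᵖ →ₐ[k] Module.End k Y} (f : X →ₗ[k] Y)
    (hf : ∀ b x, f (r (op b) x) = r' (op b) (f x))
    (h : Function.Injective (map (l := l) (l' := l) f LinearMap.id hf (fun _ _ => rfl))) :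
    Function.Injective f := by
  let K := LinearMap.ker f
  have hK : ∀ b, ∀ x ∈ K, r b x ∈ K := by
    intro b x hx
    rw [LinearMap.mem_ker] at hx ⊢
    exact (hf b.unop x).trans (by rw [hx, map_zero])
  have h₁ := hl.1 _ _ (subAct r K hK) r K.subtype (fun _ _ => rfl) Subtype.val_injective
  have hs : ∀ z : BTensor (subAct r K hK) l, z = 0 := by
    intro z
    apply h₁
    apply h
    rw [map_zero, map_zero]
    induction z using induction_on with
    | add x y hx hy => rw [map_add, map_add, hx, hy, add_zero]
    | tmul x n =>
      have : f x = 0 := x.2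
      change mk r' l (f x) n = 0
      rw [this, map_zero, LinearMap.zero_apply]
  have := hl.2 _ (subAct r K hK) ⟨fun x y => (hs x).trans (hs y).symm⟩
  rw [← LinearMap.ker_eq_bot]
  exact Submodule.eq_bot_of_subsingleton

end Flat

end BTensor

namespace Bimodule

variable {k : Type u} {B : Type v} [Field k] [Ring B] [Algebra k B]
  {M N P M' N' P' : Bimodule k B}

/-- The map `f ⊗_B g` for a right linear map `f` and a left linear map `g`. -/
def tmap (f : M.carrier →ₗ[k] M'.carrier) (g : N.carrier →ₗ[k] N'.carrier)
    (hf : ∀ b m, f (M.right (op b) m) = M'.right (op b) (f m))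
    (hg : ∀ b n, g (N.left b n) = N'.left b (g n)) :
    (M.tensor N).carrier →ₗ[k] (M'.tensor N').carrier :=
  BTensor.map f g hf hg

@[simp] theorem tmap_tmul (f : M.carrier →ₗ[k] M'.carrier) (g : N.carrier →ₗ[k] N'.carrier)
    (hf : ∀ b m, f (M.right (op b) m) = M'.right (op b) (f m))
    (hg : ∀ b n, g (N.left b n) = N'.left b (g n)) (m : M.carrier) (n : N.carrier) :
    tmap f g hf hg (tmul M N m n) = tmul M' N' (f m) (g n) := rfl

theorem tmap_left (f : M.carrier →ₗ[k] M'.carrier) (g : N.carrier →ₗ[k] N'.carrier)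
    (hf : ∀ b m, f (M.right (op b) m) = M'.right (op b) (f m))
    (hg : ∀ b n, g (N.left b n) = N'.left b (g n))
    (hf' : ∀ b m, f (M.left b m) = M'.left b (f m)) (b : B) (z : (M.tensor N).carrier) :
    tmap f g hf hg ((M.tensor N).left b z) = (M'.tensor N').left b (tmap f g hf hg z) := by
  induction z using tensor_induction with
  | tmul m n => simp [hf']
  | add x y hx hy => simp only [map_add, hx, hy]

theorem tmap_right (f : M.carrier →ₗ[k] M'.carrier) (g : N.carrier →ₗ[k] N'.carrier)
    (hf : ∀ b m, f (M.right (op b) m) = M'.right (op b) (f m))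
    (hg : ∀ b n, g (N.left b n) = N'.left b (g n))
    (hg' : ∀ b n, g (N.right (op b) n) = N'.right (op b) (g n)) (b : B)
    (z : (M.tensor N).carrier) :
    tmap f g hf hg ((M.tensor N).right (op b) z) =
      (M'.tensor N').right (op b) (tmap f g hf hg z) := by
  induction z using tensor_induction with
  | tmul m n => simp [hg']
  | add x y hx hy => simp only [map_add, hx, hy]

end Bimodule

/-! ### The Galois map -/

namespace ComoduleAlgebra

variable {k : Type u} {H : Type w} {A : Type v} [Field k] [Ring H] [HopfAlgebra k H]
  [Ring A] [Algebra k A] (δ : ComoduleAlgebra k H A)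

/-- `A` as a bimodule over its coinvariants. -/
abbrev self : Bimodule k δ.coinv where
  carrier := A
  left := δ.leftB
  right := δ.rightB
  comm := δ.leftB_rightB

/-- `A ⊗ A` as a bimodule over the coinvariants, with the outer actions. -/
noncomputable abbrev outer : Bimodule k δ.coinv where
  carrier := A ⊗[k] A
  left := δ.leftAA
  right := δ.rightAA
  comm b c y := by
    induction y using TensorProduct.induction_on with
    | zero => simp
    | add x y hx hy => simp only [map_add, hx, hy]
    | tmul => rfl

/-- `A^{□e}` as a bimodule over the coinvariants, with the outer actions. -/
noncomputable abbrev boxBimod : Bimodule k δ.coinv where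
  carrier := δ.box
  left := δ.boxLeft
  right := δ.boxRight
  comm := boxFst_boxSnd _ _ _ _

@[simp] theorem leftB_apply (b : δ.coinv) (a : A) : δ.leftB b a = (b : A) * a := rfl

@[simp] theorem rightB_apply (b : δ.coinvᵐᵒᵖ) (a : A) : δ.rightB b a = a * (b.unop : A) := rfl

@[simp] theorem leftAA_tmul (b : δ.coinv) (a a' : A) :
    δ.leftAA b (a ⊗ₜ[k] a') = ((b : A) * a) ⊗ₜ[k] a' := rfl

@[simp] theorem rightAA_tmul (b : δ.coinvᵐᵒᵖ) (a a' : A) :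
    δ.rightAA b (a ⊗ₜ[k] a') = a ⊗ₜ[k] (a' * (b.unop : A)) := rfl

/-- The class `a ⊗_B a'`. -/
def selfMk : A →ₗ[k] A →ₗ[k] (δ.self.tensor δ.self).carrier := Bimodule.tmul δ.self δ.self

theorem selfMk_balanced (a : A) (b : δ.coinv) (a' : A) :
    δ.selfMk (a * (b : A)) a' = δ.selfMk a ((b : A) * a') :=
  Bimodule.tmul_balanced (M := δ.self) (N := δ.self) a b a'

/-- The class `y ⊗_B y'` for `y, y'` in `A ⊗ A`. -/
noncomputable def outerMk : A ⊗[k] A →ₗ[k] A ⊗[k] A →ₗ[k] (δ.outer.tensor δ.outer).carrier :=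
  Bimodule.tmul δ.outer δ.outer

@[elab_as_elim]
theorem self_induction {p : (δ.self.tensor δ.self).carrier → Prop}
    (z : (δ.self.tensor δ.self).carrier) (tmul : ∀ a a', p (δ.selfMk a a'))
    (add : ∀ x y, p x → p y → p (x + y)) : p z :=
  BTensor.induction_on z tmul add

/-- Left multiplication by an element of `A` on `A ⊗_B A`. -/
def mulL (a : A) : (δ.self.tensor δ.self).carrier →ₗ[k] (δ.self.tensor δ.self).carrier :=
  Bimodule.tmap (LinearMap.mulLeft k a) LinearMap.id (M := δ.self) (M' := δ.self)
    (fun _ _ => (mul_assoc _ _ _).symm) (fun _ _ => rfl)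

/-- Right multiplication by an element of `A` on `A ⊗_B A`. -/
def mulR (a : A) : (δ.self.tensor δ.self).carrier →ₗ[k] (δ.self.tensor δ.self).carrier :=
  Bimodule.tmap LinearMap.id (LinearMap.mulRight k a) (N := δ.self) (N' := δ.self)
    (fun _ _ => rfl) (fun _ _ => mul_assoc _ _ _)

@[simp] theorem mulL_selfMk (a c c' : A) : δ.mulL a (δ.selfMk c c') = δ.selfMk (a * c) c' := rfl

@[simp] theorem mulR_selfMk (a c c' : A) : δ.mulR a (δ.selfMk c c') = δ.selfMk c (c' * a) := rfl

/-- The canonical map, with source the bimodule `A ⊗_B A`. -/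
def canon : (δ.self.tensor δ.self).carrier →ₗ[k] A ⊗[k] H := δ.can

theorem canon_selfMk (a a' : A) : δ.canon (δ.selfMk a a') = (a ⊗ₜ[k] (1 : H)) * δ.coact a' := rfl

theorem canon_mulL (a : A) (z : (δ.self.tensor δ.self).carrier) :
    δ.canon (δ.mulL a z) = (a ⊗ₜ[k] (1 : H)) * δ.canon z := by
  induction z using self_induction with
  | tmul c c' => simp [canon_selfMk, ← mul_assoc]
  | add x y hx hy => simp only [map_add, hx, hy, mul_add]

theorem canon_mulR (a : A) (z : (δ.self.tensor δ.self).carrier) :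
    δ.canon (δ.mulR a z) = δ.canon z * δ.coact a := by
  induction z using self_induction with
  | tmul c c' => simp [canon_selfMk, mul_assoc]
  | add x y hx hy => simp only [map_add, hx, hy, add_mul]

/-- The multiplication `A ⊗_B A → A`. -/
def mulSelf : (δ.self.tensor δ.self).carrier →ₗ[k] A :=
  Bimodule.tensorLift (M := δ.self) (N := δ.self) (LinearMap.mul k A) (fun _ _ _ => mul_assoc _ _ _)

@[simp] theorem mulSelf_selfMk (a a' : A) : δ.mulSelf (δ.selfMk a a') = a * a' := rfl

/-- Applying the counit to `can(a ⊗_B a')` gives `a a'`. -/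
theorem rid_counit_canon (z : (δ.self.tensor δ.self).carrier) :
    TensorProduct.rid k A ((Coalgebra.counit (R := k) (A := H)).lTensor A (δ.canon z)) =
      δ.mulSelf z := by
  induction z using self_induction with
  | add x y hx hy => simp only [map_add, hx, hy]
  | tmul a a' =>
    have h : ∀ s : A ⊗[k] H, TensorProduct.rid k A ((Coalgebra.counit (R := k) (A := H)).lTensor A
        ((a ⊗ₜ[k] (1 : H)) * s)) = a * TensorProduct.rid k A
          ((Coalgebra.counit (R := k) (A := H)).lTensor A s) := by
      intro s
      induction s using TensorProduct.induction_on with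
      | zero => simp
      | add x y hx hy => simp only [map_add, mul_add, hx, hy]
      | tmul => simp
    rw [canon_selfMk, h, δ.counit, mulSelf_selfMk]

/-- The coaction `a ⊗_B a' ↦ (a ⊗_B a'₀) ⊗ a'₁`. -/
noncomputable def selfCoact : (δ.self.tensor δ.self).carrier →ₗ[k]
    (δ.self.tensor δ.self).carrier ⊗[k] H :=
  Bimodule.tensorLift (M := δ.self) (N := δ.self)
    (LinearMap.mk₂ k (fun a a' => (δ.selfMk a).rTensor H (δ.coact a'))
      (fun _ _ _ => by simp [LinearMap.rTensor_add]) (fun _ _ _ => by simp [LinearMap.rTensor_smul])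
      (fun _ _ _ => by simp) (fun _ _ _ => by simp))
    (fun a b a' => by
      change (δ.selfMk (a * (b : A))).rTensor H (δ.coact a') =
        (δ.selfMk a).rTensor H (δ.coact ((b : A) * a'))
      rw [map_mul δ.coact, coact_coinv]
      induction δ.coact a' using TensorProduct.induction_on with
      | zero => simp
      | add x y hx hy => simp only [map_add, mul_add, hx, hy]
      | tmul c h => simp [selfMk_balanced])

@[simp] theorem selfCoact_selfMk (a a' : A) :
    δ.selfCoact (δ.selfMk a a') = (δ.selfMk a).rTensor H (δ.coact a') := rfl

/-- The canonical map is colinear for the coactions on the second factors. -/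
theorem canon_selfCoact (z : (δ.self.tensor δ.self).carrier) :
    TensorProduct.assoc k A H H (δ.canon.rTensor H (δ.selfCoact z)) =
      (comul (R := k) (A := H)).lTensor A (δ.canon z) := by
  induction z using self_induction with
  | add x y hx hy => simp only [map_add, hx, hy]
  | tmul a a' =>
    have h₁ : ∀ s : A ⊗[k] H, (comul (R := k) (A := H)).lTensor A ((a ⊗ₜ[k] (1 : H)) * s) =
        (a ⊗ₜ[k] (1 : H ⊗[k] H)) * (comul (R := k) (A := H)).lTensor A s := by
      intro s
      induction s using TensorProduct.induction_on with
      | zero => simp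
      | add x y hx hy => simp only [map_add, mul_add, hx, hy]
      | tmul => simp
    have h₂ : ∀ s : A ⊗[k] H, TensorProduct.assoc k A H H (δ.canon.rTensor H
        ((δ.selfMk a).rTensor H s)) = (a ⊗ₜ[k] (1 : H ⊗[k] H)) *
          TensorProduct.assoc k A H H (δ.coact.toLinearMap.rTensor H s) := by
      intro s
      induction s using TensorProduct.induction_on with
      | zero => simp
      | add x y hx hy => simp only [map_add, mul_add, hx, hy]
      | tmul c h =>
        have h₃ : ∀ t : A ⊗[k] H, TensorProduct.assoc k A H H (((a ⊗ₜ[k] (1 : H)) * t) ⊗ₜ[k] h) =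
            (a ⊗ₜ[k] (1 : H ⊗[k] H)) * TensorProduct.assoc k A H H (t ⊗ₜ[k] h) := by
          intro t
          induction t using TensorProduct.induction_on with
          | zero => simp
          | add x y hx hy => simp only [map_add, mul_add, TensorProduct.add_tmul, hx, hy]
          | tmul => simp [Algebra.TensorProduct.one_def]
        exact h₃ (δ.coact c)
    rw [canon_selfMk, h₁, ← δ.coassoc, selfCoact_selfMk, h₂]

variable {δ} (hA : δ.IsFaithfullyFlatGalois)

/-- The inverse of the canonical map, `a ⊗ h ↦ a γ(h)`. -/
noncomputable def canInv : A ⊗[k] H →ₗ[k] (δ.self.tensor δ.self).carrier :=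
  (LinearEquiv.ofBijective δ.can hA.can_bijective).symm.toLinearMap

theorem canon_injective (hA : δ.IsFaithfullyFlatGalois) : Function.Injective δ.canon :=
  hA.can_bijective.1

theorem canon_canInv (s : A ⊗[k] H) : δ.canon (canInv hA s) = s :=
  (LinearEquiv.ofBijective δ.can hA.can_bijective).apply_symm_apply s

/-- `γ(h) = can⁻¹(1 ⊗ h)`, as an element of the bimodule `A ⊗_B A`. -/
noncomputable def gam : H →ₗ[k] (δ.self.tensor δ.self).carrier := δ.gamma hA

theorem canon_gam (h : H) : δ.canon (gam hA h) = 1 ⊗ₜ h := canon_canInv hA _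

theorem canInv_tmul (a : A) (h : H) : canInv hA (a ⊗ₜ h) = δ.mulL a (gam hA h) := by
  apply canon_injective hA
  rw [canon_canInv, canon_mulL, canon_gam]
  simp

/-- `b γ(h) = γ(h) b` for `b` in `B`. -/
theorem mulL_gam (b : δ.coinv) (h : H) : δ.mulL (b : A) (gam hA h) = δ.mulR (b : A) (gam hA h) := by
  apply canon_injective hA
  rw [canon_mulL, canon_mulR, canon_gam, coact_coinv]
  simp

/-- `l(h) r(h) = ε(h)`. -/
theorem mulSelf_gam (h : H) : δ.mulSelf (gam hA h) = Coalgebra.counit (R := k) h • (1 : A) := by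
  rw [← rid_counit_canon, canon_gam]
  simp

/-- `l(h) ⊗ r(h)₀ ⊗ r(h)₁ = l(h₁) ⊗ r(h₁) ⊗ h₂`. -/
theorem selfCoact_gam (h : H) :
    δ.selfCoact (gam hA h) = (gam hA).rTensor H (comul (R := k) h) := by
  have hinj : Function.Injective (δ.canon.rTensor H) :=
    Module.Flat.rTensor_preserves_injective_linearMap _ (canon_injective hA)
  apply hinj
  apply (TensorProduct.assoc k A H H).injective
  rw [canon_selfCoact, canon_gam]
  have : δ.canon ∘ₗ gam hA = TensorProduct.mk k A H 1 := LinearMap.ext (canon_gam hA)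
  rw [← LinearMap.rTensor_comp_apply, this, LinearMap.lTensor_tmul]
  induction comul (R := k) h using TensorProduct.induction_on with
  | zero => simp
  | add x y hx hy => simp only [map_add, TensorProduct.tmul_add, hx, hy]
  | tmul => simp

/-- `a₀ γ(a₁) = 1 ⊗_B a`. -/
theorem canInv_coact (a : A) : canInv hA (δ.coact a) = δ.selfMk 1 a := by
  apply canon_injective hA
  rw [canon_canInv, canon_selfMk]
  exact (one_mul _).symm

end ComoduleAlgebra

/-! ### The map `a ⊗ a' ↦ (a₀ ⊗ l(a₁)) ⊗_B (r(a₁) ⊗ a')` -/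

namespace Bimodule

variable {k : Type u} {B : Type v} [Field k] [Ring B] [Algebra k B] {M N : Bimodule k B}
  {H : Type w} [AddCommGroup H] [Module k H]

/-- The map `m ⊗_B n ↦ (m₀ ⊗_B n) ⊗ m₁` for a right `B`-linear map `m ↦ m₀ ⊗ m₁`. -/
noncomputable def tensorCoactFst (N : Bimodule k B) (ρ : M.carrier →ₗ[k] M.carrier ⊗[k] H)
    (hρ : ∀ b m, ρ (M.right (op b) m) = (M.right (op b)).rTensor H (ρ m)) :
    (M.tensor N).carrier →ₗ[k] (M.tensor N).carrier ⊗[k] H :=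
  tensorLift (LinearMap.mk₂ k (fun m n => ((tmul M N).flip n).rTensor H (ρ m))
      (fun _ _ _ => by simp) (fun _ _ _ => by simp)
      (fun _ _ _ => by simp [LinearMap.rTensor_add])
      (fun _ _ _ => by simp [LinearMap.rTensor_smul]))
    (fun m b n => by
      rw [LinearMap.mk₂_apply, LinearMap.mk₂_apply, hρ, ← LinearMap.rTensor_comp_apply]
      congr 2
      ext m
      exact tmul_balanced m b n)

/-- The map `m ⊗_B n ↦ (m ⊗_B n₀) ⊗ n₁` for a left `B`-linear map `n ↦ n₀ ⊗ n₁`. -/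
noncomputable def tensorCoactSnd (M : Bimodule k B) (ρ : N.carrier →ₗ[k] N.carrier ⊗[k] H)
    (hρ : ∀ b n, ρ (N.left b n) = (N.left b).rTensor H (ρ n)) :
    (M.tensor N).carrier →ₗ[k] (M.tensor N).carrier ⊗[k] H :=
  tensorLift (LinearMap.mk₂ k (fun m n => (tmul M N m).rTensor H (ρ n))
      (fun _ _ _ => by simp [LinearMap.rTensor_add])
      (fun _ _ _ => by simp [LinearMap.rTensor_smul]) (fun _ _ _ => by simp) (fun _ _ _ => by simp))
    (fun m b n => by
      rw [LinearMap.mk₂_apply, LinearMap.mk₂_apply, hρ, ← LinearMap.rTensor_comp_apply]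
      congr 2
      ext n
      exact tmul_balanced m b n)

end Bimodule

namespace ComoduleAlgebra
open Bimodule

variable {k : Type u} {H : Type w} {A : Type v} [Field k] [Ring H] [HopfAlgebra k H]
  [Ring A] [Algebra k A] (δ : ComoduleAlgebra k H A)

@[elab_as_elim]
theorem outer_induction {p : (δ.outer.tensor δ.outer).carrier → Prop}
    (z : (δ.outer.tensor δ.outer).carrier)
    (tmul : ∀ a a' c c', p (δ.outerMk (a ⊗ₜ a') (c ⊗ₜ c')))
    (add : ∀ x y, p x → p y → p (x + y)) : p z := by
  induction z using tensor_induction with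
  | add x y hx hy => exact add x y hx hy
  | tmul y y' =>
    change p (δ.outerMk y y')
    induction y using TensorProduct.induction_on with
    | zero => simpa using tmul 0 0 0 0
    | add x y hx hy => rw [map_add, LinearMap.add_apply]; exact add _ _ hx hy
    | tmul a a' =>
      induction y' using TensorProduct.induction_on with
      | zero => simpa using tmul 0 0 0 0
      | add x y hx hy => rw [map_add]; exact add _ _ hx hy
      | tmul c c' => exact tmul a a' c c'

/-- The insertion `l ⊗_B r ↦ (a ⊗ a' ↦ (a ⊗ l) ⊗_B (r ⊗ a'))`. -/
noncomputable def ins : (δ.self.tensor δ.self).carrier →ₗ[k] A ⊗[k] A →ₗ[k]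
    (δ.outer.tensor δ.outer).carrier := δ.insert

@[simp] theorem ins_selfMk (l r a a' : A) :
    δ.ins (δ.selfMk l r) (a ⊗ₜ a') = δ.outerMk (a ⊗ₜ l) (r ⊗ₜ a') := rfl

/-- The multiplication `(a ⊗ a') ⊗_B (c ⊗ c') ↦ a ⊗ a' c ⊗ c'` in the middle. -/
noncomputable def mid : (δ.outer.tensor δ.outer).carrier →ₗ[k] (A ⊗[k] A) ⊗[k] A :=
  tensorLift (M := δ.outer) (N := δ.outer)
    (TensorProduct.curry (((LinearMap.mul' k A).lTensor A ∘ₗ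
      (TensorProduct.assoc k A A A).toLinearMap).rTensor A ∘ₗ
        (TensorProduct.assoc k (A ⊗[k] A) A A).symm.toLinearMap))
    (fun y b y' => by
      induction y using TensorProduct.induction_on with
      | zero => simp
      | add x y hx hy => simp only [map_add, LinearMap.add_apply, hx, hy]
      | tmul a a' =>
        induction y' using TensorProduct.induction_on with
        | zero => simp
        | add x y hx hy => simp only [map_add, hx, hy]
        | tmul c c' => simp [mul_assoc])

@[simp] theorem mid_outerMk (a a' c c' : A) :
    δ.mid (δ.outerMk (a ⊗ₜ a') (c ⊗ₜ c')) = (a ⊗ₜ (a' * c)) ⊗ₜ c' := rfl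

/-- The multiplication `A ⊗ A → A`. -/
noncomputable def mulOuter : A ⊗[k] A →ₗ[k] A := LinearMap.mul' k A

@[simp] theorem mulOuter_tmul (a a' : A) : mulOuter (k := k) (a ⊗ₜ a') = a * a' := rfl

theorem mulOuter_left (b : δ.coinv) (y : A ⊗[k] A) :
    mulOuter (δ.outer.left b y) = δ.self.left b (mulOuter y) := by
  induction y using TensorProduct.induction_on with
  | zero => simp
  | add x y hx hy => simp only [map_add, hx, hy]
  | tmul a a' => simp [mul_assoc]

theorem mulOuter_right (b : δ.coinvᵐᵒᵖ) (y : A ⊗[k] A) :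
    mulOuter (δ.outer.right b y) = δ.self.right b (mulOuter y) := by
  induction y using TensorProduct.induction_on with
  | zero => simp
  | add x y hx hy => simp only [map_add, hx, hy]
  | tmul a a' => simp [mul_assoc]

theorem rTensor_outer_right (f : A →ₗ[k] A) (b : δ.coinvᵐᵒᵖ) (y : A ⊗[k] A) :
    f.rTensor A (δ.outer.right b y) = δ.outer.right b (f.rTensor A y) := by
  induction y using TensorProduct.induction_on with
  | zero => simp
  | add x y hx hy => simp only [map_add, hx, hy]
  | tmul a a' => simp

theorem lTensor_outer_left (f : A →ₗ[k] A) (b : δ.coinv) (y : A ⊗[k] A) :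
    f.lTensor A (δ.outer.left b y) = δ.outer.left b (f.lTensor A y) := by
  induction y using TensorProduct.induction_on with
  | zero => simp
  | add x y hx hy => simp only [map_add, hx, hy]
  | tmul a a' => simp

/-- The map `(a ⊗ a') ⊗_B (c ⊗ c') ↦ (f(a) ⊗ a') ⊗_B (c ⊗ c')`. -/
noncomputable def mapFst (f : A →ₗ[k] A) :
    (δ.outer.tensor δ.outer).carrier →ₗ[k] (δ.outer.tensor δ.outer).carrier :=
  tmap (f.rTensor A) LinearMap.id (M := δ.outer) (M' := δ.outer)
    (fun b => δ.rTensor_outer_right f (op b)) (fun _ _ => rfl)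

/-- The map `(a ⊗ a') ⊗_B (c ⊗ c') ↦ (a ⊗ a') ⊗_B (c ⊗ f(c'))`. -/
noncomputable def mapSnd (f : A →ₗ[k] A) :
    (δ.outer.tensor δ.outer).carrier →ₗ[k] (δ.outer.tensor δ.outer).carrier :=
  tmap LinearMap.id (f.lTensor A) (N := δ.outer) (N' := δ.outer)
    (fun _ _ => rfl) (δ.lTensor_outer_left f)

/-- The map `(a ⊗ l) ⊗_B (r ⊗ a') ↦ (a ⊗ b l) ⊗_B (r ⊗ a')`. -/
noncomputable def midLeft (b : δ.coinv) :
    (δ.outer.tensor δ.outer).carrier →ₗ[k] (δ.outer.tensor δ.outer).carrier :=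
  tmap ((δ.leftB b).lTensor A) LinearMap.id (M := δ.outer) (M' := δ.outer)
    (fun c y => by
      induction y using TensorProduct.induction_on with
      | zero => simp
      | add x y hx hy => simp only [map_add, hx, hy]
      | tmul a a' => simp [mul_assoc]) (fun _ _ => rfl)

/-- The map `(a ⊗ l) ⊗_B (r ⊗ a') ↦ (a ⊗ l) ⊗_B (r b ⊗ a')`. -/
noncomputable def midRight (b : δ.coinv) :
    (δ.outer.tensor δ.outer).carrier →ₗ[k] (δ.outer.tensor δ.outer).carrier :=
  tmap LinearMap.id ((δ.rightB (op b)).rTensor A) (N := δ.outer) (N' := δ.outer)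
    (fun _ _ => rfl)
    (fun c y => by
      induction y using TensorProduct.induction_on with
      | zero => simp
      | add x y hx hy => simp only [map_add, hx, hy]
      | tmul a a' => simp [mul_assoc])

theorem outer_coactLeft_right (b : δ.coinv) (y : A ⊗[k] A) :
    δ.coactLeft (δ.outer.right (op b) y) = (δ.outer.right (op b)).rTensor H (δ.coactLeft y) :=
  IsColinear.coactLeft_snd δ.rightB (op b) y

theorem outer_coactLeft_left (b : δ.coinv) (y : A ⊗[k] A) :
    δ.coactLeft (δ.outer.left b y) = (δ.outer.left b).rTensor H (δ.coactLeft y) :=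
  δ.isColinear_leftB.coactLeft_fst b y

/-- The coaction on the first factor of `(A ⊗ A) ⊗_B (A ⊗ A)`. -/
noncomputable def outerCoactFst : (δ.outer.tensor δ.outer).carrier →ₗ[k]
    (δ.outer.tensor δ.outer).carrier ⊗[k] H :=
  tensorCoactFst δ.outer (M := δ.outer) δ.coactLeft δ.outer_coactLeft_right

/-- The coaction on the second factor of `(A ⊗ A) ⊗_B (A ⊗ A)`. -/
noncomputable def outerCoactSnd : (δ.outer.tensor δ.outer).carrier →ₗ[k]
    (δ.outer.tensor δ.outer).carrier ⊗[k] H :=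
  tensorCoactSnd δ.outer (N := δ.outer) δ.coactLeft δ.outer_coactLeft_left

@[simp] theorem outerCoactFst_outerMk (y y' : A ⊗[k] A) :
    δ.outerCoactFst (δ.outerMk y y') = (δ.outerMk.flip y').rTensor H (δ.coactLeft y) := rfl

@[simp] theorem outerCoactSnd_outerMk (y y' : A ⊗[k] A) :
    δ.outerCoactSnd (δ.outerMk y y') = (δ.outerMk y).rTensor H (δ.coactLeft y') := rfl

variable {δ} (hA : δ.IsFaithfullyFlatGalois)

/-- The map `∑ a ⊗ a' ↦ ∑ (a₀ ⊗ l(a₁)) ⊗_B (r(a₁) ⊗ a')`, with values in a bimodule. -/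
noncomputable def spl : A ⊗[k] A →ₗ[k] (δ.outer.tensor δ.outer).carrier := δ.split hA

/-- The map `c ⊗ h ↦ (c ⊗ l(h)) ⊗_B (r(h) ⊗ a')`. -/
noncomputable def splAux (a' : A) : A ⊗[k] H →ₗ[k] (δ.outer.tensor δ.outer).carrier :=
  TensorProduct.lift (δ.ins.flip.compl₂ (gam hA)) ∘ₗ ((TensorProduct.mk k A A).flip a').rTensor H

@[simp] theorem splAux_tmul (a' c : A) (h : H) :
    splAux hA a' (c ⊗ₜ h) = δ.ins (gam hA h) (c ⊗ₜ a') := rfl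

theorem spl_tmul (a a' : A) : spl hA (a ⊗ₜ a') = splAux hA a' (δ.coact a) :=
  congrArg (TensorProduct.lift (δ.ins.flip.compl₂ (gam hA))) (δ.coactLeft_tmul a a')

theorem mid_ins (z : (δ.self.tensor δ.self).carrier) (a a' : A) :
    δ.mid (δ.ins z (a ⊗ₜ a')) = (a ⊗ₜ δ.mulSelf z) ⊗ₜ a' := by
  induction z using self_induction with
  | tmul l r => simp
  | add x y hx hy =>
    simp only [map_add, LinearMap.add_apply, hx, hy, TensorProduct.tmul_add, TensorProduct.add_tmul]

/-- Multiplying the middle factors of `∑ (a₀ ⊗ l(a₁)) ⊗_B (r(a₁) ⊗ a')` gives `∑ a ⊗ 1 ⊗ a'`. -/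
theorem mid_spl (y : A ⊗[k] A) :
    δ.mid (spl hA y) = ((TensorProduct.mk k A A).flip 1).rTensor A y := by
  induction y using TensorProduct.induction_on with
  | zero => simp
  | add x y hx hy => simp only [map_add, hx, hy]
  | tmul a a' =>
    have h : ∀ s : A ⊗[k] H, δ.mid (splAux hA a' s) =
        ((TensorProduct.rid k A ((Coalgebra.counit (R := k) (A := H)).lTensor A s)) ⊗ₜ 1) ⊗ₜ
          a' := by
      intro s
      induction s using TensorProduct.induction_on with
      | zero => simp
      | add x y hx hy => simp only [map_add, hx, hy, TensorProduct.add_tmul]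
      | tmul c h =>
        rw [splAux_tmul, mid_ins, mulSelf_gam]
        simp [TensorProduct.smul_tmul']
    rw [spl_tmul, h, δ.counit]
    simp

/-- Multiplying both pairs of factors of `∑ (a₀ ⊗ l(a₁)) ⊗_B (r(a₁) ⊗ a')` gives
`∑ 1 ⊗_B a a'`. -/
theorem tmap_mulOuter_spl (y : A ⊗[k] A) :
    tmap (M := δ.outer) (N := δ.outer) (M' := δ.self) (N' := δ.self) mulOuter mulOuter
      (fun b => δ.mulOuter_right (op b)) δ.mulOuter_left (spl hA y) = δ.selfMk 1 (mulOuter y) := by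
  induction y using TensorProduct.induction_on with
  | zero => simp
  | add x y hx hy => simp only [map_add, hx, hy]
  | tmul a a' =>
    have h₁ : ∀ (z : (δ.self.tensor δ.self).carrier) (c : A),
        tmap (M := δ.outer) (N := δ.outer) (M' := δ.self) (N' := δ.self) mulOuter mulOuter
        (fun b => δ.mulOuter_right (op b)) δ.mulOuter_left (δ.ins z (c ⊗ₜ a')) =
        δ.mulR a' (δ.mulL c z) := by
      intro z c
      induction z using self_induction with
      | tmul l r => rfl
      | add x y hx hy => simp only [map_add, LinearMap.add_apply, hx, hy]
    have h : ∀ s : A ⊗[k] H, tmap (M := δ.outer) (N := δ.outer) (M' := δ.self) (N' := δ.self)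
        mulOuter mulOuter (fun b => δ.mulOuter_right (op b)) δ.mulOuter_left (splAux hA a' s) =
        δ.mulR a' (canInv hA s) := by
      intro s
      induction s using TensorProduct.induction_on with
      | zero => simp
      | add x y hx hy => simp only [map_add, hx, hy]
      | tmul c h => rw [splAux_tmul, h₁, canInv_tmul]
    rw [spl_tmul, h, canInv_coact]
    rfl

theorem ins_mapFst (f : A →ₗ[k] A) (z : (δ.self.tensor δ.self).carrier) (y : A ⊗[k] A) :
    δ.ins z (f.rTensor A y) = δ.mapFst f (δ.ins z y) := by
  induction y using TensorProduct.induction_on with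
  | zero => simp
  | add x y hx hy => simp only [map_add, hx, hy]
  | tmul a a' =>
    induction z using self_induction with
    | tmul l r => rfl
    | add x y hx hy => simp only [map_add, LinearMap.add_apply, hx, hy]

theorem ins_mapSnd (f : A →ₗ[k] A) (z : (δ.self.tensor δ.self).carrier) (y : A ⊗[k] A) :
    δ.ins z (f.lTensor A y) = δ.mapSnd f (δ.ins z y) := by
  induction y using TensorProduct.induction_on with
  | zero => simp
  | add x y hx hy => simp only [map_add, hx, hy]
  | tmul a a' =>
    induction z using self_induction with
    | tmul l r => rfl
    | add x y hx hy => simp only [map_add, LinearMap.add_apply, hx, hy]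

theorem spl_mapFst (f : A →ₗ[k] A) (hf : ∀ a, δ.coact (f a) = f.rTensor H (δ.coact a))
    (y : A ⊗[k] A) : spl hA (f.rTensor A y) = δ.mapFst f (spl hA y) := by
  induction y using TensorProduct.induction_on with
  | zero => simp
  | add x y hx hy => simp only [map_add, hx, hy]
  | tmul a a' =>
    rw [LinearMap.rTensor_tmul, spl_tmul, spl_tmul, hf]
    induction δ.coact a using TensorProduct.induction_on with
    | zero => simp
    | add x y hx hy => simp only [map_add, hx, hy]
    | tmul c h =>
      rw [LinearMap.rTensor_tmul, splAux_tmul, splAux_tmul, ← ins_mapFst, LinearMap.rTensor_tmul]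

theorem spl_mapSnd (f : A →ₗ[k] A) (y : A ⊗[k] A) :
    spl hA (f.lTensor A y) = δ.mapSnd f (spl hA y) := by
  induction y using TensorProduct.induction_on with
  | zero => simp
  | add x y hx hy => simp only [map_add, hx, hy]
  | tmul a a' =>
    rw [LinearMap.lTensor_tmul, spl_tmul, spl_tmul]
    induction δ.coact a using TensorProduct.induction_on with
    | zero => simp
    | add x y hx hy => simp only [map_add, hx, hy]
    | tmul c h => rw [splAux_tmul, splAux_tmul, ← ins_mapSnd, LinearMap.lTensor_tmul]

theorem spl_left (b : δ.coinv) (y : A ⊗[k] A) :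
    spl hA (δ.outer.left b y) = (δ.outer.tensor δ.outer).left b (spl hA y) :=
  spl_mapFst hA (δ.leftB b) (δ.isColinear_leftB b) y

theorem spl_right (b : δ.coinvᵐᵒᵖ) (y : A ⊗[k] A) :
    spl hA (δ.outer.right b y) = (δ.outer.tensor δ.outer).right b (spl hA y) :=
  spl_mapSnd hA (δ.rightB b) y

/-- The middle factors of `∑ (a₀ ⊗ l(a₁)) ⊗_B (r(a₁) ⊗ a')` centralize `B`. -/
theorem midLeft_spl (b : δ.coinv) (y : A ⊗[k] A) :
    δ.midLeft b (spl hA y) = δ.midRight b (spl hA y) := by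
  induction y using TensorProduct.induction_on with
  | zero => simp
  | add x y hx hy => simp only [map_add, hx, hy]
  | tmul a a' =>
    rw [spl_tmul]
    induction δ.coact a using TensorProduct.induction_on with
    | zero => simp
    | add x y hx hy => simp only [map_add, hx, hy]
    | tmul c h =>
      have h₁ : ∀ z, δ.midLeft b (δ.ins z (c ⊗ₜ a')) = δ.ins (δ.mulL (b : A) z) (c ⊗ₜ a') := by
        intro z
        induction z using self_induction with
        | tmul l r => rfl
        | add x y hx hy => simp only [map_add, LinearMap.add_apply, hx, hy]
      have h₂ : ∀ z, δ.midRight b (δ.ins z (c ⊗ₜ a')) = δ.ins (δ.mulR (b : A) z) (c ⊗ₜ a') := by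
        intro z
        induction z using self_induction with
        | tmul l r => rfl
        | add x y hx hy => simp only [map_add, LinearMap.add_apply, hx, hy]
      rw [splAux_tmul, h₁, h₂, mulL_gam]

/-- The map `c ⊗ (h ⊗ h') ↦ (c ⊗ l(h)) ⊗_B (r(h) ⊗ a') ⊗ h'`. -/
noncomputable def splAuxH (a' : A) :
    A ⊗[k] (H ⊗[k] H) →ₗ[k] (δ.outer.tensor δ.outer).carrier ⊗[k] H :=
  (splAux hA a').rTensor H ∘ₗ (TensorProduct.assoc k A H H).symm.toLinearMap

theorem rTensor_spl_coactLeft (a a' : A) : (spl hA).rTensor H (δ.coactLeft (a ⊗ₜ a')) =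
    splAuxH hA a' ((comul (R := k) (A := H)).lTensor A (δ.coact a)) := by
  rw [coactLeft_tmul, ← δ.coassoc]
  induction δ.coact a using TensorProduct.induction_on with
  | zero => simp
  | add x y hx hy => simp only [map_add, hx, hy]
  | tmul c h => simp [splAuxH, spl_tmul]

/-- Colinearity of `spl` for the coaction on the second factor: this uses
`l(h) ⊗ r(h)₀ ⊗ r(h)₁ = l(h₁) ⊗ r(h₁) ⊗ h₂`. -/
theorem outerCoactSnd_spl (y : A ⊗[k] A) :
    δ.outerCoactSnd (spl hA y) = (spl hA).rTensor H (δ.coactLeft y) := by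
  induction y using TensorProduct.induction_on with
  | zero => simp
  | add x y hx hy => simp only [map_add, hx, hy]
  | tmul a a' =>
    rw [rTensor_spl_coactLeft, spl_tmul]
    induction δ.coact a using TensorProduct.induction_on with
    | zero => simp
    | add x y hx hy => simp only [map_add, hx, hy]
    | tmul c h =>
      have h₁ : ∀ z : (δ.self.tensor δ.self).carrier, δ.outerCoactSnd (δ.ins z (c ⊗ₜ a')) =
          (δ.ins.flip (c ⊗ₜ a')).rTensor H (δ.selfCoact z) := by
        intro z
        induction z using self_induction with
        | add x y hx hy => simp only [map_add, LinearMap.add_apply, hx, hy]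
        | tmul l r =>
          rw [ins_selfMk, outerCoactSnd_outerMk, coactLeft_tmul, selfCoact_selfMk,
            ← LinearMap.rTensor_comp_apply, ← LinearMap.rTensor_comp_apply]
          rfl
      rw [splAux_tmul, h₁, selfCoact_gam, ← LinearMap.rTensor_comp_apply, LinearMap.lTensor_tmul]
      induction comul (R := k) h using TensorProduct.induction_on with
      | zero => simp
      | add x y hx hy => simp only [map_add, TensorProduct.tmul_add, hx, hy]
      | tmul => rfl

/-- Colinearity of `spl` for the coaction on the first factor: this uses that `H` is
cocommutative. -/
theorem outerCoactFst_spl [Coalgebra.IsCocomm k H] (y : A ⊗[k] A) :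
    δ.outerCoactFst (spl hA y) = (spl hA).rTensor H (δ.coactLeft y) := by
  induction y using TensorProduct.induction_on with
  | zero => simp
  | add x y hx hy => simp only [map_add, hx, hy]
  | tmul a a' =>
    have h₁ : ∀ s : A ⊗[k] H, δ.outerCoactFst (splAux hA a' s) = splAuxH hA a'
        ((TensorProduct.comm k H H).toLinearMap.lTensor A (TensorProduct.assoc k A H H
          (δ.coact.toLinearMap.rTensor H s))) := by
      intro s
      induction s using TensorProduct.induction_on with
      | zero => simp
      | add x y hx hy => simp only [map_add, hx, hy]
      | tmul c h =>
        have h₂ : ∀ z : (δ.self.tensor δ.self).carrier, δ.outerCoactFst (δ.ins z (c ⊗ₜ a')) =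
            (δ.ins z).rTensor H (δ.coactLeft (c ⊗ₜ a')) := by
          intro z
          induction z using self_induction with
          | add x y hx hy =>
            simp only [map_add, LinearMap.add_apply, hx, hy, LinearMap.rTensor_add]
          | tmul l r =>
            rw [ins_selfMk, outerCoactFst_outerMk, coactLeft_tmul, coactLeft_tmul,
              ← LinearMap.rTensor_comp_apply, ← LinearMap.rTensor_comp_apply]
            rfl
        rw [splAux_tmul, h₂, coactLeft_tmul, LinearMap.rTensor_tmul]
        change _ = splAuxH hA a' ((TensorProduct.comm k H H).toLinearMap.lTensor A
          (TensorProduct.assoc k A H H (δ.coact c ⊗ₜ h)))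
        induction δ.coact c using TensorProduct.induction_on with
        | zero => simp
        | add x y hx hy => simp only [map_add, TensorProduct.add_tmul, hx, hy]
        | tmul => rfl
    rw [rTensor_spl_coactLeft, spl_tmul, h₁, δ.coassoc, ← LinearMap.lTensor_comp_apply,
      Coalgebra.comm_comp_comul]

end ComoduleAlgebra

/-! ### Coassociativity and the descent datum on `A ⊗ A` -/

namespace ComoduleAlgebra
open Bimodule

variable {k : Type u} {H : Type w} {A : Type v} [Field k] [Ring H] [HopfAlgebra k H]
  [Ring A] [Algebra k A] {δ : ComoduleAlgebra k H A} (hA : δ.IsFaithfullyFlatGalois)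

/-- The map `y ⊗_B y' ↦ σ(y) ⊗_B y'` for the map `σ = spl`. -/
noncomputable def splFst : (δ.outer.tensor δ.outer).carrier →ₗ[k]
    ((δ.outer.tensor δ.outer).tensor δ.outer).carrier :=
  tmap (M := δ.outer) (M' := δ.outer.tensor δ.outer) (spl hA) LinearMap.id
    (fun b => spl_right hA (op b)) (fun _ _ => rfl)

/-- The map `y ⊗_B y' ↦ y ⊗_B σ(y')` for the map `σ = spl`. -/
noncomputable def splSnd : (δ.outer.tensor δ.outer).carrier →ₗ[k]
    (δ.outer.tensor (δ.outer.tensor δ.outer)).carrier :=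
  tmap (N := δ.outer) (N' := δ.outer.tensor δ.outer) LinearMap.id (spl hA)
    (fun _ _ => rfl) (spl_left hA)

theorem splFst_outerMk (y y' : A ⊗[k] A) : splFst hA (δ.outerMk y y') =
    tmul (δ.outer.tensor δ.outer) δ.outer (spl hA y) y' := rfl

theorem splSnd_outerMk (y y' : A ⊗[k] A) : splSnd hA (δ.outerMk y y') =
    tmul δ.outer (δ.outer.tensor δ.outer) y (spl hA y') := rfl

variable (δ) in
/-- The map `(l ⊗_B r) ↦ (c ⊗ (l' ⊗_B r') ↦ (c ⊗ l) ⊗_B (r ⊗ l') ⊗_B (r' ⊗ a'))`. -/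
noncomputable def insTwice (a' : A) : (δ.self.tensor δ.self).carrier →ₗ[k]
    A ⊗[k] (δ.self.tensor δ.self).carrier →ₗ[k]
      (δ.outer.tensor (δ.outer.tensor δ.outer)).carrier :=
  tensorLift (M := δ.self) (N := δ.self)
    (LinearMap.mk₂ k (fun l r => TensorProduct.lift
        ((tmul δ.outer (δ.outer.tensor δ.outer)).compl₁₂ ((TensorProduct.mk k A A).flip l)
          (δ.ins.flip (r ⊗ₜ a'))))
      (fun _ _ _ => by ext; simp)
      (fun _ _ _ => by ext; simp)
      (fun _ _ _ => by ext; simp [TensorProduct.add_tmul])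
      (fun _ _ _ => by ext; simp [← TensorProduct.smul_tmul']))
    (fun l b r => by
      rw [LinearMap.mk₂_apply, LinearMap.mk₂_apply]
      apply TensorProduct.ext'
      intro c z
      change tmul δ.outer (δ.outer.tensor δ.outer) (δ.outer.right (op b) (c ⊗ₜ l))
        (δ.ins z (r ⊗ₜ a')) = tmul δ.outer (δ.outer.tensor δ.outer) (c ⊗ₜ l)
        (δ.ins z ((δ.leftB b).rTensor A (r ⊗ₜ a')))
      rw [tmul_balanced, ins_mapFst]
      rfl)

/-- The map `c ⊗ (h ⊗ h') ↦ (c ⊗ l(h)) ⊗_B (r(h) ⊗ l(h')) ⊗_B (r(h') ⊗ a')`. -/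
noncomputable def splTwice (a' : A) : A ⊗[k] (H ⊗[k] H) →ₗ[k]
    (δ.outer.tensor (δ.outer.tensor δ.outer)).carrier :=
  TensorProduct.lift ((δ.insTwice a').compl₁₂ (gam hA) ((gam hA).lTensor A)) ∘ₗ
    (TensorProduct.leftComm k A H H).toLinearMap

/-- Coassociativity of `∑ a ⊗ a' ↦ ∑ (a₀ ⊗ l(a₁)) ⊗_B (r(a₁) ⊗ a')`. -/
theorem assoc_splFst_spl (y : A ⊗[k] A) :
    assoc δ.outer δ.outer δ.outer (splFst hA (spl hA y)) = splSnd hA (spl hA y) := by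
  induction y using TensorProduct.induction_on with
  | zero => simp
  | add x y hx hy => simp only [map_add, hx, hy]
  | tmul a a' =>
    have h₁ : ∀ s : A ⊗[k] H, splSnd hA (splAux hA a' s) =
        splTwice hA a' ((comul (R := k) (A := H)).lTensor A s) := by
      intro s
      induction s using TensorProduct.induction_on with
      | zero => simp
      | add x y hx hy => simp only [map_add, hx, hy]
      | tmul c h =>
        let R : (δ.self.tensor δ.self).carrier ⊗[k] H →ₗ[k]
            (δ.outer.tensor (δ.outer.tensor δ.outer)).carrier :=
          TensorProduct.lift ((LinearMap.lcomp k _ (TensorProduct.mk k A _ c ∘ₗ gam hA)) ∘ₗ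
            δ.insTwice a')
        have hR : ∀ z : (δ.self.tensor δ.self).carrier,
            splSnd hA (δ.ins z (c ⊗ₜ a')) = R (δ.selfCoact z) := by
          intro z
          induction z using self_induction with
          | add x y hx hy => simp only [map_add, LinearMap.add_apply, hx, hy]
          | tmul l r =>
            rw [ins_selfMk, splSnd_outerMk, spl_tmul, selfCoact_selfMk]
            induction δ.coact r using TensorProduct.induction_on with
            | zero => simp
            | add x y hx hy => simp only [map_add, hx, hy]
            | tmul d h' => rfl
        rw [splAux_tmul, hR, selfCoact_gam, LinearMap.lTensor_tmul]
        induction comul (R := k) h using TensorProduct.induction_on with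
        | zero => simp
        | add x y hx hy => simp only [map_add, TensorProduct.tmul_add, hx, hy]
        | tmul => rfl
    have h₂ : ∀ s : A ⊗[k] H,
        assoc δ.outer δ.outer δ.outer (splFst hA (splAux hA a' s)) =
        splTwice hA a' (TensorProduct.assoc k A H H (δ.coact.toLinearMap.rTensor H s)) := by
      intro s
      induction s using TensorProduct.induction_on with
      | zero => simp
      | add x y hx hy => simp only [map_add, hx, hy]
      | tmul c h =>
        have h₃ : ∀ z : (δ.self.tensor δ.self).carrier,
            assoc δ.outer δ.outer δ.outer (splFst hA (δ.ins z (c ⊗ₜ a'))) =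
            (TensorProduct.lift ((δ.insTwice a').compl₁₂ (gam hA)
              ((TensorProduct.mk k A _).flip z)))
              (TensorProduct.comm k A H (δ.coact c)) := by
          intro z
          induction z using self_induction with
          | add x y hx hy =>
            simp only [map_add, LinearMap.add_apply, hx, hy]
            induction TensorProduct.comm k A H (δ.coact c) using TensorProduct.induction_on with
            | zero => simp
            | add x y hx hy => simp only [map_add, ← hx, ← hy]; abel
            | tmul => simp
          | tmul l r =>
            rw [ins_selfMk, splFst_outerMk, spl_tmul]
            induction δ.coact c using TensorProduct.induction_on with
            | zero => simp
            | add x y hx hy => simp only [map_add, LinearMap.add_apply, hx, hy]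
            | tmul d h' =>
              have h₄ : ∀ z' : (δ.self.tensor δ.self).carrier,
                  assoc δ.outer δ.outer δ.outer (tmul (δ.outer.tensor δ.outer) δ.outer
                    (δ.ins z' (d ⊗ₜ l)) (r ⊗ₜ a')) =
                  δ.insTwice a' z' (d ⊗ₜ δ.selfMk l r) := by
                intro z'
                induction z' using self_induction with
                | add x y hx hy => simp only [map_add, LinearMap.add_apply, hx, hy]
                | tmul l' r' => rfl
              exact h₄ (gam hA h')
        rw [splAux_tmul, h₃, LinearMap.rTensor_tmul]
        change _ = splTwice hA a' (TensorProduct.assoc k A H H (δ.coact c ⊗ₜ h))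
        induction δ.coact c using TensorProduct.induction_on with
        | zero => simp
        | add x y hx hy => simp only [map_add, TensorProduct.add_tmul, hx, hy]
        | tmul => rfl
    rw [spl_tmul, h₁, h₂, δ.coassoc]

/-- The descent datum `D(∑ a ⊗ a') = ∑ (a₀ ⊗ l(a₁)) ⊗_B r(a₁) a'` on `A ⊗ A`. -/
noncomputable def desc : A ⊗[k] A →ₗ[k] (δ.outer.tensor δ.self).carrier :=
  tmap (N := δ.outer) (N' := δ.self) LinearMap.id mulOuter (fun _ _ => rfl) δ.mulOuter_left ∘ₗ
    spl hA

theorem desc_apply (y : A ⊗[k] A) : desc hA y =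
    tmap (N := δ.outer) (N' := δ.self) LinearMap.id mulOuter (fun _ _ => rfl) δ.mulOuter_left
      (spl hA y) := rfl

theorem desc_right (b : δ.coinvᵐᵒᵖ) (y : A ⊗[k] A) :
    desc hA (δ.outer.right b y) = (δ.outer.tensor δ.self).right b (desc hA y) := by
  rw [desc_apply, spl_right]
  exact tmap_right (N := δ.outer) (N' := δ.self) _ _ _ _
    (fun c => δ.mulOuter_right (op c)) b.unop _

variable (δ) in
/-- Right multiplication by an element of `A` on `(A ⊗ A) ⊗_B A`. -/
noncomputable def outerSelfMulR (c : A) :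
    (δ.outer.tensor δ.self).carrier →ₗ[k] (δ.outer.tensor δ.self).carrier :=
  tmap (N := δ.self) (N' := δ.self) LinearMap.id (LinearMap.mulRight k c) (fun _ _ => rfl)
    (fun _ _ => mul_assoc _ _ _)

theorem desc_mulRight (c : A) (y : A ⊗[k] A) :
    desc hA ((LinearMap.mulRight k c).lTensor A y) = δ.outerSelfMulR c (desc hA y) := by
  rw [desc_apply, desc_apply, spl_mapSnd]
  induction spl hA y using outer_induction with
  | add x y hx hy => simp only [map_add, hx, hy]
  | tmul a a' d d' =>
    change tmul δ.outer δ.self (a ⊗ₜ a') (d * (d' * c)) = tmul δ.outer δ.self (a ⊗ₜ a') (d * d' * c)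
    rw [mul_assoc]

variable (δ) in
/-- The right action `(a ⊗ a') ⊗_B c ↦ a ⊗ a' c` of `A` on `A ⊗ A`. -/
noncomputable def outerMul : (δ.outer.tensor δ.self).carrier →ₗ[k] A ⊗[k] A :=
  tensorLift (M := δ.outer) (N := δ.self)
    (TensorProduct.curry ((LinearMap.mul' k A).lTensor A ∘ₗ
      (TensorProduct.assoc k A A A).toLinearMap))
    (fun y b c => by
      induction y using TensorProduct.induction_on with
      | zero => simp
      | add x y hx hy => simp only [map_add, LinearMap.add_apply, hx, hy]
      | tmul a a' => simp [mul_assoc])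

theorem outerMul_tmul (y : A ⊗[k] A) (c : A) :
    δ.outerMul (tmul δ.outer δ.self y c) = (LinearMap.mulRight k c).lTensor A y := by
  induction y using TensorProduct.induction_on with
  | zero => simp
  | add x y hx hy => simp only [map_add, LinearMap.add_apply, hx, hy]
  | tmul a a' => rfl

theorem outerMul_desc (y : A ⊗[k] A) : δ.outerMul (desc hA y) = y := by
  have h : ∀ z : (δ.outer.tensor δ.outer).carrier,
      δ.outerMul (tmap (N := δ.outer) (N' := δ.self) LinearMap.id mulOuter (fun _ _ => rfl)
        δ.mulOuter_left z) =
      ((LinearMap.mul' k A).lTensor A ∘ₗ (TensorProduct.assoc k A A A).toLinearMap) (δ.mid z) := by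
    intro z
    induction z using outer_induction with
    | add x y hx hy => simp only [map_add, hx, hy]
    | tmul a a' d d' =>
      change a ⊗ₜ[k] (a' * (d * d')) = a ⊗ₜ[k] (a' * d * d')
      rw [mul_assoc]
  rw [desc_apply, h, mid_spl]
  induction y using TensorProduct.induction_on with
  | zero => simp
  | add x y hx hy => simp only [map_add, hx, hy]
  | tmul a a' => simp

variable (δ) in
/-- The map `y ↦ y ⊗_B 1`. -/
def unitR (M : Bimodule k δ.coinv) : M.carrier →ₗ[k] (M.tensor δ.self).carrier :=
  (tmul M δ.self).flip (1 : A)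

theorem unitR_apply (M : Bimodule k δ.coinv) (m : M.carrier) :
    δ.unitR M m = tmul M δ.self m (1 : A) := rfl

theorem unitR_right (M : Bimodule k δ.coinv) (b : δ.coinvᵐᵒᵖ) (m : M.carrier) :
    δ.unitR M (M.right b m) = (M.tensor δ.self).right b (δ.unitR M m) := by
  refine (tmul_balanced (N := δ.self) m b.unop (1 : A)).trans ?_
  change tmul M δ.self m ((b.unop : A) * 1) = tmul M δ.self m (1 * (b.unop : A))
  rw [mul_one, one_mul]

/-- The descent datum on `A ⊗ A` is coassociative. -/
theorem tmap_desc_desc (y : A ⊗[k] A) :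
    tmap (M := δ.outer) (M' := δ.outer.tensor δ.self) (N := δ.self) (desc hA) LinearMap.id
      (fun b => desc_right hA (op b)) (fun _ _ => rfl) (desc hA y) =
    tmap (M := δ.outer) (M' := δ.outer.tensor δ.self) (N := δ.self) (δ.unitR δ.outer) LinearMap.id
      (fun b => unitR_right _ (op b)) (fun _ _ => rfl) (desc hA y) := by
  let G : (δ.outer.tensor (δ.outer.tensor δ.outer)).carrier →ₗ[k]
      ((δ.outer.tensor δ.self).tensor δ.self).carrier :=
    (assoc δ.outer δ.self δ.self).symm.toLinearEquiv.toLinearMap ∘ₗ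
      tmap (N := δ.outer.tensor δ.outer) (N' := δ.self.tensor δ.self) LinearMap.id
        (tmap (M := δ.outer) (N := δ.outer) (M' := δ.self) (N' := δ.self) mulOuter mulOuter
          (fun b => δ.mulOuter_right (op b)) δ.mulOuter_left) (fun _ _ => rfl)
        (tmap_left (M := δ.outer) (N := δ.outer) (M' := δ.self) (N' := δ.self) _ _ _ _
          δ.mulOuter_left)
  have h₁ : ∀ z : (δ.outer.tensor δ.outer).carrier,
      tmap (M := δ.outer) (M' := δ.outer.tensor δ.self) (N := δ.self) (desc hA) LinearMap.id
      (fun b => desc_right hA (op b)) (fun _ _ => rfl)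
      (tmap (N := δ.outer) (N' := δ.self) LinearMap.id mulOuter (fun _ _ => rfl)
        δ.mulOuter_left z) = G (assoc δ.outer δ.outer δ.outer (splFst hA z)) := by
    intro z
    induction z using outer_induction with
    | add x y hx hy => simp only [map_add, hx, hy]
    | tmul a a' d d' =>
      rw [splFst_outerMk]
      change tmul (δ.outer.tensor δ.self) δ.self (desc hA (a ⊗ₜ a')) (d * d') = _
      rw [desc_apply]
      induction spl hA (a ⊗ₜ a') using outer_induction with
      | add x y hx hy => simp only [map_add, LinearMap.add_apply, hx, hy]
      | tmul => rfl
  have h₂ : ∀ z : (δ.outer.tensor δ.outer).carrier,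
      tmap (M := δ.outer) (M' := δ.outer.tensor δ.self) (N := δ.self) (δ.unitR δ.outer)
      LinearMap.id (fun b => unitR_right _ (op b)) (fun _ _ => rfl)
      (tmap (N := δ.outer) (N' := δ.self) LinearMap.id mulOuter (fun _ _ => rfl)
        δ.mulOuter_left z) = G (splSnd hA z) := by
    intro z
    induction z using outer_induction with
    | add x y hx hy => simp only [map_add, hx, hy]
    | tmul a a' d d' =>
      rw [splSnd_outerMk]
      change _ = (assoc δ.outer δ.self δ.self).symm (tmul δ.outer (δ.self.tensor δ.self) (a ⊗ₜ a')
        (tmap (M := δ.outer) (N := δ.outer) (M' := δ.self) (N' := δ.self) mulOuter mulOuter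
          (fun b => δ.mulOuter_right (op b)) δ.mulOuter_left (spl hA (d ⊗ₜ d'))))
      rw [tmap_mulOuter_spl]
      rfl
  rw [desc_apply]
  exact (h₁ _).trans ((congrArg G (assoc_splFst_spl hA y)).trans (h₂ _).symm)

end ComoduleAlgebra

/-! ### Faithfully flat descent for `A^{□e}` -/

namespace ComoduleAlgebra
open Bimodule

variable {k : Type u} {H : Type w} {A : Type v} [Field k] [Ring H] [HopfAlgebra k H]
  [Ring A] [Algebra k A] (δ : ComoduleAlgebra k H A)

theorem lTensor_counit_coact (a : A) :
    (Coalgebra.counit (R := k) (A := H)).lTensor A (δ.coact a) = a ⊗ₜ 1 := by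
  apply (TensorProduct.rid k A).injective
  rw [δ.counit]
  simp

/-- The map `a ⊗ h ↦ a₀ ⊗ h a₁`. -/
noncomputable def twist : A ⊗[k] H →ₗ[k] A ⊗[k] H :=
  TensorProduct.lift (((LinearMap.mul k (A ⊗[k] H)).flip ∘ₗ δ.coact.toLinearMap).compl₂
    (Algebra.TensorProduct.includeRight : H →ₐ[k] A ⊗[k] H).toLinearMap)

@[simp] theorem twist_tmul (a : A) (h : H) :
    δ.twist (a ⊗ₜ h) = ((1 : A) ⊗ₜ[k] h) * δ.coact a := rfl

/-- The map `a ⊗ h ↦ a₀ ⊗ h S(a₁)`. -/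
noncomputable def untwist : A ⊗[k] H →ₗ[k] A ⊗[k] H :=
  TensorProduct.lift (((LinearMap.mul k (A ⊗[k] H)).flip ∘ₗ δ.coactOp).compl₂
    (Algebra.TensorProduct.includeRight : H →ₐ[k] A ⊗[k] H).toLinearMap)

theorem untwist_tmul (a : A) (h : H) :
    δ.untwist (a ⊗ₜ h) = ((1 : A) ⊗ₜ[k] h) * (HopfAlgebra.antipode k).lTensor A (δ.coact a) := rfl

variable {δ} (hA : δ.IsFaithfullyFlatGalois)

/-- Tensoring with `A` over `B` preserves exactness at `V` of `K → V → Y`. -/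
theorem mem_range_tmap_self (hA : δ.IsFaithfullyFlatGalois) {K V Y : Bimodule k δ.coinv}
    (i : K.carrier →ₗ[k] V.carrier) (hi : ∀ b x, i (K.right (op b) x) = V.right (op b) (i x))
    (d : V.carrier →ₗ[k] Y.carrier) (hd : ∀ b x, d (V.right (op b) x) = Y.right (op b) (d x))
    (hker : ∀ x, d x = 0 → ∃ y, i y = x) (z : (V.tensor δ.self).carrier)
    (hz : tmap (N := δ.self) (N' := δ.self) d LinearMap.id hd (fun _ _ => rfl) z = 0) :
    ∃ u, tmap (N := δ.self) (N' := δ.self) i LinearMap.id hi (fun _ _ => rfl) u = z :=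
  BTensor.mem_range_map_of_flat hA.faithfullyFlat i hi d hd hker z hz

variable (δ) in
/-- The map `(a ⊗ a') ⊗_B c ↦ a ⊗ (a' ⊗_B c)`. -/
noncomputable def reassoc : (δ.outer.tensor δ.self).carrier →ₗ[k]
    A ⊗[k] (δ.self.tensor δ.self).carrier :=
  tensorLift (M := δ.outer) (N := δ.self)
    (LinearMap.mk₂ k (fun y c => (δ.selfMk.flip c).lTensor A y)
      (fun _ _ _ => by simp) (fun _ _ _ => by simp)
      (fun _ _ _ => by simp [LinearMap.lTensor_add])
      (fun _ _ _ => by simp [LinearMap.lTensor_smul]))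
    (fun y b c => by
      induction y using TensorProduct.induction_on with
      | zero => simp
      | add x y hx hy => simp only [map_add, LinearMap.add_apply, hx, hy]
      | tmul a a' => simp [selfMk_balanced])

theorem reassoc_tmul (a a' c : A) :
    δ.reassoc (tmul δ.outer δ.self (a ⊗ₜ a') c) = a ⊗ₜ δ.selfMk a' c := rfl

theorem reassoc_injective : Function.Injective δ.reassoc := by
  let f : A → (δ.self.tensor δ.self).carrier →ₗ[k] (δ.outer.tensor δ.self).carrier := fun a =>
    tmap (M := δ.self) (M' := δ.outer) (N := δ.self) (TensorProduct.mk k A A a) LinearMap.id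
      (fun _ _ => rfl) (fun _ _ => rfl)
  let g : A ⊗[k] (δ.self.tensor δ.self).carrier →ₗ[k] (δ.outer.tensor δ.self).carrier :=
    TensorProduct.lift (LinearMap.mk₂ k (fun a z => f a z)
      (fun a a' z => by
        induction z using self_induction with
        | add x y hx hy => simp only [map_add, hx, hy]; abel
        | tmul l r =>
          change tmul δ.outer δ.self ((a + a') ⊗ₜ l) r = tmul δ.outer δ.self (a ⊗ₜ l) r +
            tmul δ.outer δ.self (a' ⊗ₜ l) r
          rw [TensorProduct.add_tmul, map_add, LinearMap.add_apply])
      (fun c a z => by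
        induction z using self_induction with
        | add x y hx hy => simp only [map_add, hx, hy, smul_add]
        | tmul l r =>
          change tmul δ.outer δ.self ((c • a) ⊗ₜ l) r = c • tmul δ.outer δ.self (a ⊗ₜ l) r
          rw [← TensorProduct.smul_tmul', map_smul, LinearMap.smul_apply])
      (fun a z z' => map_add _ _ _) (fun c a z => map_smul _ _ _))
  apply Function.LeftInverse.injective (g := g)
  intro z
  induction z using tensor_induction with
  | add x y hx hy => simp only [map_add, hx, hy]
  | tmul y c =>
    induction y using TensorProduct.induction_on with
    | zero => simp
    | add x y hx hy => simp only [map_add, LinearMap.add_apply, hx, hy]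
    | tmul a a' => rfl

/-- On `A ⊗ A ⊗ H`, the descent datum becomes `a ⊗ a' ↦ a₀ ⊗ a'₀ ⊗ a₁ a'₁`. -/
theorem canon_reassoc_desc (y : A ⊗[k] A) : δ.canon.lTensor A (δ.reassoc (desc hA y)) =
    δ.twist.lTensor A (TensorProduct.assoc k A A H (δ.coactLeft y)) := by
  induction y using TensorProduct.induction_on with
  | zero => simp
  | add x y hx hy => simp only [map_add, hx, hy]
  | tmul a a' =>
    rw [desc_apply, spl_tmul, coactLeft_tmul]
    induction δ.coact a using TensorProduct.induction_on with
    | zero => simp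
    | add x y hx hy => simp only [map_add, hx, hy]
    | tmul c h =>
      have h₁ : ∀ z : (δ.self.tensor δ.self).carrier,
          δ.reassoc (tmap (N := δ.outer) (N' := δ.self) LinearMap.id mulOuter (fun _ _ => rfl)
            δ.mulOuter_left (δ.ins z (c ⊗ₜ a'))) = c ⊗ₜ δ.mulR a' z := by
        intro z
        induction z using self_induction with
        | add x y hx hy => simp only [map_add, LinearMap.add_apply, hx, hy, TensorProduct.tmul_add]
        | tmul l r => rfl
      rw [splAux_tmul, h₁, LinearMap.lTensor_tmul, canon_mulR, canon_gam]
      rfl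

theorem canon_reassoc_unitR (y : A ⊗[k] A) : δ.canon.lTensor A (δ.reassoc (δ.unitR δ.outer y)) =
    TensorProduct.assoc k A A H (y ⊗ₜ 1) := by
  induction y using TensorProduct.induction_on with
  | zero => simp
  | add x y hx hy => simp only [map_add, TensorProduct.add_tmul, hx, hy]
  | tmul a a' =>
    rw [unitR_apply, reassoc_tmul, LinearMap.lTensor_tmul, canon_selfMk]
    simp

variable (δ) in
/-- The map `A^{□e} ⊗_B A → (A ⊗ A) ⊗_B A` induced by the inclusion. -/
noncomputable def boxSelfIncl :
    (δ.boxBimod.tensor δ.self).carrier →ₗ[k] (δ.outer.tensor δ.self).carrier :=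
  tmap (M := δ.boxBimod) (M' := δ.outer) δ.box.subtype LinearMap.id (fun _ _ => rfl)
    (fun _ _ => rfl)

theorem boxSelfIncl_injective (hA : δ.IsFaithfullyFlatGalois) : Function.Injective δ.boxSelfIncl :=
  hA.faithfullyFlat.1 _ _ δ.boxRight δ.rightAA δ.box.subtype (fun _ _ => rfl)
    Subtype.val_injective

variable (δ) in
/-- The map `A^{□e} ⊗_B A → A ⊗ A`, `(a ⊗ a') ⊗_B c ↦ a ⊗ a' c`. -/
noncomputable def boxMul : (δ.boxBimod.tensor δ.self).carrier →ₗ[k] A ⊗[k] A :=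
  δ.outerMul ∘ₗ δ.boxSelfIncl

theorem boxMul_tmul (x : δ.box) (c : A) : δ.boxMul (tmul δ.boxBimod δ.self x c) =
    (LinearMap.mulRight k c).lTensor A (x : A ⊗[k] A) := outerMul_tmul _ _

variable (δ) [Coalgebra.IsCocomm k H]

theorem antipode_comp_coact_swap (a : A) :
    (TensorProduct.lift ((LinearMap.mul k H).flip ∘ₗ HopfAlgebra.antipode k)).lTensor A
      (TensorProduct.assoc k A H H (δ.coact.toLinearMap.rTensor H (δ.coact a))) = a ⊗ₜ 1 := by
  have h : TensorProduct.lift ((LinearMap.mul k H).flip ∘ₗ HopfAlgebra.antipode k) ∘ₗ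
      comul (R := k) (A := H) = Algebra.linearMap k H ∘ₗ Coalgebra.counit (R := k) (A := H) := by
    rw [← HopfAlgebra.mul_antipode_lTensor_comul]
    conv_rhs => rw [← Coalgebra.comm_comp_comul]
    rw [← LinearMap.comp_assoc, ← LinearMap.comp_assoc]
    congr 1
    ext x y
    rfl
  rw [δ.coassoc, ← LinearMap.lTensor_comp_apply, h, LinearMap.lTensor_comp_apply,
    lTensor_counit_coact]
  simp

theorem untwist_twist (s : A ⊗[k] H) : δ.untwist (δ.twist s) = s := by
  induction s using TensorProduct.induction_on with
  | zero => simp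
  | add x y hx hy => simp only [map_add, hx, hy]
  | tmul a h =>
    have h₁ : ∀ s : A ⊗[k] H, δ.untwist (((1 : A) ⊗ₜ[k] h) * s) = ((1 : A) ⊗ₜ[k] h) *
        (TensorProduct.lift ((LinearMap.mul k H).flip ∘ₗ HopfAlgebra.antipode k)).lTensor A
          (TensorProduct.assoc k A H H (δ.coact.toLinearMap.rTensor H s)) := by
      intro s
      induction s using TensorProduct.induction_on with
      | zero => simp
      | add x y hx hy => simp only [map_add, mul_add, hx, hy]
      | tmul c g =>
        rw [Algebra.TensorProduct.tmul_mul_tmul, one_mul, untwist_tmul]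
        change _ = _ * (TensorProduct.lift ((LinearMap.mul k H).flip ∘ₗ
          HopfAlgebra.antipode k)).lTensor A (TensorProduct.assoc k A H H (δ.coact c ⊗ₜ g))
        induction δ.coact c using TensorProduct.induction_on with
        | zero => simp
        | add x y hx hy => simp only [map_add, TensorProduct.add_tmul, mul_add, hx, hy]
        | tmul => simp [mul_assoc]
    rw [twist_tmul, h₁, antipode_comp_coact_swap]
    simp

theorem twist_injective : Function.Injective δ.twist :=
  Function.LeftInverse.injective δ.untwist_twist

theorem twist_coactOp (a : A) : δ.twist (δ.coactOp a) = a ⊗ₜ 1 := by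
  have h₁ : ∀ s : A ⊗[k] H, δ.twist ((HopfAlgebra.antipode k).lTensor A s) =
      (TensorProduct.lift ((LinearMap.mul k H).flip.compl₂ (HopfAlgebra.antipode k))).lTensor A
        (TensorProduct.assoc k A H H (δ.coact.toLinearMap.rTensor H s)) := by
    intro s
    induction s using TensorProduct.induction_on with
    | zero => simp
    | add x y hx hy => simp only [map_add, hx, hy]
    | tmul c g =>
      rw [LinearMap.lTensor_tmul, twist_tmul]
      change _ = (TensorProduct.lift ((LinearMap.mul k H).flip.compl₂
        (HopfAlgebra.antipode k))).lTensor A (TensorProduct.assoc k A H H (δ.coact c ⊗ₜ g))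
      induction δ.coact c using TensorProduct.induction_on with
      | zero => simp
      | add x y hx hy => simp only [map_add, TensorProduct.add_tmul, mul_add, hx, hy]
      | tmul => simp
  exact (h₁ _).trans (δ.antipode_comp_coact a)

variable {δ} (hA : δ.IsFaithfullyFlatGalois)

/-- The map `a ⊗ h ↦ a₀ ⊗ h a₁` cancels the antipode in the second coaction
`a ⊗ a' ↦ a ⊗ a'₀ ⊗ S(a'₁)` that defines `A^{□e}`. -/
theorem twist_coactRight (y : A ⊗[k] A) : δ.twist.lTensor A
    (TensorProduct.assoc k A A H (δ.coactRight y)) = TensorProduct.assoc k A A H (y ⊗ₜ 1) := by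
  induction y using TensorProduct.induction_on with
  | zero => simp
  | add x y hx hy => simp only [map_add, TensorProduct.add_tmul, hx, hy]
  | tmul a a' =>
    have h : ∀ s : A ⊗[k] H, δ.twist.lTensor A (TensorProduct.assoc k A A H
        ((TensorProduct.mk k A A a).rTensor H s)) = a ⊗ₜ δ.twist s := by
      intro s
      induction s using TensorProduct.induction_on with
      | zero => simp
      | add x y hx hy => simp only [map_add, TensorProduct.tmul_add, hx, hy]
      | tmul => rfl
    have h' : δ.coactRight (a ⊗ₜ a') = (TensorProduct.mk k A A a).rTensor H (δ.coactOp a') :=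
      δ.coactRight_tmul a a'
    rw [h', h, twist_coactOp]
    rfl

/-- `A^{□e}` consists of the elements on which the descent datum is trivial. -/
theorem mem_box_iff (y : A ⊗[k] A) : y ∈ δ.box ↔ desc hA y = δ.unitR δ.outer y := by
  have h₁ : Function.Injective (δ.canon.lTensor A) :=
    Module.Flat.lTensor_preserves_injective_linearMap _ (canon_injective hA)
  have h₂ : Function.Injective (δ.twist.lTensor A) :=
    Module.Flat.lTensor_preserves_injective_linearMap _ δ.twist_injective
  rw [← reassoc_injective.eq_iff, ← h₁.eq_iff, canon_reassoc_desc, canon_reassoc_unitR,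
    ← twist_coactRight, h₂.eq_iff, EmbeddingLike.apply_eq_iff_eq]
  rfl

theorem desc_boxMul (u : (δ.boxBimod.tensor δ.self).carrier) :
    desc hA (δ.boxMul u) = δ.boxSelfIncl u := by
  induction u using tensor_induction with
  | add x y hx hy => simp only [map_add, hx, hy]
  | tmul x c =>
    rw [boxMul_tmul, desc_mulRight, (mem_box_iff hA _).1 x.2]
    change tmul δ.outer δ.self x.1 (1 * c) = tmul δ.outer δ.self x.1 c
    rw [one_mul]

/-- `A^{□e} ⊗_B A → A ⊗ A` is bijective. -/
theorem boxMul_bijective (hA : δ.IsFaithfullyFlatGalois) : Function.Bijective δ.boxMul := by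
  refine ⟨fun u v huv => boxSelfIncl_injective hA ?_, fun y => ?_⟩
  · rw [← desc_boxMul hA, ← desc_boxMul hA, huv]
  · have hd : ∀ b y, (desc hA - δ.unitR δ.outer) (δ.outer.right (op b) y) =
        (δ.outer.tensor δ.self).right (op b) ((desc hA - δ.unitR δ.outer) y) := fun b y => by
      rw [LinearMap.sub_apply, LinearMap.sub_apply, map_sub, desc_right, unitR_right]
    have h : ∀ z : (δ.outer.tensor δ.self).carrier,
        tmap (M := δ.outer) (M' := δ.outer.tensor δ.self) (N := δ.self) (N' := δ.self)
          (desc hA - δ.unitR δ.outer) LinearMap.id hd (fun _ _ => rfl) z =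
        tmap (M := δ.outer) (M' := δ.outer.tensor δ.self) (N := δ.self) (desc hA)
          LinearMap.id (fun b => desc_right hA (op b)) (fun _ _ => rfl) z -
        tmap (M := δ.outer) (M' := δ.outer.tensor δ.self) (N := δ.self) (δ.unitR δ.outer)
          LinearMap.id (fun b => unitR_right _ (op b)) (fun _ _ => rfl) z := by
      intro z
      induction z using tensor_induction with
      | add x y hx hy => simp only [map_add, hx, hy]; abel
      | tmul y c =>
        rw [tmap_tmul, tmap_tmul, tmap_tmul, LinearMap.sub_apply, map_sub, LinearMap.sub_apply]
    obtain ⟨u, hu⟩ := mem_range_tmap_self hA (K := δ.boxBimod) (V := δ.outer)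
      (Y := δ.outer.tensor δ.self) δ.box.subtype (fun _ _ => rfl) (desc hA - δ.unitR δ.outer) hd
      (fun y hy => ⟨⟨y, (mem_box_iff hA y).2 (sub_eq_zero.1 hy)⟩, rfl⟩) (desc hA y)
      ((h _).trans (sub_eq_zero.2 (tmap_desc_desc hA y)))
    exact ⟨u, (congrArg δ.outerMul hu).trans (outerMul_desc hA y)⟩

/-- The inverse `A ⊗ A → A^{□e} ⊗_B A` of `(a ⊗ a') ⊗_B c ↦ a ⊗ a' c`. -/
noncomputable def boxMulInv : A ⊗[k] A →ₗ[k] (δ.boxBimod.tensor δ.self).carrier :=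
  (LinearEquiv.ofBijective δ.boxMul (boxMul_bijective hA)).symm.toLinearMap

theorem boxMul_boxMulInv (y : A ⊗[k] A) : δ.boxMul (boxMulInv hA y) = y :=
  (LinearEquiv.ofBijective δ.boxMul (boxMul_bijective hA)).apply_symm_apply y

theorem boxMulInv_boxMul (u : (δ.boxBimod.tensor δ.self).carrier) :
    boxMulInv hA (δ.boxMul u) = u :=
  (LinearEquiv.ofBijective δ.boxMul (boxMul_bijective hA)).symm_apply_apply u

theorem boxSelfIncl_boxMulInv (y : A ⊗[k] A) : δ.boxSelfIncl (boxMulInv hA y) = desc hA y := by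
  rw [← desc_boxMul hA, boxMul_boxMulInv]

theorem boxMulInv_coe (x : δ.box) : boxMulInv hA x = δ.unitR δ.boxBimod x := by
  rw [← boxMulInv_boxMul hA (δ.unitR δ.boxBimod x), unitR_apply, boxMul_tmul,
    LinearMap.mulRight_one, LinearMap.lTensor_id, LinearMap.id_apply]

/-- Compatibility of `A ⊗ A → A^{□e} ⊗_B A` with maps that preserve `A^{□e}`. -/
theorem boxMulInv_map (f : A ⊗[k] A →ₗ[k] A ⊗[k] A) (g : δ.box →ₗ[k] δ.box)
    (hg : ∀ b x, g (δ.boxRight (op b) x) = δ.boxRight (op b) (g x))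
    (hfg : ∀ x, (g x : A ⊗[k] A) = f x)
    (hf : ∀ c y, f ((LinearMap.mulRight k c).lTensor A y) =
      (LinearMap.mulRight k c).lTensor A (f y)) (y : A ⊗[k] A) :
    boxMulInv hA (f y) = tmap (M := δ.boxBimod) (M' := δ.boxBimod) (N := δ.self) g LinearMap.id hg
      (fun _ _ => rfl) (boxMulInv hA y) := by
  obtain ⟨u, rfl⟩ := (boxMul_bijective hA).2 y
  rw [boxMulInv_boxMul]
  apply (boxMul_bijective hA).1
  rw [boxMul_boxMulInv]
  induction u using tensor_induction with
  | add x y hx hy => simp only [map_add, hx, hy]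
  | tmul x c => rw [tmap_tmul, boxMul_tmul, boxMul_tmul, hf, hfg]; rfl

end ComoduleAlgebra

/-! ### The comultiplication of `A^{□e}` -/

namespace ComoduleAlgebra
open Bimodule

variable {k : Type u} {H : Type w} {A : Type v} [Field k] [Ring H] [HopfAlgebra k H]
  [Ring A] [Algebra k A] {δ : ComoduleAlgebra k H A}

theorem mulSelf_left (b : δ.coinv) (z : (δ.self.tensor δ.self).carrier) :
    δ.mulSelf ((δ.self.tensor δ.self).left b z) = δ.self.left b (δ.mulSelf z) := by
  induction z using self_induction with
  | add x y hx hy => simp only [map_add, hx, hy]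
  | tmul l r => exact mul_assoc (b : A) l r

/-- `X → X ⊗_B A`, `x ↦ x ⊗ 1`, is injective. -/
theorem unitR_injective (hA : δ.IsFaithfullyFlatGalois) (X : Bimodule k δ.coinv) :
    Function.Injective (δ.unitR X) := by
  refine BTensor.injective_of_map (r := X.right) (r' := (X.tensor δ.self).right)
    hA.faithfullyFlat (δ.unitR X) (fun b => unitR_right X (op b)) ?_
  let g : ((X.tensor δ.self).tensor δ.self).carrier →ₗ[k] (X.tensor δ.self).carrier :=
    tmap (N := δ.self.tensor δ.self) (N' := δ.self) LinearMap.id δ.mulSelf (fun _ _ => rfl)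
      mulSelf_left ∘ₗ (assoc X δ.self δ.self).toLinearEquiv.toLinearMap
  refine Function.LeftInverse.injective (g := g) (fun z => ?_)
  induction z using BTensor.induction_on with
  | add x y hx hy =>
    exact ((congrArg g (map_add _ x y)).trans (map_add g _ _)).trans (congrArg₂ _ hx hy)
  | tmul x c =>
    change tmul X δ.self x ((1 : A) * c) = tmul X δ.self x c
    rw [one_mul]

/-- Tensoring with `A` over `B` preserves injectivity. -/
theorem tmap_self_injective (hA : δ.IsFaithfullyFlatGalois) {X Y : Bimodule k δ.coinv}
    (f : X.carrier →ₗ[k] Y.carrier) (hf : ∀ b x, f (X.right (op b) x) = Y.right (op b) (f x))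
    (hinj : Function.Injective f) : Function.Injective
      (tmap (N := δ.self) (N' := δ.self) f LinearMap.id hf (fun _ _ => rfl)) :=
  hA.faithfullyFlat.1 _ _ X.right Y.right f hf hinj

/-- The isomorphism `X ⊗_B (A ⊗ A) → (X ⊗_B A) ⊗ A`. -/
noncomputable def tensorOuter (X : Bimodule k δ.coinv) :
    (X.tensor δ.outer).carrier →ₗ[k] (X.tensor δ.self).carrier ⊗[k] A :=
  tensorLift (LinearMap.mk₂ k (fun x y => (tmul X δ.self x).rTensor A y)
      (fun _ _ _ => by simp [LinearMap.rTensor_add])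
      (fun _ _ _ => by simp [LinearMap.rTensor_smul]) (fun _ _ _ => by simp) (fun _ _ _ => by simp))
    (fun x b y => by
      induction y using TensorProduct.induction_on with
      | zero => simp
      | add x y hx hy => simp only [map_add, hx, hy]
      | tmul a a' => exact congrArg (· ⊗ₜ[k] a') (tmul_balanced (N := δ.self) x b a))

/-- The inverse `(X ⊗_B A) ⊗ A → X ⊗_B (A ⊗ A)`. -/
noncomputable def tensorOuterInv (X : Bimodule k δ.coinv) :
    (X.tensor δ.self).carrier ⊗[k] A →ₗ[k] (X.tensor δ.outer).carrier :=
  TensorProduct.lift (tensorLift (N := δ.self)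
    (LinearMap.mk₂ k (fun x a => tmul X δ.outer x ∘ₗ TensorProduct.mk k A A a)
      (fun _ _ _ => by ext; simp) (fun _ _ _ => by ext; simp) (fun _ _ _ => by ext; simp)
      (fun _ _ _ => by ext; simp))
    (fun x b a => LinearMap.ext fun a' => tmul_balanced (N := δ.outer) x b (a ⊗ₜ a')))

theorem tensorOuter_injective (X : Bimodule k δ.coinv) :
    Function.Injective (tensorOuter (δ := δ) X) := by
  refine Function.LeftInverse.injective (g := tensorOuterInv X) (fun z => ?_)
  induction z using tensor_induction with
  | add x y hx hy => simp only [map_add, hx, hy]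
  | tmul x y =>
    induction y using TensorProduct.induction_on with
    | zero => simp
    | add y z hy hz => simp only [map_add, hy, hz]
    | tmul a a' => rfl

/-- Tensoring with `A ⊗ A` over `B` preserves injectivity. -/
theorem tmap_outer_injective (hA : δ.IsFaithfullyFlatGalois) {X Y : Bimodule k δ.coinv}
    (f : X.carrier →ₗ[k] Y.carrier) (hf : ∀ b x, f (X.right (op b) x) = Y.right (op b) (f x))
    (hinj : Function.Injective f) : Function.Injective
      (tmap (N := δ.outer) (N' := δ.outer) f LinearMap.id hf (fun _ _ => rfl)) := by
  have h₁ : Function.Injective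
      ((tmap (N := δ.self) (N' := δ.self) f LinearMap.id hf (fun _ _ => rfl)).rTensor A) :=
    Module.Flat.rTensor_preserves_injective_linearMap _ (tmap_self_injective hA f hf hinj)
  have h₂ : ∀ z, tensorOuter Y (tmap (N := δ.outer) (N' := δ.outer) f LinearMap.id hf
      (fun _ _ => rfl) z) = (tmap (N := δ.self) (N' := δ.self) f LinearMap.id hf
      (fun _ _ => rfl)).rTensor A (tensorOuter X z) := by
    intro z
    induction z using tensor_induction with
    | add x y hx hy => simp only [map_add, hx, hy]
    | tmul x y =>
      induction y using TensorProduct.induction_on with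
      | zero => simp
      | add y z hy hz => simp only [map_add, hy, hz]
      | tmul a a' => rfl
  intro z z' hz
  apply tensorOuter_injective
  apply h₁
  rw [← h₂, ← h₂, hz]

/-- Let `D` be a descent datum on the right `A`-module `V`.  If `f : X → V` takes values in the
elements on which `D` is trivial and the induced map `X ⊗_B A → V` is surjective, then every
element on which `D` is trivial lies in the range of `f`. -/
theorem mem_range_of_descent (hA : δ.IsFaithfullyFlatGalois) {X V : Bimodule k δ.coinv}
    (D : V.carrier →ₗ[k] (V.tensor δ.self).carrier)
    (hD : ∀ b v, D (V.right (op b) v) = (V.tensor δ.self).right (op b) (D v))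
    (act : (V.tensor δ.self).carrier →ₗ[k] V.carrier)
    (hact : ∀ v, D v = δ.unitR V v → ∀ c : A, D (act (tmul V δ.self v c)) = tmul V δ.self v c)
    (f : X.carrier →ₗ[k] V.carrier) (hf : ∀ b x, f (X.right (op b) x) = V.right (op b) (f x))
    (hDf : ∀ x, D (f x) = δ.unitR V (f x))
    (hsurj : ∀ v, ∃ u, act (tmap (N := δ.self) (N' := δ.self) f LinearMap.id hf
      (fun _ _ => rfl) u) = v)
    (v : V.carrier) (hv : D v = δ.unitR V v) : ∃ x, f x = v := by
  let K : Submodule k V.carrier := LinearMap.eqLocus D (δ.unitR V)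
  have hK : ∀ b, ∀ x ∈ K, V.right b x ∈ K := by
    intro b x hx
    change D _ = δ.unitR V _
    have hx : D x = δ.unitR V x := hx
    rw [unitR_right, ← hx]
    exact hD b.unop x
  let rK := BTensor.subAct V.right K hK
  let fK : X.carrier →ₗ[k] K := f.codRestrict K hDf
  have hfK : ∀ b x, fK (X.right (op b) x) = rK (op b) (fK x) := fun b x => Subtype.ext (hf b x)
  let incl : BTensor rK δ.leftB →ₗ[k] (V.tensor δ.self).carrier :=
    BTensor.map K.subtype LinearMap.id (fun _ _ => rfl) (fun _ _ => rfl)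
  have hincl : Function.Injective incl :=
    hA.faithfullyFlat.1 _ _ rK V.right K.subtype (fun _ _ => rfl) Subtype.val_injective
  have h₁ : ∀ w, D (act (incl w)) = incl w := by
    intro w
    induction w using BTensor.induction_on with
    | add x y hx hy => simp only [map_add, hx, hy]
    | tmul x c => exact hact x.1 x.2 c
  have h₂ : incl ∘ₗ BTensor.map (r := X.right) (l := δ.leftB) (l' := δ.leftB) fK LinearMap.id
      hfK (fun _ _ => rfl) = tmap (N := δ.self) (N' := δ.self) f LinearMap.id hf (fun _ _ => rfl) :=
    BTensor.hom_ext fun _ _ => rfl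
  have h₃ : Function.Surjective fK := by
    refine BTensor.surjective_of_map hA.faithfullyFlat fK hfK (fun w => ?_)
    obtain ⟨u, hu⟩ := hsurj (act (incl w))
    refine ⟨u, hincl ?_⟩
    have h₄ := LinearMap.congr_fun h₂ u
    refine (h₁ _).symm.trans (Eq.trans ?_ (h₁ w))
    exact congrArg D ((congrArg act h₄).trans hu)
  obtain ⟨x, hx⟩ := h₃ ⟨v, hv⟩
  exact ⟨x, congrArg Subtype.val hx⟩

variable (hA : δ.IsFaithfullyFlatGalois)

theorem boxMulInv_left [Coalgebra.IsCocomm k H] (b : δ.coinv) (y : A ⊗[k] A) :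
    boxMulInv hA (δ.outer.left b y) = (δ.boxBimod.tensor δ.self).left b (boxMulInv hA y) :=
  boxMulInv_map hA (δ.outer.left b) (δ.boxLeft b) (fun c x => δ.boxBimod.comm b (op c) x)
    (fun _ => rfl) (fun _ y => lTensor_outer_left δ _ b y |>.symm) y

variable (δ) in
/-- The map `X ⊗_B A^{□e} → X ⊗_B (A ⊗ A)` induced by the inclusion. -/
noncomputable def tensorBoxIncl (X : Bimodule k δ.coinv) :
    (X.tensor δ.boxBimod).carrier →ₗ[k] (X.tensor δ.outer).carrier :=
  tmap (N := δ.boxBimod) (N' := δ.outer) LinearMap.id δ.box.subtype (fun _ _ => rfl)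
    (fun _ _ => rfl)

theorem tensorBoxIncl_tmul (X : Bimodule k δ.coinv) (x : X.carrier) (e : δ.box) :
    δ.tensorBoxIncl X (tmul X δ.boxBimod x e) = tmul X δ.outer x (e : A ⊗[k] A) := rfl

/-- Injective because `x ↦ x ⊗_B 1` from `X ⊗_B A^{□e}` to `(X ⊗_B A^{□e}) ⊗_B A` factors through
this map. -/
theorem tensorBoxIncl_injective [Coalgebra.IsCocomm k H] (hA : δ.IsFaithfullyFlatGalois)
    (X : Bimodule k δ.coinv) :
    Function.Injective (δ.tensorBoxIncl X) := by
  let s : (X.tensor δ.outer).carrier →ₗ[k] ((X.tensor δ.boxBimod).tensor δ.self).carrier :=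
    (assoc X δ.boxBimod δ.self).symm.toLinearEquiv.toLinearMap ∘ₗ
      tmap (N := δ.outer) (N' := δ.boxBimod.tensor δ.self) LinearMap.id (boxMulInv hA)
        (fun _ _ => rfl) (boxMulInv_left hA)
  have hs : ∀ z, s (δ.tensorBoxIncl X z) = δ.unitR (X.tensor δ.boxBimod) z := by
    intro z
    induction z using tensor_induction with
    | add x y hx hy => simp only [map_add, hx, hy]
    | tmul x e =>
      change (assoc X δ.boxBimod δ.self).symm
        (tmul X (δ.boxBimod.tensor δ.self) x (boxMulInv hA e)) = _
      rw [boxMulInv_coe]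
      rfl
  intro z z' hz
  apply unitR_injective hA
  rw [← hs, ← hs, hz]

variable (δ) in
/-- The map `A^{□e} ⊗_B (A ⊗ A) → (A ⊗ A) ⊗_B (A ⊗ A)` induced by the inclusion. -/
noncomputable def boxTensorOuterIncl :
    (δ.boxBimod.tensor δ.outer).carrier →ₗ[k] (δ.outer.tensor δ.outer).carrier :=
  tmap (M := δ.boxBimod) (M' := δ.outer) δ.box.subtype LinearMap.id (fun _ _ => rfl)
    (fun _ _ => rfl)

theorem boxTensorOuterIncl_injective (hA : δ.IsFaithfullyFlatGalois) :
    Function.Injective δ.boxTensorOuterIncl :=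
  tmap_outer_injective hA (X := δ.boxBimod) (Y := δ.outer) δ.box.subtype (fun _ _ => rfl)
    Subtype.val_injective

variable (δ) in
/-- The map `A^{□e} ⊗_B A^{□e} → (A ⊗ A) ⊗_B (A ⊗ A)` induced by the inclusion, as a map of
bimodules. -/
noncomputable def boxBoxIncl :
    (δ.boxBimod.tensor δ.boxBimod).carrier →ₗ[k] (δ.outer.tensor δ.outer).carrier := δ.boxIncl

theorem boxBoxIncl_tmul (x y : δ.box) :
    δ.boxBoxIncl (tmul δ.boxBimod δ.boxBimod x y) = δ.outerMk x y := rfl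

theorem boxTensorOuterIncl_tensorBoxIncl (z : (δ.boxBimod.tensor δ.boxBimod).carrier) :
    δ.boxTensorOuterIncl (δ.tensorBoxIncl δ.boxBimod z) = δ.boxBoxIncl z := by
  induction z using tensor_induction with
  | add x y hx hy => simp only [map_add, hx, hy]
  | tmul x y => rfl

theorem boxBoxIncl_injective [Coalgebra.IsCocomm k H] (hA : δ.IsFaithfullyFlatGalois) :
    Function.Injective δ.boxBoxIncl := by
  intro z z' hz
  apply tensorBoxIncl_injective hA
  apply boxTensorOuterIncl_injective hA
  rw [boxTensorOuterIncl_tensorBoxIncl, boxTensorOuterIncl_tensorBoxIncl, hz]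

/-- The map `∑ a ⊗ a' ↦ ∑ (a₀ ⊗ l(a₁)) ⊗_B (r(a₁) ⊗ a')`, with the first factor read in
`A^{□e}`. -/
noncomputable def splBox [Coalgebra.IsCocomm k H] :
    A ⊗[k] A →ₗ[k] (δ.boxBimod.tensor δ.outer).carrier :=
  tensorOuterInv δ.boxBimod ∘ₗ (boxMulInv hA ∘ₗ (TensorProduct.mk k A A).flip 1).rTensor A

theorem boxTensorOuterIncl_splBox [Coalgebra.IsCocomm k H] (y : A ⊗[k] A) :
    δ.boxTensorOuterIncl (splBox hA y) = spl hA y := by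
  induction y using TensorProduct.induction_on with
  | zero => simp
  | add x y hx hy => simp only [map_add, hx, hy]
  | tmul a a' =>
    have h₁ : ∀ u, δ.boxTensorOuterIncl (tensorOuterInv δ.boxBimod (u ⊗ₜ a')) =
        tensorOuterInv δ.outer (δ.boxSelfIncl u ⊗ₜ a') := by
      intro u
      induction u using tensor_induction with
      | add x y hx hy => simp only [map_add, TensorProduct.add_tmul, hx, hy]
      | tmul x c => rfl
    have h₂ : ∀ s : A ⊗[k] H, tensorOuterInv δ.outer (tmap (N := δ.outer) (N' := δ.self)
        LinearMap.id mulOuter (fun _ _ => rfl) δ.mulOuter_left (splAux hA 1 s) ⊗ₜ a') =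
        splAux hA a' s := by
      intro s
      induction s using TensorProduct.induction_on with
      | zero => simp
      | add x y hx hy => simp only [map_add, TensorProduct.add_tmul, hx, hy]
      | tmul c h =>
        rw [splAux_tmul, splAux_tmul]
        induction gam hA h using self_induction with
        | add x y hx hy => simp only [map_add, LinearMap.add_apply, TensorProduct.add_tmul, hx, hy]
        | tmul l r =>
          change δ.outerMk (c ⊗ₜ l) ((r * 1) ⊗ₜ a') = δ.outerMk (c ⊗ₜ l) (r ⊗ₜ a')
          rw [mul_one]
    refine (h₁ _).trans ?_
    change tensorOuterInv δ.outer (δ.boxSelfIncl (boxMulInv hA (a ⊗ₜ 1)) ⊗ₜ a') = _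
    rw [boxSelfIncl_boxMulInv, desc_apply, spl_tmul, h₂, spl_tmul]

theorem desc_left (b : δ.coinv) (y : A ⊗[k] A) :
    desc hA (δ.outer.left b y) = (δ.outer.tensor δ.self).left b (desc hA y) := by
  rw [desc_apply, spl_left]
  exact tmap_left (M := δ.outer) (M' := δ.outer) (N := δ.outer) (N' := δ.self) _ _ _ _
    (fun _ _ => rfl) b _

/-- The descent datum on `X ⊗_B (A ⊗ A)` induced by that on `A ⊗ A`. -/
noncomputable def tensorDesc (X : Bimodule k δ.coinv) :
    (X.tensor δ.outer).carrier →ₗ[k] ((X.tensor δ.outer).tensor δ.self).carrier :=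
  (assoc X δ.outer δ.self).symm.toLinearEquiv.toLinearMap ∘ₗ
    tmap (N := δ.outer) (N' := δ.outer.tensor δ.self) LinearMap.id (desc hA) (fun _ _ => rfl)
      (desc_left hA)

theorem tensorDesc_tmul (X : Bimodule k δ.coinv) (x : X.carrier) (y : A ⊗[k] A) :
    tensorDesc hA X (tmul X δ.outer x y) = (assoc X δ.outer δ.self).symm
      (tmul X (δ.outer.tensor δ.self) x (desc hA y)) := rfl

theorem outerMul_left (b : δ.coinv) (z : (δ.outer.tensor δ.self).carrier) :
    δ.outerMul ((δ.outer.tensor δ.self).left b z) = δ.outer.left b (δ.outerMul z) := by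
  induction z using tensor_induction with
  | add x y hx hy => simp only [map_add, hx, hy]
  | tmul y c =>
    rw [tensor_left, outerMul_tmul, outerMul_tmul]
    exact lTensor_outer_left δ _ b y

/-- The elements of `X ⊗_B (A ⊗ A)` on which the descent datum is trivial are those of
`X ⊗_B A^{□e}`. -/
theorem exists_tensorBoxIncl_eq [Coalgebra.IsCocomm k H] (X : Bimodule k δ.coinv)
    (v : (X.tensor δ.outer).carrier)
    (hv : tensorDesc hA X v = δ.unitR _ v) : ∃ z, δ.tensorBoxIncl X z = v := by
  let act : ((X.tensor δ.outer).tensor δ.self).carrier →ₗ[k] (X.tensor δ.outer).carrier :=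
    tmap (N := δ.outer.tensor δ.self) (N' := δ.outer) LinearMap.id δ.outerMul (fun _ _ => rfl)
      outerMul_left ∘ₗ (assoc X δ.outer δ.self).toLinearEquiv.toLinearMap
  have hact : ∀ x y c, act (tmul _ δ.self (tmul X δ.outer x y) c) =
      tmul X δ.outer x (δ.outerMul (tmul δ.outer δ.self y c)) := fun _ _ _ => rfl
  have hmul : ∀ (c : A) (v : (X.tensor δ.outer).carrier),
      tensorDesc hA X (act (tmul _ δ.self v c)) = tmap (N := δ.self) (N' := δ.self) LinearMap.id
        (LinearMap.mulRight k c) (fun _ _ => rfl) (fun _ _ => mul_assoc _ _ _)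
        (tensorDesc hA X v) := by
    intro c v
    induction v using tensor_induction with
    | add x y hx hy => simp only [map_add, LinearMap.add_apply, hx, hy]
    | tmul x y =>
      rw [hact, outerMul_tmul, tensorDesc_tmul, tensorDesc_tmul, desc_mulRight]
      induction desc hA y using tensor_induction with
      | add x y hx hy => simp only [map_add, hx, hy]
      | tmul y c' => rfl
  refine mem_range_of_descent hA (X := X.tensor δ.boxBimod) (V := X.tensor δ.outer)
    (tensorDesc hA X) (fun b v => ?_) act (fun v hv c => ?_)
    (δ.tensorBoxIncl X) (tmap_right (N := δ.boxBimod) (N' := δ.outer) _ _ _ _ (fun _ _ => rfl))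
    (fun z => ?_) (fun v => ?_) v hv
  · induction v using tensor_induction with
    | add x y hx hy => simp only [map_add, hx, hy]
    | tmul x y =>
      rw [tensor_right, tensorDesc_tmul, tensorDesc_tmul, desc_right]
      induction desc hA y using tensor_induction with
      | add x y hx hy => simp only [map_add, hx, hy]
      | tmul y c' => rfl
  · rw [hmul, hv]
    change tmul _ δ.self v ((1 : A) * c) = _
    rw [one_mul]
  · induction z using tensor_induction with
    | add x y hx hy => simp only [map_add, hx, hy]
    | tmul x e =>
      rw [tensorBoxIncl_tmul, tensorDesc_tmul, (mem_box_iff hA _).1 e.2]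
      rfl
  · induction v using tensor_induction with
    | add x y hx hy =>
      obtain ⟨u, rfl⟩ := hx
      obtain ⟨u', rfl⟩ := hy
      exact ⟨u + u', by rw [map_add, map_add]⟩
    | tmul x y =>
      obtain ⟨u, rfl⟩ := (boxMul_bijective hA).2 y
      refine ⟨(assoc X δ.boxBimod δ.self).symm (tmul X (δ.boxBimod.tensor δ.self) x u), ?_⟩
      induction u using tensor_induction with
      | add x y hx hy => simp only [map_add, hx, hy]
      | tmul e c => rfl

/-- Coassociativity of `spl` makes the second factors of `spl(x)`, for `x` in `A^{□e}`, invariant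
under the descent datum. -/
theorem tensorDesc_splBox [Coalgebra.IsCocomm k H] (x : δ.box) :
    tensorDesc hA δ.boxBimod (splBox hA x) = δ.unitR _ (splBox hA x) := by
  have hr : ∀ b z, δ.boxTensorOuterIncl ((δ.boxBimod.tensor δ.outer).right (op b) z) =
      (δ.outer.tensor δ.outer).right (op b) (δ.boxTensorOuterIncl z) :=
    tmap_right (M := δ.boxBimod) (M' := δ.outer) (N := δ.outer) (N' := δ.outer) _ _ _ _
      (fun _ _ => rfl)
  apply tmap_self_injective hA δ.boxTensorOuterIncl hr (boxTensorOuterIncl_injective hA)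
  have h₁ : ∀ z, tmap (N := δ.self) (N' := δ.self) δ.boxTensorOuterIncl LinearMap.id hr
      (fun _ _ => rfl) (tensorDesc hA δ.boxBimod z) =
      tensorDesc hA δ.outer (δ.boxTensorOuterIncl z) := by
    intro z
    induction z using tensor_induction with
    | add x y hx hy => simp only [map_add, hx, hy]
    | tmul x y =>
      change _ = tensorDesc hA δ.outer (tmul δ.outer δ.outer x.1 y)
      rw [tensorDesc_tmul, tensorDesc_tmul]
      induction desc hA y using tensor_induction with
      | add x y hx hy => simp only [map_add, hx, hy]
      | tmul y c' => rfl
  have h₂ : ∀ z, tensorDesc hA δ.outer z =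
      tmap (M := δ.outer.tensor δ.outer) (N := δ.outer) (N' := δ.self) LinearMap.id mulOuter
        (fun _ _ => rfl) δ.mulOuter_left ((assoc δ.outer δ.outer δ.outer).symm (splSnd hA z)) := by
    intro z
    induction z using tensor_induction with
    | add x y hx hy => simp only [map_add, hx, hy]
    | tmul y y' =>
      rw [tensorDesc_tmul]
      change _ = tmap (M := δ.outer.tensor δ.outer) (N := δ.outer) (N' := δ.self) LinearMap.id
        mulOuter (fun _ _ => rfl) δ.mulOuter_left ((assoc δ.outer δ.outer δ.outer).symm
          (tmul δ.outer (δ.outer.tensor δ.outer) y (spl hA y')))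
      rw [desc_apply]
      induction spl hA y' using tensor_induction with
      | add x y hx hy => simp only [map_add, hx, hy]
      | tmul => rfl
  have h₃ : ∀ z, tmap (M := δ.outer.tensor δ.outer) (N := δ.outer) (N' := δ.self) LinearMap.id
      mulOuter (fun _ _ => rfl) δ.mulOuter_left (splFst hA z) =
      tmap (M := δ.outer) (M' := δ.outer.tensor δ.outer) (N := δ.self) (spl hA) LinearMap.id
        (fun b => spl_right hA (op b)) (fun _ _ => rfl)
        (tmap (M := δ.outer) (N := δ.outer) (N' := δ.self) LinearMap.id mulOuter
          (fun _ _ => rfl) δ.mulOuter_left z) := by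
    intro z
    induction z using tensor_induction with
    | add x y hx hy => simp only [map_add, hx, hy]
    | tmul y y' => rfl
  rw [h₁, boxTensorOuterIncl_splBox, h₂, ← assoc_splFst_spl, Iso.symm_apply_apply, h₃,
    ← desc_apply, (mem_box_iff hA _).1 x.2, unitR_apply, tmap_tmul, unitR_apply, tmap_tmul,
    boxTensorOuterIncl_splBox]

/-- For `x` in `A^{□e}`, the element `∑ (a₀ ⊗ l(a₁)) ⊗_B (r(a₁) ⊗ a')` lies in
`A^{□e} ⊗_B A^{□e}`. -/
theorem spl_mem_range [Coalgebra.IsCocomm k H] (x : δ.box) :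
    spl hA x ∈ LinearMap.range δ.boxBoxIncl := by
  obtain ⟨z, hz⟩ := exists_tensorBoxIncl_eq hA _ _ (tensorDesc_splBox hA x)
  refine ⟨z, ?_⟩
  rw [← boxTensorOuterIncl_tensorBoxIncl, hz, boxTensorOuterIncl_splBox]

/-- The comultiplication `A^{□e} → A^{□e} ⊗_B A^{□e}`,
`∑ a ⊗ a' ↦ ∑ (a₀ ⊗ l(a₁)) ⊗_B (r(a₁) ⊗ a')`. -/
noncomputable def boxComul [Coalgebra.IsCocomm k H] :
    δ.box →ₗ[k] (δ.boxBimod.tensor δ.boxBimod).carrier :=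
  (LinearEquiv.ofInjective _ (boxBoxIncl_injective hA)).symm.toLinearMap ∘ₗ
    (spl hA ∘ₗ δ.box.subtype).codRestrict _ (spl_mem_range hA)

theorem boxBoxIncl_boxComul [Coalgebra.IsCocomm k H] (x : δ.box) :
    δ.boxBoxIncl (boxComul hA x) = spl hA x :=
  congrArg Subtype.val (LinearEquiv.apply_symm_apply
    (LinearEquiv.ofInjective _ (boxBoxIncl_injective hA))
      ((spl hA ∘ₗ δ.box.subtype).codRestrict _ (spl_mem_range hA) x))

end ComoduleAlgebra

/-! ### Compatibility of the comultiplication with the actions and the coaction -/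

namespace ComoduleAlgebra
open Bimodule

variable {k : Type u} {H : Type w} {A : Type v} [Field k] [Ring H] [HopfAlgebra k H]
  [Ring A] [Algebra k A] {δ : ComoduleAlgebra k H A}

variable (δ) in
/-- The inner right action `(∑ a ⊗ a') c = ∑ a c ⊗ a'` on `A^{□e}`. -/
noncomputable def innerFst (c : δ.coinv) : δ.box →ₗ[k] δ.box :=
  boxFst δ.rightB δ.isColinear_rightB (op c)

variable (δ) in
/-- The inner action `∑ a ⊗ c a'` on `A^{□e}`. -/
noncomputable def innerSnd (c : δ.coinv) : δ.box →ₗ[k] δ.box :=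
  boxSnd δ.leftB δ.isColinear_leftB c

theorem innerFst_coe (c : δ.coinv) (x : δ.box) :
    (δ.innerFst c x : A ⊗[k] A) = (δ.rightB (op c)).rTensor A x := rfl

theorem innerSnd_coe (c : δ.coinv) (x : δ.box) :
    (δ.innerSnd c x : A ⊗[k] A) = (δ.leftB c).lTensor A x := rfl

theorem innerSnd_right (c b : δ.coinv) (x : δ.box) :
    δ.innerSnd c (δ.boxBimod.right (op b) x) = δ.boxBimod.right (op b) (δ.innerSnd c x) := by
  apply Subtype.ext
  change (δ.leftB c).lTensor A ((δ.rightB (op b)).lTensor A x) =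
    (δ.rightB (op b)).lTensor A ((δ.leftB c).lTensor A x)
  rw [← LinearMap.lTensor_comp_apply, ← LinearMap.lTensor_comp_apply]
  congr 2
  exact LinearMap.ext fun a => δ.leftB_rightB c (op b) a

theorem innerFst_left (c b : δ.coinv) (x : δ.box) :
    δ.innerFst c (δ.boxBimod.left b x) = δ.boxBimod.left b (δ.innerFst c x) := by
  apply Subtype.ext
  change (δ.rightB (op c)).rTensor A ((δ.leftB b).rTensor A x) =
    (δ.leftB b).rTensor A ((δ.rightB (op c)).rTensor A x)
  rw [← LinearMap.rTensor_comp_apply, ← LinearMap.rTensor_comp_apply]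
  congr 2
  exact LinearMap.ext fun a => (δ.leftB_rightB b (op c) a).symm

theorem innerFst_right (c b : δ.coinv) (x : δ.box) :
    δ.innerFst c (δ.boxBimod.right (op b) x) = δ.boxBimod.right (op b) (δ.innerFst c x) :=
  boxFst_boxSnd δ.rightB δ.isColinear_rightB δ.rightB δ.isColinear_rightB _ _ x

theorem innerSnd_left (c b : δ.coinv) (x : δ.box) :
    δ.innerSnd c (δ.boxBimod.left b x) = δ.boxBimod.left b (δ.innerSnd c x) :=
  (boxFst_boxSnd δ.leftB δ.isColinear_leftB δ.leftB δ.isColinear_leftB _ _ x).symm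

theorem boxMk_innerFst (M : Bimodule k δ.coinv) (c : δ.coinv) (x : δ.box) (m : M.carrier) :
    δ.boxMk M (δ.innerFst c x) m = δ.boxMk M x (M.left c m) := by
  have := δ.boxMk_balanced M x (c ⊗ₜ 1) m
  rw [boxInner_tmul, env_tmul, map_one, MulOpposite.unop_one, map_one] at this
  exact this

theorem boxMk_innerSnd (M : Bimodule k δ.coinv) (c : δ.coinv) (x : δ.box) (m : M.carrier) :
    δ.boxMk M (δ.innerSnd c x) m = δ.boxMk M x (M.right (op c) m) := by
  have := δ.boxMk_balanced M x (1 ⊗ₜ op c) m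
  rw [boxInner_tmul, env_tmul, map_one, MulOpposite.op_one, map_one] at this
  exact this

theorem boxBoxIncl_left (b : δ.coinv) (z : (δ.boxBimod.tensor δ.boxBimod).carrier) :
    δ.boxBoxIncl ((δ.boxBimod.tensor δ.boxBimod).left b z) =
      (δ.outer.tensor δ.outer).left b (δ.boxBoxIncl z) := by
  induction z using tensor_induction with
  | add x y hx hy => simp only [map_add, hx, hy]
  | tmul x y => rfl

theorem boxBoxIncl_right (b : δ.coinvᵐᵒᵖ) (z : (δ.boxBimod.tensor δ.boxBimod).carrier) :
    δ.boxBoxIncl ((δ.boxBimod.tensor δ.boxBimod).right b z) =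
      (δ.outer.tensor δ.outer).right b (δ.boxBoxIncl z) := by
  induction z using tensor_induction with
  | add x y hx hy => simp only [map_add, hx, hy]
  | tmul x y => rfl

theorem boxBoxIncl_tmap_fst (f : δ.box →ₗ[k] δ.box)
    (hf : ∀ b x, f (δ.boxBimod.right (op b) x) = δ.boxBimod.right (op b) (f x))
    (f' : A ⊗[k] A →ₗ[k] A ⊗[k] A)
    (hf' : ∀ b y, f' (δ.outer.right (op b) y) = δ.outer.right (op b) (f' y))
    (h : ∀ x, (f x : A ⊗[k] A) = f' x) (z : (δ.boxBimod.tensor δ.boxBimod).carrier) :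
    δ.boxBoxIncl (tmap (M := δ.boxBimod) (M' := δ.boxBimod) (N := δ.boxBimod) f LinearMap.id hf
      (fun _ _ => rfl) z) = tmap (M := δ.outer) (M' := δ.outer) (N := δ.outer) f' LinearMap.id hf'
      (fun _ _ => rfl) (δ.boxBoxIncl z) := by
  induction z using tensor_induction with
  | add x y hx hy => simp only [map_add, hx, hy]
  | tmul x y => exact congrArg (fun t => δ.outerMk t (y : A ⊗[k] A)) (h x)

theorem boxBoxIncl_tmap_snd (f : δ.box →ₗ[k] δ.box)
    (hf : ∀ b x, f (δ.boxBimod.left b x) = δ.boxBimod.left b (f x))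
    (f' : A ⊗[k] A →ₗ[k] A ⊗[k] A)
    (hf' : ∀ b y, f' (δ.outer.left b y) = δ.outer.left b (f' y))
    (h : ∀ x, (f x : A ⊗[k] A) = f' x) (z : (δ.boxBimod.tensor δ.boxBimod).carrier) :
    δ.boxBoxIncl (tmap (M := δ.boxBimod) (N := δ.boxBimod) (N' := δ.boxBimod) LinearMap.id f
      (fun _ _ => rfl) hf z) = tmap (M := δ.outer) (N := δ.outer) (N' := δ.outer) LinearMap.id f'
      (fun _ _ => rfl) hf' (δ.boxBoxIncl z) := by
  induction z using tensor_induction with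
  | add x y hx hy => simp only [map_add, hx, hy]
  | tmul x y => exact congrArg (δ.outerMk (x : A ⊗[k] A)) (h y)

variable [Coalgebra.IsCocomm k H]

theorem boxCoact_right (b : δ.coinv) (x : δ.box) :
    δ.boxCoact (δ.boxBimod.right (op b) x) = (δ.boxBimod.right (op b)).rTensor H (δ.boxCoact x) :=
  δ.boxCoact_of_coactLeft (δ.outer.right (op b)) _ (fun _ => rfl)
    (δ.outer_coactLeft_right b) x

theorem boxCoact_left (b : δ.coinv) (x : δ.box) :
    δ.boxCoact (δ.boxBimod.left b x) = (δ.boxBimod.left b).rTensor H (δ.boxCoact x) :=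
  δ.boxCoact_of_coactLeft (δ.outer.left b) _ (fun _ => rfl) (δ.outer_coactLeft_left b) x

theorem boxCoact_coassoc (x : δ.box) :
    TensorProduct.assoc k δ.box H H (δ.boxCoact.rTensor H (δ.boxCoact x)) =
      (comul (R := k) (A := H)).lTensor δ.box (δ.boxCoact x) := by
  have hinj : Function.Injective (δ.box.subtype.rTensor (H ⊗[k] H)) :=
    Module.Flat.rTensor_preserves_injective_linearMap _ Subtype.val_injective
  have h := coactFst_coassoc δ.coact.toLinearMap (comul (R := k) (A := H)) δ.coassoc (x : A ⊗[k] A)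
  have h₁ : ∀ s : δ.box ⊗[k] H, δ.box.subtype.rTensor (H ⊗[k] H)
      (TensorProduct.assoc k δ.box H H (δ.boxCoact.rTensor H s)) =
      TensorProduct.assoc k (A ⊗[k] A) H H (δ.coactLeft.rTensor H (δ.box.subtype.rTensor H s)) := by
    intro s
    induction s using TensorProduct.induction_on with
    | zero => simp
    | add x y hx hy => simp only [map_add, hx, hy]
    | tmul x h =>
      rw [LinearMap.rTensor_tmul, LinearMap.rTensor_tmul, LinearMap.rTensor_tmul,
        Submodule.subtype_apply, ← boxCoact_spec]
      induction δ.boxCoact x using TensorProduct.induction_on with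
      | zero => simp
      | add x y hx hy => simp only [map_add, TensorProduct.add_tmul, hx, hy]
      | tmul => rfl
  apply hinj
  rw [h₁, boxCoact_spec]
  refine h.trans ?_
  change (comul (R := k) (A := H)).lTensor (A ⊗[k] A) (δ.coactLeft x) = _
  rw [← boxCoact_spec]
  exact LinearMap.congr_fun ((LinearMap.lTensor_comp_rTensor _ _ _).trans
    (LinearMap.rTensor_comp_lTensor _ _ _).symm) (δ.boxCoact x)

theorem boxCoact_counit (x : δ.box) : TensorProduct.rid k δ.box
    ((Coalgebra.counit (R := k) (A := H)).lTensor δ.box (δ.boxCoact x)) = x := by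
  apply Subtype.ext
  have h₁ : ∀ s : δ.box ⊗[k] H, ((TensorProduct.rid k δ.box
      ((Coalgebra.counit (R := k) (A := H)).lTensor δ.box s) : δ.box) : A ⊗[k] A) =
      TensorProduct.rid k (A ⊗[k] A) ((Coalgebra.counit (R := k) (A := H)).lTensor _
        (δ.box.subtype.rTensor H s)) := by
    intro s
    induction s using TensorProduct.induction_on with
    | zero => simp
    | add x y hx hy => simp only [map_add, Submodule.coe_add, hx, hy]
    | tmul => simp
  rw [h₁, boxCoact_spec]
  induction (x : A ⊗[k] A) using TensorProduct.induction_on with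
  | zero => simp
  | add x y hx hy => simp only [map_add, hx, hy]
  | tmul a a' =>
    have h₂ : ∀ s : A ⊗[k] H, TensorProduct.rid k (A ⊗[k] A)
        ((Coalgebra.counit (R := k) (A := H)).lTensor _
          (((TensorProduct.mk k A A).flip a').rTensor H s)) =
        TensorProduct.rid k A ((Coalgebra.counit (R := k) (A := H)).lTensor A s) ⊗ₜ a' := by
      intro s
      induction s using TensorProduct.induction_on with
      | zero => simp
      | add x y hx hy => simp only [map_add, TensorProduct.add_tmul, hx, hy]
      | tmul => simp [TensorProduct.smul_tmul']
    rw [coactLeft_tmul, h₂, δ.counit]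

variable (δ) in
/-- The coaction on the first factor of `A^{□e} ⊗_B A^{□e}`. -/
noncomputable def boxBoxCoactFst : (δ.boxBimod.tensor δ.boxBimod).carrier →ₗ[k]
    (δ.boxBimod.tensor δ.boxBimod).carrier ⊗[k] H :=
  tensorCoactFst δ.boxBimod (M := δ.boxBimod) δ.boxCoact boxCoact_right

variable (δ) in
/-- The coaction on the second factor of `A^{□e} ⊗_B A^{□e}`. -/
noncomputable def boxBoxCoactSnd : (δ.boxBimod.tensor δ.boxBimod).carrier →ₗ[k]
    (δ.boxBimod.tensor δ.boxBimod).carrier ⊗[k] H :=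
  tensorCoactSnd δ.boxBimod (N := δ.boxBimod) δ.boxCoact boxCoact_left

theorem boxBoxCoactFst_tmul (x y : δ.box) :
    δ.boxBoxCoactFst (tmul δ.boxBimod δ.boxBimod x y) =
      ((tmul δ.boxBimod δ.boxBimod).flip y).rTensor H (δ.boxCoact x) := rfl

theorem boxBoxCoactSnd_tmul (x y : δ.box) :
    δ.boxBoxCoactSnd (tmul δ.boxBimod δ.boxBimod x y) =
      (tmul δ.boxBimod δ.boxBimod x).rTensor H (δ.boxCoact y) := rfl

theorem boxBoxIncl_boxBoxCoactFst (z : (δ.boxBimod.tensor δ.boxBimod).carrier) :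
    δ.boxBoxIncl.rTensor H (δ.boxBoxCoactFst z) = δ.outerCoactFst (δ.boxBoxIncl z) := by
  induction z using tensor_induction with
  | add x y hx hy => simp only [map_add, hx, hy]
  | tmul x y =>
    have h₁ : δ.boxBoxIncl ∘ₗ (tmul δ.boxBimod δ.boxBimod).flip y =
      δ.outerMk.flip (y : A ⊗[k] A) ∘ₗ δ.box.subtype := rfl
    have h₂ := congrArg (δ.outerMk.flip (y : A ⊗[k] A) |>.rTensor H) (δ.boxCoact_spec x)
    rw [boxBoxCoactFst_tmul, ← LinearMap.rTensor_comp_apply, h₁, LinearMap.rTensor_comp_apply]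
    exact h₂

theorem boxBoxIncl_boxBoxCoactSnd (z : (δ.boxBimod.tensor δ.boxBimod).carrier) :
    δ.boxBoxIncl.rTensor H (δ.boxBoxCoactSnd z) = δ.outerCoactSnd (δ.boxBoxIncl z) := by
  induction z using tensor_induction with
  | add x y hx hy => simp only [map_add, hx, hy]
  | tmul x y =>
    have h₁ : δ.boxBoxIncl ∘ₗ tmul δ.boxBimod δ.boxBimod x =
      δ.outerMk (x : A ⊗[k] A) ∘ₗ δ.box.subtype := rfl
    have h₂ := congrArg (δ.outerMk (x : A ⊗[k] A) |>.rTensor H) (δ.boxCoact_spec y)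
    rw [boxBoxCoactSnd_tmul, ← LinearMap.rTensor_comp_apply, h₁, LinearMap.rTensor_comp_apply]
    exact h₂

variable (hA : δ.IsFaithfullyFlatGalois)

theorem boxComul_left (b : δ.coinv) (x : δ.box) : boxComul hA (δ.boxBimod.left b x) =
    (δ.boxBimod.tensor δ.boxBimod).left b (boxComul hA x) := by
  apply boxBoxIncl_injective hA
  rw [boxBoxIncl_boxComul, boxBoxIncl_left, boxBoxIncl_boxComul]
  exact spl_left hA b x

theorem boxComul_right (b : δ.coinvᵐᵒᵖ) (x : δ.box) : boxComul hA (δ.boxBimod.right b x) =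
    (δ.boxBimod.tensor δ.boxBimod).right b (boxComul hA x) := by
  apply boxBoxIncl_injective hA
  rw [boxBoxIncl_boxComul, boxBoxIncl_right, boxBoxIncl_boxComul]
  exact spl_right hA b x

theorem boxComul_innerFst (c : δ.coinv) (x : δ.box) : boxComul hA (δ.innerFst c x) =
    tmap (M := δ.boxBimod) (M' := δ.boxBimod) (N := δ.boxBimod) (δ.innerFst c) LinearMap.id
      (innerFst_right c) (fun _ _ => rfl) (boxComul hA x) := by
  apply boxBoxIncl_injective hA
  rw [boxBoxIncl_tmap_fst _ _ _ (fun b => δ.rTensor_outer_right _ (op b)) (innerFst_coe c),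
    boxBoxIncl_boxComul, boxBoxIncl_boxComul]
  exact spl_mapFst hA (δ.rightB (op c)) (δ.isColinear_rightB (op c)) x

theorem boxComul_innerSnd (c : δ.coinv) (x : δ.box) : boxComul hA (δ.innerSnd c x) =
    tmap (M := δ.boxBimod) (N := δ.boxBimod) (N' := δ.boxBimod) LinearMap.id (δ.innerSnd c)
      (fun _ _ => rfl) (innerSnd_left c) (boxComul hA x) := by
  apply boxBoxIncl_injective hA
  rw [boxBoxIncl_tmap_snd _ _ _ (δ.lTensor_outer_left _) (innerSnd_coe c),
    boxBoxIncl_boxComul, boxBoxIncl_boxComul]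
  exact spl_mapSnd hA (δ.leftB c) x

/-- The comultiplication of `A^{□e}` takes values in the elements whose middle factors
centralize `B`. -/
theorem boxComul_middle (c : δ.coinv) (x : δ.box) :
    tmap (M := δ.boxBimod) (M' := δ.boxBimod) (N := δ.boxBimod) (δ.innerSnd c) LinearMap.id
      (innerSnd_right c) (fun _ _ => rfl) (boxComul hA x) =
    tmap (M := δ.boxBimod) (N := δ.boxBimod) (N' := δ.boxBimod) LinearMap.id (δ.innerFst c)
      (fun _ _ => rfl) (innerFst_left c) (boxComul hA x) := by
  have h₁ : ∀ z, δ.boxBoxIncl (tmap (M := δ.boxBimod) (M' := δ.boxBimod) (N := δ.boxBimod)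
      (δ.innerSnd c) LinearMap.id (innerSnd_right c) (fun _ _ => rfl) z) =
      δ.midLeft c (δ.boxBoxIncl z) := by
    intro z
    induction z using tensor_induction with
    | add x y hx hy => simp only [map_add, hx, hy]
    | tmul x y => rfl
  have h₂ : ∀ z, δ.boxBoxIncl (tmap (M := δ.boxBimod) (N := δ.boxBimod) (N' := δ.boxBimod)
      LinearMap.id (δ.innerFst c) (fun _ _ => rfl) (innerFst_left c) z) =
      δ.midRight c (δ.boxBoxIncl z) := by
    intro z
    induction z using tensor_induction with
    | add x y hx hy => simp only [map_add, hx, hy]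
    | tmul x y => rfl
  apply boxBoxIncl_injective hA
  rw [h₁, h₂, boxBoxIncl_boxComul, midLeft_spl]

theorem boxBoxCoactFst_boxComul (x : δ.box) :
    δ.boxBoxCoactFst (boxComul hA x) = (boxComul hA).rTensor H (δ.boxCoact x) := by
  have hinj : Function.Injective (δ.boxBoxIncl.rTensor H) :=
    Module.Flat.rTensor_preserves_injective_linearMap _ (boxBoxIncl_injective hA)
  have h : δ.boxBoxIncl ∘ₗ boxComul hA = spl hA ∘ₗ δ.box.subtype :=
    LinearMap.ext (boxBoxIncl_boxComul hA)
  apply hinj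
  rw [boxBoxIncl_boxBoxCoactFst, boxBoxIncl_boxComul, outerCoactFst_spl,
    ← LinearMap.rTensor_comp_apply, h, LinearMap.rTensor_comp_apply, boxCoact_spec]

theorem boxBoxCoactSnd_boxComul (x : δ.box) :
    δ.boxBoxCoactSnd (boxComul hA x) = (boxComul hA).rTensor H (δ.boxCoact x) := by
  have hinj : Function.Injective (δ.boxBoxIncl.rTensor H) :=
    Module.Flat.rTensor_preserves_injective_linearMap _ (boxBoxIncl_injective hA)
  have h : δ.boxBoxIncl ∘ₗ boxComul hA = spl hA ∘ₗ δ.box.subtype :=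
    LinearMap.ext (boxBoxIncl_boxComul hA)
  apply hinj
  rw [boxBoxIncl_boxBoxCoactSnd, boxBoxIncl_boxComul, outerCoactSnd_spl,
    ← LinearMap.rTensor_comp_apply, h, LinearMap.rTensor_comp_apply, boxCoact_spec]

/-- The comultiplication of `A^{□e}` is colinear for the diagonal coaction:
`x₁₀ ⊗ x₂₀ ⊗ x₁₁ ⊗ x₂₁ = Δ(x₀) ⊗ x₁ ⊗ x₂`. -/
theorem boxBoxCoact_boxComul (x : δ.box) :
    TensorProduct.assoc k _ H H (δ.boxBoxCoactFst.rTensor H (δ.boxBoxCoactSnd (boxComul hA x))) =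
      TensorProduct.map (boxComul hA) (comul (R := k) (A := H)) (δ.boxCoact x) := by
  have h : δ.boxBoxCoactFst ∘ₗ boxComul hA = (boxComul hA).rTensor H ∘ₗ δ.boxCoact :=
    LinearMap.ext (boxBoxCoactFst_boxComul hA)
  have h₁ : ∀ s : (δ.box ⊗[k] H) ⊗[k] H, TensorProduct.assoc k _ H H
      (((boxComul hA).rTensor H).rTensor H s) =
      (boxComul hA).rTensor (H ⊗[k] H) (TensorProduct.assoc k _ H H s) := fun s =>
    LinearMap.congr_fun (f := (TensorProduct.assoc k _ H H).toLinearMap ∘ₗ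
      ((boxComul hA).rTensor H).rTensor H) (g := (boxComul hA).rTensor (H ⊗[k] H) ∘ₗ
        (TensorProduct.assoc k _ H H).toLinearMap)
      (TensorProduct.ext_threefold fun _ _ _ => rfl) s
  rw [boxBoxCoactSnd_boxComul, ← LinearMap.rTensor_comp_apply, h, LinearMap.rTensor_comp_apply, h₁,
    boxCoact_coassoc, ← LinearMap.comp_apply, LinearMap.rTensor_comp_lTensor]

/-- The map `x ⊗_B y ↦ Δ(x) ⊗_B y`. -/
noncomputable def comulFst : (δ.boxBimod.tensor δ.boxBimod).carrier →ₗ[k]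
    ((δ.boxBimod.tensor δ.boxBimod).tensor δ.boxBimod).carrier :=
  tmap (M := δ.boxBimod) (M' := δ.boxBimod.tensor δ.boxBimod) (boxComul hA) LinearMap.id
    (fun b => boxComul_right hA (op b)) (fun _ _ => rfl)

/-- The map `x ⊗_B y ↦ x ⊗_B Δ(y)`. -/
noncomputable def comulSnd : (δ.boxBimod.tensor δ.boxBimod).carrier →ₗ[k]
    (δ.boxBimod.tensor (δ.boxBimod.tensor δ.boxBimod)).carrier :=
  tmap (N := δ.boxBimod) (N' := δ.boxBimod.tensor δ.boxBimod) LinearMap.id (boxComul hA)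
    (fun _ _ => rfl) (boxComul_left hA)

theorem comulFst_tmul (x y : δ.box) : comulFst hA (tmul δ.boxBimod δ.boxBimod x y) =
    tmul (δ.boxBimod.tensor δ.boxBimod) δ.boxBimod (boxComul hA x) y := rfl

theorem comulSnd_tmul (x y : δ.box) : comulSnd hA (tmul δ.boxBimod δ.boxBimod x y) =
    tmul δ.boxBimod (δ.boxBimod.tensor δ.boxBimod) x (boxComul hA y) := rfl

/-- The comultiplication of `A^{□e}` is coassociative. -/
theorem comulFst_boxComul (x : δ.box) : comulFst hA (boxComul hA x) =
    (assoc δ.boxBimod δ.boxBimod δ.boxBimod).symm (comulSnd hA (boxComul hA x)) := by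
  let I : ((δ.boxBimod.tensor δ.boxBimod).tensor δ.boxBimod).carrier →ₗ[k]
      ((δ.outer.tensor δ.outer).tensor δ.outer).carrier :=
    tmap (M := δ.boxBimod.tensor δ.boxBimod) (M' := δ.outer.tensor δ.outer) (N := δ.outer)
      δ.boxBoxIncl LinearMap.id (fun b => boxBoxIncl_right (op b)) (fun _ _ => rfl) ∘ₗ
    δ.tensorBoxIncl (δ.boxBimod.tensor δ.boxBimod)
  have hI : ∀ z y, I (tmul (δ.boxBimod.tensor δ.boxBimod) δ.boxBimod z y) =
      tmul (δ.outer.tensor δ.outer) δ.outer (δ.boxBoxIncl z) (y : A ⊗[k] A) := fun _ _ => rfl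
  have hinj : Function.Injective I :=
    (tmap_outer_injective hA (X := δ.boxBimod.tensor δ.boxBimod) (Y := δ.outer.tensor δ.outer)
      δ.boxBoxIncl (fun b => boxBoxIncl_right (op b)) (boxBoxIncl_injective hA)).comp
    (tensorBoxIncl_injective hA _)
  have h₁ : ∀ z, I (comulFst hA z) = splFst hA (δ.boxBoxIncl z) := by
    intro z
    induction z using tensor_induction with
    | add x y hx hy => simp only [map_add, hx, hy]
    | tmul x y =>
      rw [comulFst_tmul, hI, boxBoxIncl_boxComul]
      rfl
  have h₂ : ∀ z, assoc δ.outer δ.outer δ.outer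
      (I ((assoc δ.boxBimod δ.boxBimod δ.boxBimod).symm (comulSnd hA z))) =
      splSnd hA (δ.boxBoxIncl z) := by
    intro z
    induction z using tensor_induction with
    | add x y hx hy => simp only [map_add, hx, hy]
    | tmul x y =>
      rw [boxBoxIncl_tmul, splSnd_outerMk, comulSnd_tmul, ← boxBoxIncl_boxComul]
      induction boxComul hA y using tensor_induction with
      | add x y hx hy => simp only [map_add, hx, hy]
      | tmul => rfl
  apply hinj
  apply (assoc δ.outer δ.outer δ.outer).toLinearEquiv.injective
  refine (congrArg (assoc δ.outer δ.outer δ.outer) (h₁ _)).trans (Eq.trans ?_ (h₂ _).symm)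
  rw [boxBoxIncl_boxComul, assoc_splFst_spl]

theorem boxAct_right (x : δ.box) (b c : δ.coinv) :
    δ.boxAct (δ.boxBimod.right (op c) x) b = δ.boxAct x b * c := by
  apply Subtype.ext
  change sandwich (b : A) ((δ.rightB (op c)).lTensor A (x : A ⊗[k] A)) =
    sandwich (b : A) (x : A ⊗[k] A) * (c : A)
  induction (x : A ⊗[k] A) using TensorProduct.induction_on with
  | zero => simp
  | add x y hx hy => simp only [map_add, add_mul, hx, hy]
  | tmul a a' => simp [mul_assoc]

theorem boxAct_left (x : δ.box) (b c : δ.coinv) :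
    δ.boxAct (δ.boxBimod.left c x) b = c * δ.boxAct x b := by
  apply Subtype.ext
  change sandwich (b : A) ((δ.leftB c).rTensor A (x : A ⊗[k] A)) =
    (c : A) * sandwich (b : A) (x : A ⊗[k] A)
  induction (x : A ⊗[k] A) using TensorProduct.induction_on with
  | zero => simp
  | add x y hx hy => simp only [map_add, mul_add, hx, hy]
  | tmul a a' => simp [mul_assoc]

variable (δ) in
/-- The map `x ⊗_B y ↦ x(b) y`, for the action `(∑ a ⊗ a')(b) = ∑ a b a'` of `A^{□e}` on `B`. -/
noncomputable def actFst (b : δ.coinv) : (δ.boxBimod.tensor δ.boxBimod).carrier →ₗ[k] δ.box :=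
  tensorLift (M := δ.boxBimod) (N := δ.boxBimod) (δ.boxBimod.left.toLinearMap ∘ₗ δ.boxAct.flip b)
    (fun x c y => by
      change δ.boxBimod.left (δ.boxAct (δ.boxBimod.right (op c) x) b) y =
        δ.boxBimod.left (δ.boxAct x b) (δ.boxBimod.left c y)
      rw [boxAct_right, map_mul]
      rfl)

theorem actFst_tmul (b : δ.coinv) (x y : δ.box) :
    δ.actFst b (tmul δ.boxBimod δ.boxBimod x y) = δ.boxBimod.left (δ.boxAct x b) y := rfl

/-- The counit property `x₁(b) x₂ = x b` of the comultiplication of `A^{□e}`. -/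
theorem actFst_boxComul (b : δ.coinv) (x : δ.box) :
    δ.actFst b (boxComul hA x) = δ.innerFst b x := by
  have h₁ : ∀ z, (δ.actFst b z : A ⊗[k] A) =
      (sandwich (b : A)).rTensor A (δ.mid (δ.boxBoxIncl z)) := by
    intro z
    induction z using tensor_induction with
    | add x y hx hy => simp only [map_add, Submodule.coe_add, hx, hy]
    | tmul x y =>
      rw [boxBoxIncl_tmul, actFst_tmul]
      change (LinearMap.mulLeft k (sandwich (b : A) (x : A ⊗[k] A))).rTensor A y = _
      induction (x : A ⊗[k] A) using TensorProduct.induction_on with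
      | zero => simp
      | add x y hx hy =>
        rw [map_add, map_add, LinearMap.add_apply, map_add, map_add, ← hx, ← hy,
          ← LinearMap.add_apply, ← LinearMap.rTensor_add]
        congr 2
        ext
        simp [add_mul]
      | tmul a a' =>
        induction (y : A ⊗[k] A) using TensorProduct.induction_on with
        | zero => simp
        | add x y hx hy => simp only [map_add, hx, hy]
        | tmul c c' => simp [mul_assoc]
  apply Subtype.ext
  rw [h₁, boxBoxIncl_boxComul, mid_spl, innerFst_coe]
  induction (x : A ⊗[k] A) using TensorProduct.induction_on with
  | zero => simp
  | add x y hx hy => simp only [map_add, hx, hy]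
  | tmul a a' => simp

end ComoduleAlgebra

/-! ### Actions of `A^{□e}` on bimodules and their tensor products -/

namespace ComoduleAlgebra
open Bimodule

variable {k : Type u} {H : Type w} {A : Type v} [Field k] [Ring H] [HopfAlgebra k H]
  [Ring A] [Algebra k A] {δ : ComoduleAlgebra k H A} {M M' N N' P P' : Bimodule k δ.coinv}

@[elab_as_elim]
theorem boxTensor_induction {p : (δ.boxTensor M).carrier → Prop} (z : (δ.boxTensor M).carrier)
    (mk : ∀ x m, p (δ.boxMk M x m)) (add : ∀ x y, p x → p y → p (x + y)) : p z :=
  BTensor.induction_on z mk add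

@[elab_as_elim]
theorem boxTensor_tensor_induction {p : (δ.boxTensor (M.tensor M')).carrier → Prop}
    (z : (δ.boxTensor (M.tensor M')).carrier)
    (mk : ∀ x m m', p (δ.boxMk (M.tensor M') x (tmul M M' m m')))
    (add : ∀ x y, p x → p y → p (x + y)) : p z := by
  induction z using boxTensor_induction with
  | add x y hx hy => exact add x y hx hy
  | mk x m =>
    induction m using tensor_induction with
    | add m n hm hn => rw [map_add]; exact add _ _ hm hn
    | tmul m m' => exact mk x m m'

theorem boxTensor_left (b : δ.coinv) (x : δ.box) (m : M.carrier) :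
    (δ.boxTensor M).left b (δ.boxMk M x m) = δ.boxMk M (δ.boxBimod.left b x) m := rfl

theorem boxTensor_right (b : δ.coinvᵐᵒᵖ) (x : δ.box) (m : M.carrier) :
    (δ.boxTensor M).right b (δ.boxMk M x m) = δ.boxMk M (δ.boxBimod.right b x) m := rfl

theorem boxTensorMap_boxMk (f : M.Iso N) (x : δ.box) (m : M.carrier) :
    δ.boxTensorMap f (δ.boxMk M x m) = δ.boxMk N x (f m) := rfl

variable (M M') in
/-- The map `x ⊗_B y ↦ (x ⊗ m) ⊗_B (y ⊗ m')`. -/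
noncomputable def boxIns (m : M.carrier) (m' : M'.carrier) :
    (δ.boxBimod.tensor δ.boxBimod).carrier →ₗ[k]
      ((δ.boxTensor M).tensor (δ.boxTensor M')).carrier := δ.boxInsert M M' m m'

theorem boxIns_tmul (m : M.carrier) (m' : M'.carrier) (x y : δ.box) :
    boxIns M M' m m' (tmul δ.boxBimod δ.boxBimod x y) =
      tmul (δ.boxTensor M) (δ.boxTensor M') (δ.boxMk M x m) (δ.boxMk M' y m') := rfl

theorem boxIns_fst_left (c : δ.coinv) (m : M.carrier) (m' : M'.carrier)
    (z : (δ.boxBimod.tensor δ.boxBimod).carrier) :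
    boxIns M M' (M.left c m) m' z = boxIns M M' m m' (tmap (M := δ.boxBimod) (M' := δ.boxBimod)
      (N := δ.boxBimod) (δ.innerFst c) LinearMap.id (innerFst_right c) (fun _ _ => rfl) z) := by
  induction z using tensor_induction with
  | add x y hx hy => simp only [map_add, hx, hy]
  | tmul x y => rw [tmap_tmul, boxIns_tmul, boxIns_tmul, boxMk_innerFst]; rfl

theorem boxIns_fst_right (c : δ.coinv) (m : M.carrier) (m' : M'.carrier)
    (z : (δ.boxBimod.tensor δ.boxBimod).carrier) :
    boxIns M M' (M.right (op c) m) m' z = boxIns M M' m m' (tmap (M := δ.boxBimod)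
      (M' := δ.boxBimod) (N := δ.boxBimod) (δ.innerSnd c) LinearMap.id (innerSnd_right c)
        (fun _ _ => rfl) z) := by
  induction z using tensor_induction with
  | add x y hx hy => simp only [map_add, hx, hy]
  | tmul x y => rw [tmap_tmul, boxIns_tmul, boxIns_tmul, boxMk_innerSnd]; rfl

theorem boxIns_snd_left (c : δ.coinv) (m : M.carrier) (m' : M'.carrier)
    (z : (δ.boxBimod.tensor δ.boxBimod).carrier) :
    boxIns M M' m (M'.left c m') z = boxIns M M' m m' (tmap (M := δ.boxBimod)
      (N := δ.boxBimod) (N' := δ.boxBimod) LinearMap.id (δ.innerFst c) (fun _ _ => rfl)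
        (innerFst_left c) z) := by
  induction z using tensor_induction with
  | add x y hx hy => simp only [map_add, hx, hy]
  | tmul x y => rw [tmap_tmul, boxIns_tmul, boxIns_tmul, boxMk_innerFst]; rfl

theorem boxIns_snd_right (c : δ.coinv) (m : M.carrier) (m' : M'.carrier)
    (z : (δ.boxBimod.tensor δ.boxBimod).carrier) :
    boxIns M M' m (M'.right (op c) m') z = boxIns M M' m m' (tmap (M := δ.boxBimod)
      (N := δ.boxBimod) (N' := δ.boxBimod) LinearMap.id (δ.innerSnd c) (fun _ _ => rfl)
        (innerSnd_left c) z) := by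
  induction z using tensor_induction with
  | add x y hx hy => simp only [map_add, hx, hy]
  | tmul x y => rw [tmap_tmul, boxIns_tmul, boxIns_tmul, boxMk_innerSnd]; rfl

section Split

variable [Coalgebra.IsCocomm k H] (hA : δ.IsFaithfullyFlatGalois)

variable (M M') in
/-- The map `x ⊗ (m ⊗_B m') ↦ (x₁ ⊗ m) ⊗_B (x₂ ⊗ m')`, with the arguments in the other order. -/
noncomputable def preSplitMap : (M.tensor M').carrier →ₗ[k] δ.box →ₗ[k]
    ((δ.boxTensor M).tensor (δ.boxTensor M')).carrier :=
  tensorLift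
    (LinearMap.mk₂ k (fun m m' => boxIns M M' m m' ∘ₗ boxComul hA)
      (fun m n m' => by
        ext x
        change boxIns M M' (m + n) m' _ = boxIns M M' m m' _ + boxIns M M' n m' _
        induction boxComul hA x using tensor_induction with
        | add x y hx hy => simp only [map_add, hx, hy]; abel
        | tmul x y =>
          rw [boxIns_tmul, boxIns_tmul, boxIns_tmul, map_add, map_add, LinearMap.add_apply])
      (fun c m m' => by
        ext x
        change boxIns M M' (c • m) m' _ = c • boxIns M M' m m' _
        induction boxComul hA x using tensor_induction with
        | add x y hx hy => simp only [map_add, hx, hy, smul_add]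
        | tmul x y => rw [boxIns_tmul, boxIns_tmul, map_smul, map_smul, LinearMap.smul_apply])
      (fun m m' n' => by
        ext x
        change boxIns M M' m (m' + n') _ = boxIns M M' m m' _ + boxIns M M' m n' _
        induction boxComul hA x using tensor_induction with
        | add x y hx hy => simp only [map_add, hx, hy]; abel
        | tmul x y => rw [boxIns_tmul, boxIns_tmul, boxIns_tmul, map_add, map_add])
      (fun c m m' => by
        ext x
        change boxIns M M' m (c • m') _ = c • boxIns M M' m m' _
        induction boxComul hA x using tensor_induction with
        | add x y hx hy => simp only [map_add, hx, hy, smul_add]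
        | tmul x y => rw [boxIns_tmul, boxIns_tmul, map_smul, map_smul]))
    (fun m b m' => LinearMap.ext fun x => by
      change boxIns M M' _ m' (boxComul hA x) = boxIns M M' m _ (boxComul hA x)
      rw [boxIns_fst_right, boxIns_snd_left, boxComul_middle])

theorem preSplitMap_tmul (m : M.carrier) (m' : M'.carrier) (x : δ.box) :
    preSplitMap M M' hA (tmul M M' m m') x = boxIns M M' m m' (boxComul hA x) := rfl

theorem preSplitMap_boxInner (x : δ.box) (s : δ.coinv ⊗[k] δ.coinvᵐᵒᵖ)
    (z : (M.tensor M').carrier) : preSplitMap M M' hA z (δ.boxInner (op s) x) =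
      preSplitMap M M' hA ((M.tensor M').env s z) x := by
  induction s using TensorProduct.induction_on with
  | zero => simp
  | add s t hs ht =>
    rw [MulOpposite.op_add, map_add, LinearMap.add_apply, map_add, map_add, LinearMap.add_apply,
      map_add, LinearMap.add_apply, hs, ht]
  | tmul c c' =>
    induction z using tensor_induction with
    | add x y hx hy => simp only [map_add, LinearMap.add_apply, hx, hy]
    | tmul m m' =>
      rw [boxInner_tmul, env_tmul, tensor_right, tensor_left, preSplitMap_tmul, preSplitMap_tmul]
      change boxIns M M' m m' (boxComul hA (δ.innerSnd c'.unop (δ.innerFst c x))) =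
        boxIns M M' (M.left c m) (M'.right (op c'.unop) m') (boxComul hA x)
      rw [boxComul_innerSnd, boxComul_innerFst, ← boxIns_snd_right, ← boxIns_fst_left]

variable (M M') in
/-- The map `x ⊗ (m ⊗_B m') ↦ (x₁ ⊗ m) ⊗_B (x₂ ⊗ m')`. -/
noncomputable def splitMap : (δ.boxTensor (M.tensor M')).carrier →ₗ[k]
    ((δ.boxTensor M).tensor (δ.boxTensor M')).carrier :=
  BTensor.lift (preSplitMap M M' hA).flip (preSplitMap_boxInner hA)

theorem splitMap_boxMk (x : δ.box) (m : M.carrier) (m' : M'.carrier) :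
    splitMap M M' hA (δ.boxMk (M.tensor M') x (tmul M M' m m')) =
      boxIns M M' m m' (boxComul hA x) := rfl

theorem isSplitMap_splitMap : δ.IsSplitMap hA M M' (splitMap M M' hA) :=
  fun x _ _ => ⟨boxComul hA x, boxBoxIncl_boxComul hA x, rfl⟩

/-- There is only one map `g`, because `A^{□e} ⊗_B A^{□e} → (A ⊗ A) ⊗_B (A ⊗ A)` is injective. -/
theorem IsSplitMap.eq_splitMap {g : (δ.boxTensor (M.tensor M')).carrier →ₗ[k]
    ((δ.boxTensor M).tensor (δ.boxTensor M')).carrier} (hg : δ.IsSplitMap hA M M' g) :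
    g = splitMap M M' hA := by
  ext z
  induction z using boxTensor_tensor_induction with
  | add x y hx hy => rw [map_add, map_add, hx, hy]
  | mk x m m' =>
    obtain ⟨y, hy, h⟩ := hg x m m'
    have : y = boxComul hA x :=
      boxBoxIncl_injective hA (Eq.trans hy (boxBoxIncl_boxComul hA x).symm)
    rw [h, this, splitMap_boxMk]
    rfl

end Split

variable (δ) in
/-- A `B`-bilinear map `A^{□e} ⊗_{B^e} M → M`. -/
structure BoxAction (M : Bimodule k δ.coinv) where
  act : (δ.boxTensor M).carrier →ₗ[k] M.carrier
  map_left : ∀ b z, act ((δ.boxTensor M).left b z) = M.left b (act z)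
  map_right : ∀ b z, act ((δ.boxTensor M).right b z) = M.right b (act z)

/-- The map `x ↦ x m` for a bilinear map `A^{□e} ⊗_{B^e} M → M`, `x ⊗ m ↦ x m`. -/
noncomputable def BoxAction.on (a : δ.BoxAction M) (m : M.carrier) : δ.box →ₗ[k] M.carrier :=
  a.act ∘ₗ (δ.boxMk M).flip m

theorem BoxAction.on_apply (a : δ.BoxAction M) (m : M.carrier) (x : δ.box) :
    a.on m x = a.act (δ.boxMk M x m) := rfl

theorem BoxAction.on_add (a : δ.BoxAction M) (x : δ.box) (m n : M.carrier) :
    a.on (m + n) x = a.on m x + a.on n x := by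
  rw [on_apply, on_apply, on_apply, map_add, map_add]

theorem BoxAction.on_left (a : δ.BoxAction M) (m : M.carrier) (b : δ.coinv) (x : δ.box) :
    a.on m (δ.boxBimod.left b x) = M.left b (a.on m x) := a.map_left b (δ.boxMk M x m)

theorem BoxAction.on_right (a : δ.BoxAction M) (m : M.carrier) (b : δ.coinvᵐᵒᵖ) (x : δ.box) :
    a.on m (δ.boxBimod.right b x) = M.right b (a.on m x) := a.map_right b (δ.boxMk M x m)

/-- The map `x ⊗_B y ↦ x m ⊗_B y m'`. -/
noncomputable def BoxAction.onPair (a : δ.BoxAction M) (a' : δ.BoxAction M') (m : M.carrier)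
    (m' : M'.carrier) : (δ.boxBimod.tensor δ.boxBimod).carrier →ₗ[k] (M.tensor M').carrier :=
  tmap (M := δ.boxBimod) (N := δ.boxBimod) (a.on m) (a'.on m') (fun b => a.on_right m (op b))
    (a'.on_left m')

theorem BoxAction.onPair_tmul (a : δ.BoxAction M) (a' : δ.BoxAction M') (m : M.carrier)
    (m' : M'.carrier) (x y : δ.box) : a.onPair a' m m' (tmul δ.boxBimod δ.boxBimod x y) =
      tmul M M' (a.on m x) (a'.on m' y) := rfl

theorem BoxAction.onPair_left (a : δ.BoxAction M) (a' : δ.BoxAction M') (m : M.carrier)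
    (m' : M'.carrier) (b : δ.coinv) (z : (δ.boxBimod.tensor δ.boxBimod).carrier) :
    a.onPair a' m m' ((δ.boxBimod.tensor δ.boxBimod).left b z) =
      (M.tensor M').left b (a.onPair a' m m' z) :=
  tmap_left (M := δ.boxBimod) (N := δ.boxBimod) _ _ _ _ (a.on_left m) b z

theorem BoxAction.onPair_right (a : δ.BoxAction M) (a' : δ.BoxAction M') (m : M.carrier)
    (m' : M'.carrier) (b : δ.coinv) (z : (δ.boxBimod.tensor δ.boxBimod).carrier) :
    a.onPair a' m m' ((δ.boxBimod.tensor δ.boxBimod).right (op b) z) =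
      (M.tensor M').right (op b) (a.onPair a' m m' z) :=
  tmap_right (M := δ.boxBimod) (N := δ.boxBimod) _ _ _ _ (fun b => a'.on_right m' (op b)) b z

/-- The isomorphism `f` intertwines the maps `A^{□e} ⊗_{B^e} M → M` and
`A^{□e} ⊗_{B^e} N → N`. -/
def BoxAction.Equivariant (a : δ.BoxAction M) (b : δ.BoxAction N) (f : M.Iso N) : Prop :=
  ∀ x m, f (a.on m x) = b.on (f m) x

theorem BoxAction.Equivariant.act_eq {a : δ.BoxAction M} {b : δ.BoxAction N} {f : M.Iso N}
    (h : a.Equivariant b f) (z : (δ.boxTensor M).carrier) :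
    f (a.act z) = b.act (δ.boxTensorMap f z) := by
  induction z using boxTensor_induction with
  | add x y hx hy => simp only [map_add, hx, hy]
  | mk x m => exact h x m

theorem BoxAction.Equivariant.refl (a : δ.BoxAction M) : a.Equivariant a (Iso.refl M) :=
  fun _ _ => rfl

theorem BoxAction.Equivariant.trans {a : δ.BoxAction M} {b : δ.BoxAction N} {c : δ.BoxAction P}
    {f : M.Iso N} {g : N.Iso P} (h : a.Equivariant b f) (h' : b.Equivariant c g) :
    a.Equivariant c (f.trans g) :=
  fun x m => (congrArg g (h x m)).trans (h' x (f m))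

theorem BoxAction.Equivariant.symm {a : δ.BoxAction M} {b : δ.BoxAction N} {f : M.Iso N}
    (h : a.Equivariant b f) : b.Equivariant a f.symm := fun x n => by
  apply f.toLinearEquiv.injective
  have h₁ := h x (f.symm n)
  rw [Iso.apply_symm_apply] at h₁
  exact (f.apply_symm_apply _).trans h₁.symm

section Tensor

variable [Coalgebra.IsCocomm k H] (hA : δ.IsFaithfullyFlatGalois)

/-- The map `x ⊗ (m ⊗_B m') ↦ x₁ m ⊗_B x₂ m'`. -/
noncomputable def BoxAction.tensor (a : δ.BoxAction M) (a' : δ.BoxAction M') :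
    δ.BoxAction (M.tensor M') where
  act := tmap a.act a'.act (fun b => a.map_right (op b)) a'.map_left ∘ₗ splitMap M M' hA
  map_left b z := by
    induction z using boxTensor_tensor_induction with
    | add x y hx hy => simp only [map_add, hx, hy]
    | mk x m m' =>
      rw [boxTensor_left, LinearMap.comp_apply, LinearMap.comp_apply, splitMap_boxMk,
        splitMap_boxMk, boxComul_left]
      induction boxComul hA x using tensor_induction with
      | add x y hx hy => simp only [map_add, hx, hy]
      | tmul x y => exact a.onPair_left a' m m' b (tmul δ.boxBimod δ.boxBimod x y)
  map_right b z := by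
    induction z using boxTensor_tensor_induction with
    | add x y hx hy => simp only [map_add, hx, hy]
    | mk x m m' =>
      rw [boxTensor_right, LinearMap.comp_apply, LinearMap.comp_apply, splitMap_boxMk,
        splitMap_boxMk, boxComul_right]
      induction boxComul hA x using tensor_induction with
      | add x y hx hy => simp only [map_add, hx, hy]
      | tmul x y => exact a.onPair_right a' m m' b.unop (tmul δ.boxBimod δ.boxBimod x y)

theorem BoxAction.tensor_on (a : δ.BoxAction M) (a' : δ.BoxAction M') (x : δ.box) (m : M.carrier)
    (m' : M'.carrier) :
    (a.tensor hA a').on (tmul M M' m m') x = a.onPair a' m m' (boxComul hA x) := by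
  change tmap a.act a'.act (fun b => a.map_right (op b)) a'.map_left
    (boxIns M M' m m' (boxComul hA x)) = _
  induction boxComul hA x using tensor_induction with
  | add x y hx hy => simp only [map_add, hx, hy]
  | tmul x y => rfl

theorem BoxAction.Equivariant.tensor {a : δ.BoxAction M} {b : δ.BoxAction N} {f : M.Iso N}
    {a' : δ.BoxAction M'} {b' : δ.BoxAction N'} {f' : M'.Iso N'} (h : a.Equivariant b f)
    (h' : a'.Equivariant b' f') :
    (a.tensor hA a').Equivariant (b.tensor hA b') (f.tensor f') := by
  intro x m
  induction m using tensor_induction with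
  | add m n hm hn => simp only [on_add, map_add, hm, hn]
  | tmul m m' =>
    rw [tensor_on, Iso.tensor_tmul, tensor_on]
    induction boxComul hA x using tensor_induction with
    | add x y hx hy => simp only [map_add, hx, hy]
    | tmul x y => rw [onPair_tmul, onPair_tmul, Iso.tensor_tmul, h, h']

/-- Coassociativity of the comultiplication of `A^{□e}` makes the tensor product of actions
associative. -/
theorem BoxAction.equivariant_assoc (a : δ.BoxAction M) (b : δ.BoxAction N) (c : δ.BoxAction P) :
    ((a.tensor hA b).tensor hA c).Equivariant (a.tensor hA (b.tensor hA c)) (assoc M N P) := by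
  intro x m
  induction m using tensor_induction with
  | add m n hm hn => simp only [on_add, map_add, hm, hn]
  | tmul m p =>
  induction m using tensor_induction with
  | add m n hm hn => simp only [on_add, map_add, LinearMap.add_apply, hm, hn]
  | tmul m n =>
    rw [tensor_on, assoc_tmul, tensor_on]
    let Q : ((δ.boxBimod.tensor δ.boxBimod).tensor δ.boxBimod).carrier →ₗ[k]
        ((M.tensor N).tensor P).carrier :=
      tmap (M := δ.boxBimod.tensor δ.boxBimod) (N := δ.boxBimod) (a.onPair b m n) (c.on p)
        (a.onPair_right b m n) (c.on_left p)
    let Q' : (δ.boxBimod.tensor (δ.boxBimod.tensor δ.boxBimod)).carrier →ₗ[k]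
        (M.tensor (N.tensor P)).carrier :=
      tmap (M := δ.boxBimod) (N := δ.boxBimod.tensor δ.boxBimod) (a.on m) (b.onPair c n p)
        (fun b => a.on_right m (op b)) (b.onPair_left c n p)
    have h₁ : ∀ z, (a.tensor hA b).onPair c (tmul M N m n) p z = Q (comulFst hA z) := by
      intro z
      induction z using tensor_induction with
      | add x y hx hy => simp only [map_add, hx, hy]
      | tmul x y =>
        rw [onPair_tmul, tensor_on]
        rfl
    have h₂ : ∀ z, a.onPair (b.tensor hA c) m (tmul N P n p) z = Q' (comulSnd hA z) := by
      intro z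
      induction z using tensor_induction with
      | add x y hx hy => simp only [map_add, hx, hy]
      | tmul x y =>
        rw [onPair_tmul, tensor_on]
        rfl
    have h₃ : ∀ z, assoc M N P (Q ((assoc δ.boxBimod δ.boxBimod δ.boxBimod).symm z)) = Q' z := by
      intro z
      induction z using tensor_induction with
      | add x y hx hy => simp only [map_add, hx, hy]
      | tmul x y =>
      induction y using tensor_induction with
      | add y z hy hz => simp only [map_add, hy, hz]
      | tmul y z => rfl
    rw [h₁, h₂, comulFst_boxComul, h₃]

variable (δ) in
/-- The map `∑ (a ⊗ a') ⊗ b ↦ ∑ a b a'`. -/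
noncomputable def unitAct :
    (δ.boxTensor (unit k δ.coinv)).carrier →ₗ[k] (unit k δ.coinv).carrier :=
  BTensor.lift δ.boxActUnit δ.boxActUnit_boxInner

variable (δ) in
/-- The action `(∑ a ⊗ a') b = ∑ a b a'` on the unit bimodule. -/
noncomputable def unitAction : δ.BoxAction (unit k δ.coinv) where
  act := δ.unitAct
  map_left b z := by
    induction z using boxTensor_induction with
    | add x y hx hy => simp only [map_add, hx, hy]
    | mk x c => exact boxAct_left x c b
  map_right b z := by
    induction z using boxTensor_induction with
    | add x y hx hy => simp only [map_add, hx, hy]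
    | mk x c => exact boxAct_right x c b.unop

/-- The counit property of the comultiplication of `A^{□e}` makes `B` a unit for the tensor product
of actions. -/
theorem BoxAction.equivariant_leftUnitor (a : δ.BoxAction M) :
    (δ.unitAction.tensor hA a).Equivariant a (leftUnitor M) := by
  intro x m
  induction m using tensor_induction with
  | add m n hm hn => simp only [on_add, map_add, hm, hn]
  | tmul b m =>
    have h : ∀ z, leftUnitor M (δ.unitAction.onPair a b m z) = a.on m (δ.actFst b z) := by
      intro z
      induction z using tensor_induction with
      | add x y hx hy => simp only [map_add, hx, hy]
      | tmul x y =>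
        exact (a.on_left m (δ.boxAct x b) y).symm
    exact (congrArg (leftUnitor M) (tensor_on hA _ a x b m)).trans ((h _).trans
      ((congrArg (a.on m) (actFst_boxComul hA b x)).trans
        (congrArg a.act (boxMk_innerFst M b x m))))

theorem BoxAction.Equivariant.contract {a : δ.BoxAction M} {b : δ.BoxAction N}
    {a' : δ.BoxAction M'} {b' : δ.BoxAction N'} {α : (M.tensor N).Iso (unit k δ.coinv)}
    {α' : (M'.tensor N').Iso (unit k δ.coinv)} (h : (a.tensor hA b).Equivariant δ.unitAction α)
    (h' : (a'.tensor hA b').Equivariant δ.unitAction α') :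
    ((a.tensor hA a').tensor hA (b'.tensor hA b)).Equivariant δ.unitAction
      (StrictMoritaContext.contract α α') :=
  (equivariant_assoc hA a a' (b'.tensor hA b)).trans
    ((Equivariant.tensor hA (Equivariant.refl a) ((equivariant_assoc hA a' b' b).symm.trans
      ((Equivariant.tensor hA h' (Equivariant.refl b)).trans
        (equivariant_leftUnitor hA b)))).trans h)

end Tensor

end ComoduleAlgebra

/-! ### Actions of `A^{□e}` and colinear maps to `M ⊗ H` -/

namespace ComoduleAlgebra
open Bimodule

/-- The map `v ⊗ h ↦ ε(h) v`. -/
noncomputable def counitR {k H : Type*} (V : Type*) [Field k] [Ring H] [HopfAlgebra k H]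
    [AddCommGroup V] [Module k V] : V ⊗[k] H →ₗ[k] V :=
  (TensorProduct.rid k V).toLinearMap ∘ₗ (Coalgebra.counit (R := k) (A := H)).lTensor V

section CounitR

variable {k H V W : Type*} [Field k] [Ring H] [HopfAlgebra k H] [AddCommGroup V] [Module k V]
  [AddCommGroup W] [Module k W]

theorem counitR_tmul (x : V) (h : H) :
    counitR V (x ⊗ₜ[k] h) = Coalgebra.counit (R := k) h • x := by simp [counitR]

theorem counitR_rTensor (f : V →ₗ[k] W) (s : V ⊗[k] H) :
    counitR W (f.rTensor H s) = f (counitR V s) := by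
  induction s using TensorProduct.induction_on with
  | zero => simp
  | add x y hx hy => simp only [map_add, hx, hy]
  | tmul x h => simp [counitR_tmul]

/-- The map `v ⊗ (h ⊗ h') ↦ ε(h) v ⊗ h'`. -/
noncomputable def counitMid (k H V : Type*) [Field k] [Ring H] [HopfAlgebra k H]
    [AddCommGroup V] [Module k V] : V ⊗[k] (H ⊗[k] H) →ₗ[k] V ⊗[k] H :=
  ((TensorProduct.lid k H).toLinearMap ∘ₗ (Coalgebra.counit (R := k) (A := H)).rTensor H).lTensor V

theorem counitMid_comul (s : V ⊗[k] H) :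
    counitMid k H V ((comul (R := k) (A := H)).lTensor V s) = s := by
  rw [counitMid, ← LinearMap.lTensor_comp_apply, LinearMap.comp_assoc,
    Coalgebra.rTensor_counit_comp_comul]
  induction s using TensorProduct.induction_on with
  | zero => simp
  | add x y hx hy => rw [map_add, hx, hy]
  | tmul x h => simp

theorem counitMid_assoc (s : (V ⊗[k] H) ⊗[k] H) :
    counitMid k H V (TensorProduct.assoc k V H H s) = (counitR V).rTensor H s := by
  have h : counitMid k H V ∘ₗ (TensorProduct.assoc k V H H).toLinearMap =
      (counitR (k := k) (H := H) V).rTensor H := by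
    apply TensorProduct.ext_threefold
    intro x h h'
    simp [counitMid, counitR, TensorProduct.smul_tmul]
  exact LinearMap.congr_fun h s

end CounitR

section Kappa

variable {k : Type u} {B : Type v} {H : Type w} [Field k] [Ring B] [Algebra k B] [Ring H]
  [HopfAlgebra k H] {M N : Bimodule k B}

/-- The map `(m ⊗_B n) ⊗ (h ⊗ h') ↦ (m ⊗ h) ⊗_B (n ⊗ h')`. -/
noncomputable def kappaTwo (M N : Bimodule k B) (H : Type w) [Ring H]
    [HopfAlgebra k H] :
    (M.tensor N).carrier ⊗[k] (H ⊗[k] H) →ₗ[k] BTensor (M.rightH H) (N.leftH H) :=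
  TensorProduct.lift (tensorLift
    (LinearMap.mk₂ k (fun m n => TensorProduct.lift ((BTensor.mk (M.rightH H) (N.leftH H)).compl₁₂
        (TensorProduct.mk k M.carrier H m) (TensorProduct.mk k N.carrier H n)))
      (fun _ _ _ => by ext; simp)
      (fun _ _ _ => by ext; simp)
      (fun _ _ _ => by ext; simp)
      (fun _ _ _ => by ext; simp))
    (fun m b n => TensorProduct.ext' fun h h' =>
      BTensor.mk_balanced (r := M.rightH H) (l := N.leftH H) (m ⊗ₜ h) b (n ⊗ₜ h')))

theorem kappaTwo_tmul (m : M.carrier) (n : N.carrier) (h h' : H) :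
    kappaTwo M N H (tmul M N m n ⊗ₜ (h ⊗ₜ h')) =
      BTensor.mk (M.rightH H) (N.leftH H) (m ⊗ₜ h) (n ⊗ₜ h') := rfl

theorem kappa_eq (s : (M.tensor N).carrier ⊗[k] H) :
    kappa M N H s = kappaTwo M N H ((comul (R := k) (A := H)).lTensor _ s) := by
  induction s using TensorProduct.induction_on with
  | zero => simp
  | add x y hx hy => simp only [map_add, hx, hy]
  | tmul z h =>
    induction z using tensor_induction with
    | add x y hx hy => simp only [map_add, TensorProduct.add_tmul, hx, hy]
    | tmul m n =>
      change preKappa M N H ((m ⊗ₜ n) ⊗ₜ h) = _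
      simp only [preKappa, LinearMap.comp_apply, LinearMap.lTensor_tmul]
      induction comul (R := k) h using TensorProduct.induction_on with
      | zero => simp
      | add x y hx hy => simp only [map_add, TensorProduct.tmul_add, hx, hy]
      | tmul => rfl

theorem counitR_leftH (b : B) (s : M.carrier ⊗[k] H) :
    counitR M.carrier (M.leftH H b s) = M.left b (counitR M.carrier s) :=
  counitR_rTensor (M.left b) s

theorem counitR_rightH (b : Bᵐᵒᵖ) (s : M.carrier ⊗[k] H) :
    counitR M.carrier (M.rightH H b s) = M.right b (counitR M.carrier s) :=
  counitR_rTensor (M.right b) s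

/-- The map `(m ⊗ h) ⊗_B (n ⊗ h') ↦ ε(h) ε(h') m ⊗_B n`. -/
noncomputable def counitTensor (M N : Bimodule k B) (H : Type w) [Ring H]
    [HopfAlgebra k H] : BTensor (M.rightH H) (N.leftH H) →ₗ[k] (M.tensor N).carrier :=
  BTensor.map (counitR M.carrier) (counitR N.carrier) (fun b => counitR_rightH (op b))
    (counitR_leftH (M := N))

theorem counitTensor_mk (s : M.carrier ⊗[k] H) (t : N.carrier ⊗[k] H) :
    counitTensor M N H (BTensor.mk (M.rightH H) (N.leftH H) s t) =
      tmul M N (counitR M.carrier s) (counitR N.carrier t) := rfl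

theorem counitTensor_kappa (s : (M.tensor N).carrier ⊗[k] H) :
    counitTensor M N H (kappa M N H s) = counitR _ s := by
  have h : counitTensor M N H ∘ₗ kappaTwo M N H = counitR _ ∘ₗ counitMid k H _ := by
    apply TensorProduct.ext
    ext z h h'
    change counitTensor M N H (kappaTwo M N H (z ⊗ₜ (h ⊗ₜ h'))) =
      counitR _ (counitMid k H _ (z ⊗ₜ (h ⊗ₜ h')))
    induction z using tensor_induction with
    | add x y hx hy => simp only [map_add, TensorProduct.add_tmul, hx, hy]
    | tmul m n =>
      rw [kappaTwo_tmul, counitTensor_mk]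
      simp [counitMid, counitR_tmul, smul_smul, mul_comm]
  have h₁ := LinearMap.congr_fun h ((comul (R := k) (A := H)).lTensor _ s)
  rw [LinearMap.comp_apply, LinearMap.comp_apply, counitMid_comul] at h₁
  rw [kappa_eq, h₁]

end Kappa

variable {k : Type u} {H : Type w} {A : Type v} [Field k] [Ring H] [HopfAlgebra k H]
  [Ring A] [Algebra k A] {δ : ComoduleAlgebra k H A} {M M' N N' : Bimodule k δ.coinv}

variable [Coalgebra.IsCocomm k H]

theorem boxTensorCoact_counit (z : (δ.boxTensor M).carrier) :
    counitR _ (δ.boxTensorCoact M z) = z := by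
  induction z using boxTensor_induction with
  | add x y hx hy => simp only [map_add, hx, hy]
  | mk x m =>
    rw [boxTensorCoact_boxMk, counitR_rTensor]
    exact congrArg (fun x => δ.boxMk M x m) (boxCoact_counit x)

theorem boxTensorCoact_coassoc (z : (δ.boxTensor M).carrier) :
    TensorProduct.assoc k _ H H ((δ.boxTensorCoact M).rTensor H (δ.boxTensorCoact M z)) =
      (comul (R := k) (A := H)).lTensor _ (δ.boxTensorCoact M z) := by
  induction z using boxTensor_induction with
  | add x y hx hy => simp only [map_add, hx, hy]
  | mk x m =>
    have h₁ : ∀ s : δ.box ⊗[k] H, TensorProduct.assoc k _ H H ((δ.boxTensorCoact M).rTensor H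
        (((δ.boxMk M).flip m).rTensor H s)) = ((δ.boxMk M).flip m).rTensor (H ⊗[k] H)
          (TensorProduct.assoc k _ H H (δ.boxCoact.rTensor H s)) := by
      intro s
      induction s using TensorProduct.induction_on with
      | zero => simp
      | add x y hx hy => simp only [map_add, hx, hy]
      | tmul x h =>
        rw [LinearMap.rTensor_tmul, LinearMap.rTensor_tmul, LinearMap.rTensor_tmul,
          LinearMap.flip_apply, boxTensorCoact_boxMk]
        induction δ.boxCoact x using TensorProduct.induction_on with
        | zero => simp
        | add x y hx hy => simp only [map_add, TensorProduct.add_tmul, hx, hy]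
        | tmul => rfl
    rw [boxTensorCoact_boxMk, h₁, boxCoact_coassoc]
    exact LinearMap.congr_fun ((LinearMap.rTensor_comp_lTensor _ _ _).trans
      (LinearMap.lTensor_comp_rTensor _ _ _).symm) (δ.boxCoact x)

theorem boxTensorCoact_left (b : δ.coinv) (z : (δ.boxTensor M).carrier) :
    δ.boxTensorCoact M ((δ.boxTensor M).left b z) =
      ((δ.boxTensor M).left b).rTensor H (δ.boxTensorCoact M z) := by
  induction z using boxTensor_induction with
  | add x y hx hy => simp only [map_add, hx, hy]
  | mk x m =>
    rw [boxTensor_left, boxTensorCoact_boxMk, boxTensorCoact_boxMk, boxCoact_left,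
      ← LinearMap.rTensor_comp_apply, ← LinearMap.rTensor_comp_apply]
    rfl

theorem boxTensorCoact_right (b : δ.coinv) (z : (δ.boxTensor M).carrier) :
    δ.boxTensorCoact M ((δ.boxTensor M).right (op b) z) =
      ((δ.boxTensor M).right (op b)).rTensor H (δ.boxTensorCoact M z) := by
  induction z using boxTensor_induction with
  | add x y hx hy => simp only [map_add, hx, hy]
  | mk x m =>
    rw [boxTensor_right, boxTensorCoact_boxMk, boxTensorCoact_boxMk, boxCoact_right,
      ← LinearMap.rTensor_comp_apply, ← LinearMap.rTensor_comp_apply]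
    rfl

theorem boxTensorCoact_map (f : M.Iso N) (z : (δ.boxTensor M).carrier) :
    δ.boxTensorCoact N (δ.boxTensorMap f z) =
      (δ.boxTensorMap f).rTensor H (δ.boxTensorCoact M z) := by
  induction z using boxTensor_induction with
  | add x y hx hy => simp only [map_add, hx, hy]
  | mk x m =>
    rw [boxTensorMap_boxMk, boxTensorCoact_boxMk, boxTensorCoact_boxMk,
      ← LinearMap.rTensor_comp_apply]
    rfl

/-- The colinear map `x ⊗ m ↦ x₀ m ⊗ x₁` that corresponds to a bilinear map `x ⊗ m ↦ x m`. -/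
noncomputable def BoxAction.coext (a : δ.BoxAction M) :
    (δ.boxTensor M).carrier →ₗ[k] M.carrier ⊗[k] H :=
  a.act.rTensor H ∘ₗ δ.boxTensorCoact M

theorem BoxAction.coext_apply (a : δ.BoxAction M) (z : (δ.boxTensor M).carrier) :
    a.coext z = a.act.rTensor H (δ.boxTensorCoact M z) := rfl

theorem BoxAction.coext_boxMk (a : δ.BoxAction M) (x : δ.box) (m : M.carrier) :
    a.coext (δ.boxMk M x m) = (a.on m).rTensor H (δ.boxCoact x) := by
  rw [coext_apply, boxTensorCoact_boxMk, ← LinearMap.rTensor_comp_apply]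
  rfl

theorem BoxAction.coext_left (a : δ.BoxAction M) (b : δ.coinv) (z : (δ.boxTensor M).carrier) :
    a.coext ((δ.boxTensor M).left b z) = M.leftH H b (a.coext z) := by
  rw [coext_apply, boxTensorCoact_left, ← LinearMap.rTensor_comp_apply,
    LinearMap.ext (f := a.act ∘ₗ _) (g := M.left b ∘ₗ a.act) (a.map_left b),
    LinearMap.rTensor_comp_apply]
  rfl

theorem BoxAction.coext_right (a : δ.BoxAction M) (b : δ.coinv) (z : (δ.boxTensor M).carrier) :
    a.coext ((δ.boxTensor M).right (op b) z) = M.rightH H (op b) (a.coext z) := by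
  rw [coext_apply, boxTensorCoact_right, ← LinearMap.rTensor_comp_apply,
    LinearMap.ext (f := a.act ∘ₗ _) (g := M.right (op b) ∘ₗ a.act) (a.map_right (op b)),
    LinearMap.rTensor_comp_apply]
  rfl

theorem BoxAction.counitR_coext (a : δ.BoxAction M) (z : (δ.boxTensor M).carrier) :
    counitR _ (a.coext z) = a.act z := by
  rw [coext_apply, counitR_rTensor, boxTensorCoact_counit]

theorem BoxAction.coext_colinear (a : δ.BoxAction M) (z : (δ.boxTensor M).carrier) :
    TensorProduct.assoc k M.carrier H H (a.coext.rTensor H (δ.boxTensorCoact M z)) =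
      (comul (R := k) (A := H)).lTensor M.carrier (a.coext z) := by
  have h₁ : ∀ s : ((δ.boxTensor M).carrier ⊗[k] H) ⊗[k] H, TensorProduct.assoc k M.carrier H H
      ((a.act.rTensor H).rTensor H s) =
      a.act.rTensor (H ⊗[k] H) (TensorProduct.assoc k _ H H s) := fun s =>
    LinearMap.congr_fun (f := (TensorProduct.assoc k M.carrier H H).toLinearMap ∘ₗ
      (a.act.rTensor H).rTensor H) (g := a.act.rTensor (H ⊗[k] H) ∘ₗ
        (TensorProduct.assoc k _ H H).toLinearMap)
      (TensorProduct.ext_threefold fun _ _ _ => rfl) s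
  rw [coext, LinearMap.rTensor_comp_apply, h₁, boxTensorCoact_coassoc]
  exact LinearMap.congr_fun ((LinearMap.rTensor_comp_lTensor _ _ _).trans
    (LinearMap.lTensor_comp_rTensor _ _ _).symm) (δ.boxTensorCoact M z)

/-- A bilinear map `A^{□e} ⊗_{B^e} M → M` with bijective coextension gives an isomorphism
`A^{□e} ⊗_{B^e} M → M ⊗ H` in `_B M_B^H`. -/
noncomputable def BoxAction.toStableIso (a : δ.BoxAction M) (h : Function.Bijective a.coext) :
    δ.StableIso M where
  toLinearEquiv := LinearEquiv.ofBijective a.coext h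
  map_left := a.coext_left
  map_right b := a.coext_right b.unop
  colinear := a.coext_colinear

/-- The map `(id ⊗ ε) ∘ φ` for an isomorphism `φ : A^{□e} ⊗_{B^e} M → M ⊗ H`. -/
noncomputable def StableIso.action (φ : δ.StableIso M) : δ.BoxAction M where
  act := counitR M.carrier ∘ₗ φ.toLinearEquiv.toLinearMap
  map_left b z := (congrArg (counitR M.carrier) (φ.map_left b z)).trans (counitR_leftH b _)
  map_right b z := (congrArg (counitR M.carrier) (φ.map_right b z)).trans (counitR_rightH b _)

/-- A colinear map to `M ⊗ H` is determined by its composite with `id ⊗ ε`. -/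
theorem StableIso.coext_action (φ : δ.StableIso M) :
    φ.action.coext = φ.toLinearEquiv.toLinearMap := by
  ext z
  have h := congrArg (counitMid k H M.carrier) (φ.colinear z)
  rw [counitMid_assoc, counitMid_comul, ← LinearMap.rTensor_comp_apply] at h
  exact h

theorem BoxAction.action_toStableIso (a : δ.BoxAction M) (h : Function.Bijective a.coext) :
    (a.toStableIso h).action = a := by
  obtain ⟨act, h₁, h₂⟩ := a
  have : counitR M.carrier ∘ₗ BoxAction.coext ⟨act, h₁, h₂⟩ = act :=
    LinearMap.ext (BoxAction.counitR_coext ⟨act, h₁, h₂⟩)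
  simp only [StableIso.action, BoxAction.mk.injEq]
  exact this

/-- The map `f ⊗_B f'` for the colinear maps `f`, `f'` that correspond to bilinear maps. -/
noncomputable def BoxAction.coextTensor (a : δ.BoxAction M) (a' : δ.BoxAction M') :
    ((δ.boxTensor M).tensor (δ.boxTensor M')).carrier →ₗ[k] BTensor (M.rightH H) (M'.leftH H) :=
  BTensor.map a.coext a'.coext a.coext_right a'.coext_left

theorem BoxAction.coextTensor_tmul (a : δ.BoxAction M) (a' : δ.BoxAction M')
    (z : (δ.boxTensor M).carrier) (z' : (δ.boxTensor M').carrier) :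
    a.coextTensor a' (tmul _ _ z z') =
      BTensor.mk (M.rightH H) (M'.leftH H) (a.coext z) (a'.coext z') := rfl

theorem StableIso.tensorMap_eq (φ : δ.StableIso M) (φ' : δ.StableIso M') :
    φ.tensorMap φ' = φ.action.coextTensor φ'.action := by
  apply tensor_hom_ext
  intro z z'
  rw [BoxAction.coextTensor_tmul, coext_action, coext_action]
  rfl

variable (hA : δ.IsFaithfullyFlatGalois)

/-- The colinear map that corresponds to the tensor product of two bilinear maps satisfies the
equation that determines `φ_{M ⊗_B M'}`. -/
theorem BoxAction.kappa_coext_tensor (a : δ.BoxAction M) (a' : δ.BoxAction M')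
    (z : (δ.boxTensor (M.tensor M')).carrier) :
    kappa M M' H ((a.tensor hA a').coext z) = a.coextTensor a' (splitMap M M' hA z) := by
  induction z using boxTensor_tensor_induction with
  | add x y hx hy => simp only [map_add, hx, hy]
  | mk x m m' =>
    let P := a.onPair a' m m'
    have h₁ : ∀ s : δ.box ⊗[k] H, (comul (R := k) (A := H)).lTensor _
        (((a.tensor hA a').on (tmul M M' m m')).rTensor H s) =
        P.rTensor (H ⊗[k] H) (TensorProduct.map (boxComul hA) (comul (R := k) (A := H)) s) := by
      intro s
      induction s using TensorProduct.induction_on with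
      | zero => simp
      | add x y hx hy => simp only [map_add, hx, hy]
      | tmul x h =>
        rw [LinearMap.rTensor_tmul, LinearMap.lTensor_tmul, tensor_on, TensorProduct.map_tmul,
          LinearMap.rTensor_tmul]
    have h₂ : ∀ w, kappaTwo M M' H (P.rTensor (H ⊗[k] H) (TensorProduct.assoc k _ H H
        (δ.boxBoxCoactFst.rTensor H (δ.boxBoxCoactSnd w)))) =
        a.coextTensor a' (boxIns M M' m m' w) := by
      intro w
      induction w using tensor_induction with
      | add x y hx hy => simp only [map_add, hx, hy]
      | tmul u v =>
        rw [boxIns_tmul, coextTensor_tmul, boxBoxCoactSnd_tmul, coext_boxMk, coext_boxMk]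
        induction δ.boxCoact v using TensorProduct.induction_on with
        | zero => simp
        | add x y hx hy => simp only [map_add, hx, hy]
        | tmul v' h' =>
          rw [LinearMap.rTensor_tmul, LinearMap.rTensor_tmul, LinearMap.rTensor_tmul,
            boxBoxCoactFst_tmul]
          induction δ.boxCoact u using TensorProduct.induction_on with
          | zero => simp
          | add x y hx hy =>
            simp only [map_add, TensorProduct.add_tmul, LinearMap.add_apply, hx, hy]
          | tmul u' h => rfl
    rw [splitMap_boxMk, coext_boxMk, kappa_eq, h₁, ← boxBoxCoact_boxComul, h₂]

/-- Compatibility of `φ`, `φ'` with `α` in terms of the bilinear maps that correspond to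
`φ` and `φ'`. -/
theorem isCompatible_iff (φ : δ.StableIso M) (φ' : δ.StableIso M')
    (α : (M.tensor M').Iso (unit k δ.coinv)) : IsCompatible hA φ φ' α ↔
      (φ.action.tensor hA φ'.action).Equivariant δ.unitAction α := by
  constructor
  · rintro ⟨ψ, ⟨g, hg, hψ⟩, hα⟩ x m
    rw [hg.eq_splitMap, StableIso.tensorMap_eq] at hψ
    have h₁ : ∀ z, counitR _ (ψ z) = (φ.action.tensor hA φ'.action).act z := by
      intro z
      rw [← counitTensor_kappa, ← BoxAction.counitR_coext, ← counitTensor_kappa (M := M),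
        BoxAction.kappa_coext_tensor]
      exact congrArg (counitTensor M M' H) (LinearMap.congr_fun hψ z)
    have h₂ := congrArg (counitR _) (LinearMap.congr_fun hα (δ.boxMk _ x m))
    rw [LinearMap.comp_apply, counitR_rTensor, h₁] at h₂
    exact h₂.trans (BoxAction.counitR_coext δ.unitAction _)
  · intro h
    refine ⟨(φ.action.tensor hA φ'.action).coext, ⟨splitMap M M' hA, isSplitMap_splitMap hA, ?_⟩,
      ?_⟩
    · ext z
      rw [StableIso.tensorMap_eq]
      exact BoxAction.kappa_coext_tensor hA _ _ z
    · have h₁ : α.val ∘ₗ (φ.action.tensor hA φ'.action).act = δ.unitAct ∘ₗ δ.boxTensorMap α :=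
        LinearMap.ext h.act_eq
      ext z
      have h₂ : δ.unitAct.rTensor H (δ.boxTensorCoact _ (δ.boxTensorMap α z)) =
          (δ.unitAct ∘ₗ δ.boxTensorMap α).rTensor H (δ.boxTensorCoact _ z) := by
        rw [boxTensorCoact_map, ← LinearMap.rTensor_comp_apply]
      exact (LinearMap.rTensor_comp_apply H α.val _ _).symm.trans
        ((congrArg (fun f => f.rTensor H (δ.boxTensorCoact _ z)) h₁).trans h₂.symm)

end ComoduleAlgebra

/-! ### Bijectivity of `φ_B` -/

/-- The antipode of a cocommutative Hopf algebra is an involution. -/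
theorem antipode_antipode {k H : Type*} [Field k] [Ring H] [HopfAlgebra k H]
    [Coalgebra.IsCocomm k H] (h : H) :
    HopfAlgebra.antipode k (HopfAlgebra.antipode k h) = h := by
  let S := HopfAlgebra.antipode k (A := H)
  have h₁ : LinearMap.mul' k H ∘ₗ TensorProduct.map (S ∘ₗ S) S ∘ₗ comul =
      Algebra.linearMap k H ∘ₗ Coalgebra.counit := by
    have e₁ : LinearMap.mul' k H ∘ₗ TensorProduct.map (S ∘ₗ S) S =
        (S ∘ₗ LinearMap.mul' k H ∘ₗ S.lTensor H) ∘ₗ (TensorProduct.comm k H H).toLinearMap := by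
      ext x y
      exact (HopfAlgebra.antipode_mul_antidistrib y (S x)).symm
    rw [← LinearMap.comp_assoc, e₁, LinearMap.comp_assoc, Coalgebra.comm_comp_comul,
      LinearMap.comp_assoc, LinearMap.comp_assoc, HopfAlgebra.mul_antipode_lTensor_comul]
    ext x
    simp [S, Algebra.algebraMap_eq_smul_one, HopfAlgebra.antipode_one]
  have h₂ : WithConv.toConv (S ∘ₗ S) * WithConv.toConv S = 1 := by
    apply WithConv.ofConv_injective
    exact h₁
  have h₃ := left_inv_eq_right_inv h₂ (LinearMap.antipode_mul_id (R := k) (C := H))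
  exact LinearMap.congr_fun (WithConv.toConv_injective h₃) h

namespace ComoduleAlgebra
open Bimodule

variable {k : Type u} {H : Type w} {A : Type v} [Field k] [Ring H] [HopfAlgebra k H]
  [Ring A] [Algebra k A] (δ : ComoduleAlgebra k H A)

/-- The map `a ⊗_B c ↦ a₀ c ⊗ a₁`. -/
noncomputable def canonLeft : (δ.self.tensor δ.self).carrier →ₗ[k] A ⊗[k] H :=
  tensorLift (M := δ.self) (N := δ.self)
    ((LinearMap.mul k (A ⊗[k] H)).compl₁₂ δ.coact.toLinearMap
      (Algebra.TensorProduct.includeLeft : A →ₐ[k] A ⊗[k] H).toLinearMap)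
    (fun a b c => by
      change δ.coact (a * (b : A)) * (c ⊗ₜ 1) = δ.coact a * (((b : A) * c) ⊗ₜ 1)
      rw [map_mul, coact_coinv, mul_assoc, Algebra.TensorProduct.tmul_mul_tmul, one_mul])

theorem canonLeft_selfMk (a c : A) :
    δ.canonLeft (δ.selfMk a c) = δ.coact a * (c ⊗ₜ[k] (1 : H)) := rfl

/-- The projection `A ⊗ A → A ⊗_B A`. -/
noncomputable def proj : A ⊗[k] A →ₗ[k] (δ.self.tensor δ.self).carrier :=
  TensorProduct.lift δ.selfMk

@[simp] theorem proj_tmul (a c : A) : δ.proj (a ⊗ₜ c) = δ.selfMk a c := rfl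

theorem proj_right (b : δ.coinvᵐᵒᵖ) (y : A ⊗[k] A) :
    δ.proj (δ.outer.right b y) = (δ.self.tensor δ.self).right b (δ.proj y) := by
  induction y using TensorProduct.induction_on with
  | zero => simp
  | add x y hx hy => simp only [map_add, hx, hy]
  | tmul a c => rfl

theorem proj_surjective : Function.Surjective δ.proj := fun v => by
  induction v using self_induction with
  | add x y hx hy =>
    obtain ⟨x, rfl⟩ := hx
    obtain ⟨y, rfl⟩ := hy
    exact ⟨x + y, map_add _ _ _⟩
  | tmul a c => exact ⟨a ⊗ₜ c, rfl⟩

/-- The right multiplication `(a ⊗_B c) ⊗_B d ↦ a ⊗_B c d`. -/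
noncomputable def selfAct : ((δ.self.tensor δ.self).tensor δ.self).carrier →ₗ[k]
    (δ.self.tensor δ.self).carrier :=
  tmap (N := δ.self.tensor δ.self) (N' := δ.self) LinearMap.id δ.mulSelf (fun _ _ => rfl)
    mulSelf_left ∘ₗ (assoc δ.self δ.self δ.self).toLinearEquiv.toLinearMap

theorem selfAct_proj (y : A ⊗[k] A) (c : A) :
    δ.selfAct (tmul _ δ.self (δ.proj y) c) = δ.proj ((LinearMap.mulRight k c).lTensor A y) := by
  induction y using TensorProduct.induction_on with
  | zero => simp
  | add x y hx hy => simp only [map_add, LinearMap.add_apply, hx, hy]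
  | tmul a c => rfl

/-- The map `(a ⊗ c) ⊗_B d ↦ (a ⊗_B c) ⊗_B d`. -/
noncomputable def projSelf : (δ.outer.tensor δ.self).carrier →ₗ[k]
    ((δ.self.tensor δ.self).tensor δ.self).carrier :=
  tmap (M := δ.outer) (M' := δ.self.tensor δ.self) (N := δ.self) δ.proj LinearMap.id
    (fun b => δ.proj_right (op b)) (fun _ _ => rfl)

theorem projSelf_tmul (y : A ⊗[k] A) (c : A) :
    δ.projSelf (tmul δ.outer δ.self y c) = tmul _ δ.self (δ.proj y) c := rfl

/-- The map `(a ⊗_B c) ⊗_B d ↦ (a ⊗_B c d₀) ⊗ d₁`. -/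
noncomputable def canonSelf : ((δ.self.tensor δ.self).tensor δ.self).carrier →ₗ[k]
    (δ.self.tensor δ.self).carrier ⊗[k] H :=
  tensorLift (N := δ.self)
    (LinearMap.mk₂ k (fun v d => (δ.selfAct ∘ₗ tmul _ δ.self v).rTensor H (δ.coact d))
      (fun _ _ _ => by simp [LinearMap.comp_add, LinearMap.rTensor_add])
      (fun _ _ _ => by simp [LinearMap.comp_smul, LinearMap.rTensor_smul])
      (fun _ _ _ => by simp) (fun _ _ _ => by simp))
    (fun v b d => by
      change (δ.selfAct ∘ₗ tmul _ δ.self _).rTensor H (δ.coact d) =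
        (δ.selfAct ∘ₗ tmul _ δ.self v).rTensor H (δ.coact ((b : A) * d))
      rw [map_mul, coact_coinv]
      induction δ.coact d using TensorProduct.induction_on with
      | zero => simp
      | add x y hx hy => simp only [map_add, mul_add, hx, hy]
      | tmul c h =>
        rw [Algebra.TensorProduct.tmul_mul_tmul, one_mul]
        exact congrArg (fun t => δ.selfAct t ⊗ₜ[k] h) (tmul_balanced (N := δ.self) v b c))

theorem canonSelf_selfMk (a c d : A) :
    δ.canonSelf (tmul _ δ.self (δ.selfMk a c) d) =
      (δ.selfMk a).rTensor H ((c ⊗ₜ[k] (1 : H)) * δ.coact d) := by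
  change (δ.selfAct ∘ₗ tmul _ δ.self _).rTensor H (δ.coact d) = _
  induction δ.coact d using TensorProduct.induction_on with
  | zero => simp
  | add x y hx hy => simp only [map_add, mul_add, hx, hy]
  | tmul c h =>
    rw [Algebra.TensorProduct.tmul_mul_tmul, one_mul]
    rfl

theorem canonSelf_unitR (v : (δ.self.tensor δ.self).carrier) :
    δ.canonSelf (δ.unitR _ v) = v ⊗ₜ 1 := by
  induction v using self_induction with
  | add x y hx hy => simp only [map_add, TensorProduct.add_tmul, hx, hy]
  | tmul a c =>
    rw [unitR_apply, canonSelf_selfMk, map_one, mul_one]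
    rfl

theorem canonSelf_projSelf (z : (δ.outer.tensor δ.self).carrier) :
    δ.canonSelf (δ.projSelf z) = δ.proj.rTensor H
      ((TensorProduct.assoc k A A H).symm (δ.canon.lTensor A (δ.reassoc z))) := by
  induction z using tensor_induction with
  | add x y hx hy => simp only [map_add, hx, hy]
  | tmul y d =>
    induction y using TensorProduct.induction_on with
    | zero => simp
    | add x y hx hy => simp only [map_add, LinearMap.add_apply, hx, hy]
    | tmul a c =>
      rw [projSelf_tmul, proj_tmul, canonSelf_selfMk, reassoc_tmul, LinearMap.lTensor_tmul,
        canon_selfMk]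
      induction (c ⊗ₜ[k] (1 : H)) * δ.coact d using TensorProduct.induction_on with
      | zero => simp
      | add x y hx hy => simp only [map_add, TensorProduct.tmul_add, hx, hy]
      | tmul => rfl

variable {δ} (hA : δ.IsFaithfullyFlatGalois)

theorem canInv_mul (c : A) (s : A ⊗[k] H) :
    canInv hA ((c ⊗ₜ[k] (1 : H)) * s) = δ.mulL c (canInv hA s) := by
  apply canon_injective hA
  rw [canon_mulL, canon_canInv, canon_canInv]

/-- The map is injective because `(a ⊗_B c) ⊗ h ↦ a ⊗_B can⁻¹(c ⊗ h)` is a left inverse. -/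
theorem canonSelf_injective (hA : δ.IsFaithfullyFlatGalois) :
    Function.Injective δ.canonSelf := by
  let L : (δ.self.tensor δ.self).carrier ⊗[k] H →ₗ[k]
      ((δ.self.tensor δ.self).tensor δ.self).carrier :=
    TensorProduct.lift (tensorLift (M := δ.self) (N := δ.self)
      (LinearMap.mk₂ k (fun a c => (assoc δ.self δ.self δ.self).symm.toLinearEquiv.toLinearMap ∘ₗ
          tmul δ.self (δ.self.tensor δ.self) a ∘ₗ canInv hA ∘ₗ TensorProduct.mk k A H c)
        (fun _ _ _ => by ext; simp) (fun _ _ _ => by ext; simp)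
        (fun _ _ _ => by ext; simp) (fun _ _ _ => by ext; simp))
      (fun a b c => LinearMap.ext fun h => by
        change (assoc δ.self δ.self δ.self).symm (tmul δ.self (δ.self.tensor δ.self)
          (δ.self.right (op b) a) (canInv hA (c ⊗ₜ h))) = (assoc δ.self δ.self δ.self).symm
            (tmul δ.self (δ.self.tensor δ.self) a (canInv hA (((b : A) * c) ⊗ₜ h)))
        rw [tmul_balanced, canInv_tmul, canInv_tmul]
        induction gam hA h using self_induction with
        | add x y hx hy => simp only [map_add, hx, hy]
        | tmul l r =>
          change (assoc δ.self δ.self δ.self).symm (tmul δ.self (δ.self.tensor δ.self) a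
            (δ.selfMk ((b : A) * (c * l)) r)) = (assoc δ.self δ.self δ.self).symm (tmul δ.self
              (δ.self.tensor δ.self) a (δ.selfMk ((b : A) * c * l) r))
          rw [mul_assoc]))
  have hL : ∀ a s, L ((δ.selfMk a).rTensor H s) = (assoc δ.self δ.self δ.self).symm
      (tmul δ.self (δ.self.tensor δ.self) a (canInv hA s)) := by
    intro a s
    induction s using TensorProduct.induction_on with
    | zero => simp
    | add x y hx hy => simp only [map_add, hx, hy]
    | tmul => rfl
  refine Function.LeftInverse.injective (g := L) (fun z => ?_)
  induction z using tensor_induction with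
  | add x y hx hy => simp only [map_add, hx, hy]
  | tmul v d =>
    induction v using self_induction with
    | add x y hx hy => simp only [map_add, LinearMap.add_apply, hx, hy]
    | tmul a c =>
      rw [canonSelf_selfMk, hL, canInv_mul, canInv_coact]
      change tmul _ δ.self (δ.selfMk a (c * 1)) d = tmul _ δ.self (δ.selfMk a c) d
      rw [mul_one]

/-- The descent datum `D(a ⊗_B c) = a₀ ⊗_B l(a₁) ⊗_B r(a₁) c` on `A ⊗_B A`. -/
noncomputable def selfDesc : (δ.self.tensor δ.self).carrier →ₗ[k]
    ((δ.self.tensor δ.self).tensor δ.self).carrier :=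
  tensorLift (M := δ.self) (N := δ.self) (TensorProduct.curry (δ.projSelf ∘ₗ desc hA))
    (fun a b c => by
      let G : (δ.outer.tensor δ.outer).carrier →ₗ[k]
          ((δ.self.tensor δ.self).tensor δ.self).carrier :=
        δ.projSelf ∘ₗ tmap (N := δ.outer) (N' := δ.self) LinearMap.id mulOuter (fun _ _ => rfl)
          δ.mulOuter_left
      have h₁ : ∀ w, G (δ.mapFst (δ.rightB (op b)) w) = G (δ.midLeft b w) := by
        intro w
        induction w using outer_induction with
        | add x y hx hy => simp only [map_add, hx, hy]
        | tmul a l r c =>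
          exact congrArg (fun v => tmul _ δ.self v (r * c)) (δ.selfMk_balanced a b l)
      have h₂ : ∀ w, G (δ.midRight b w) = G (δ.mapSnd (δ.leftB b) w) := by
        intro w
        induction w using outer_induction with
        | add x y hx hy => simp only [map_add, hx, hy]
        | tmul a l r c => exact congrArg (tmul _ δ.self (δ.selfMk a l)) (mul_assoc r (b : A) c)
      change G (spl hA ((δ.rightB (op b)).rTensor A (a ⊗ₜ c))) =
        G (spl hA ((δ.leftB b).lTensor A (a ⊗ₜ c)))
      rw [spl_mapFst hA _ (δ.isColinear_rightB (op b)), spl_mapSnd, h₁, midLeft_spl, h₂])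

theorem selfDesc_proj (y : A ⊗[k] A) : selfDesc hA (δ.proj y) = δ.projSelf (desc hA y) := by
  induction y using TensorProduct.induction_on with
  | zero => simp
  | add x y hx hy => simp only [map_add, hx, hy]
  | tmul => rfl

theorem selfDesc_right (b : δ.coinv) (v : (δ.self.tensor δ.self).carrier) :
    selfDesc hA ((δ.self.tensor δ.self).right (op b) v) =
      ((δ.self.tensor δ.self).tensor δ.self).right (op b) (selfDesc hA v) := by
  obtain ⟨y, rfl⟩ := δ.proj_surjective v
  rw [← proj_right, selfDesc_proj, selfDesc_proj, desc_right]
  exact tmap_right (M := δ.outer) (M' := δ.self.tensor δ.self) (N := δ.self) (N' := δ.self) _ _ _ _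
    (fun _ _ => rfl) b _

theorem selfDesc_selfAct (c : A) (v : (δ.self.tensor δ.self).carrier) :
    selfDesc hA (δ.selfAct (tmul _ δ.self v c)) =
      tmap (M := δ.self.tensor δ.self) (N := δ.self) (N' := δ.self) LinearMap.id
        (LinearMap.mulRight k c) (fun _ _ => rfl) (fun _ _ => mul_assoc _ _ _)
          (selfDesc hA v) := by
  obtain ⟨y, rfl⟩ := δ.proj_surjective v
  rw [selfAct_proj, selfDesc_proj, selfDesc_proj, desc_mulRight]
  induction desc hA y using tensor_induction with
  | add x y hx hy => simp only [map_add, hx, hy]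
  | tmul y c' => rfl

variable (δ) in
/-- The map `A^{□e} ⊗ B → A ⊗_B A`, `∑ (a ⊗ a') ⊗ b ↦ ∑ a b ⊗_B a'`. -/
noncomputable def boxSelf :
    δ.box →ₗ[k] (unit k δ.coinv).carrier →ₗ[k] (δ.self.tensor δ.self).carrier :=
  LinearMap.mk₂ k (fun (x : δ.box) (b : δ.coinv) => δ.proj (δ.innerFst b x : A ⊗[k] A))
    (fun _ _ _ => by simp) (fun _ _ _ => by simp)
    (fun x (b c : δ.coinv) => by
      change δ.proj ((δ.rightB (op (b + c))).rTensor A x.1) =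
        δ.proj ((δ.rightB (op b)).rTensor A x.1) + δ.proj ((δ.rightB (op c)).rTensor A x.1)
      rw [MulOpposite.op_add, map_add, LinearMap.rTensor_add, LinearMap.add_apply, map_add])
    (fun c x (b : δ.coinv) => by
      change δ.proj ((δ.rightB (op (c • b))).rTensor A x.1) =
        c • δ.proj ((δ.rightB (op b)).rTensor A x.1)
      rw [MulOpposite.op_smul, map_smul, LinearMap.rTensor_smul, LinearMap.smul_apply, map_smul])

theorem boxSelf_boxInner (x : δ.box) (s : δ.coinv ⊗[k] δ.coinvᵐᵒᵖ)
    (b : (unit k δ.coinv).carrier) :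
    δ.boxSelf (δ.boxInner (op s) x) b = δ.boxSelf x ((unit k δ.coinv).env s b) := by
  induction s using TensorProduct.induction_on with
  | zero => simp
  | add s t hs ht =>
    rw [MulOpposite.op_add, map_add, LinearMap.add_apply, map_add, LinearMap.add_apply, hs, ht,
      map_add, LinearMap.add_apply, map_add]
  | tmul c c' =>
    rw [boxInner_tmul, env_tmul]
    change δ.coinv at b
    change δ.proj ((δ.rightB (op b)).rTensor A
      ((δ.leftB c'.unop).lTensor A ((δ.rightB (op c)).rTensor A x.1))) =
        δ.proj ((δ.rightB (op (c * (b * c'.unop)))).rTensor A x.1)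
    induction x.1 using TensorProduct.induction_on with
    | zero => simp
    | add y z hy hz => simp only [map_add, hy, hz]
    | tmul a a' =>
      refine (δ.selfMk_balanced (a * c * b) c'.unop a').symm.trans ?_
      change δ.selfMk (a * (c : A) * (b : A) * (c'.unop : A)) a' =
        δ.selfMk (a * ((c : A) * ((b : A) * (c'.unop : A)))) a'
      simp only [mul_assoc]

variable (δ) in
/-- The map `A^{□e} ⊗_{B^e} B → A ⊗_B A`, `∑ (a ⊗ a') ⊗ b ↦ ∑ a b ⊗_B a'`. -/
noncomputable def unitIncl :
    (δ.boxTensor (unit k δ.coinv)).carrier →ₗ[k] (δ.self.tensor δ.self).carrier :=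
  BTensor.lift δ.boxSelf boxSelf_boxInner

theorem unitIncl_boxMk (x : δ.box) (b : δ.coinv) :
    δ.unitIncl (δ.boxMk (unit k δ.coinv) x b) = δ.proj (δ.innerFst b x : A ⊗[k] A) := rfl

theorem unitIncl_right (b : δ.coinv) (z : (δ.boxTensor (unit k δ.coinv)).carrier) :
    δ.unitIncl ((δ.boxTensor (unit k δ.coinv)).right (op b) z) =
      (δ.self.tensor δ.self).right (op b) (δ.unitIncl z) := by
  induction z using boxTensor_induction with
  | add x y hx hy => simp only [map_add, hx, hy]
  | mk x c =>
    refine (unitIncl_boxMk _ c).trans ?_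
    refine (congrArg (fun y : δ.box => δ.proj y.1) (innerFst_right c b x)).trans ?_
    exact δ.proj_right (op b) _

variable [Coalgebra.IsCocomm k H]

theorem twist_canonLeft (v : (δ.self.tensor δ.self).carrier) :
    δ.twist ((HopfAlgebra.antipode k).lTensor A (δ.canonLeft v)) = δ.canon v := by
  induction v using self_induction with
  | add x y hx hy => simp only [map_add, hx, hy]
  | tmul a c =>
    have h₁ : ∀ s : A ⊗[k] H, δ.twist ((HopfAlgebra.antipode k).lTensor A
        (s * (c ⊗ₜ[k] (1 : H)))) =
        δ.twist ((HopfAlgebra.antipode k).lTensor A s) * δ.coact c := by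
      intro s
      induction s using TensorProduct.induction_on with
      | zero => simp
      | add x y hx hy => simp only [add_mul, map_add, hx, hy]
      | tmul a h => simp [mul_assoc]
    have h₂ : δ.twist ((HopfAlgebra.antipode k).lTensor A (δ.coact a)) = a ⊗ₜ 1 :=
      δ.twist_coactOp a
    rw [canonLeft_selfMk, h₁, h₂, canon_selfMk]

theorem canonLeft_injective (hA : δ.IsFaithfullyFlatGalois) : Function.Injective δ.canonLeft := by
  intro v w h
  apply canon_injective hA
  rw [← twist_canonLeft, ← twist_canonLeft, h]

/-- The map `a ⊗_B c ↦ a₀ c ⊗ a₁` is the canonical map up to the automorphism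
`a ⊗ h ↦ a₀ ⊗ S(h) a₁` of `A ⊗ H`. -/
theorem canonLeft_surjective (hA : δ.IsFaithfullyFlatGalois) :
    Function.Surjective δ.canonLeft := by
  intro s
  have hS : Function.Injective ((HopfAlgebra.antipode k (A := H)).lTensor A) :=
    Module.Flat.lTensor_preserves_injective_linearMap _
      (Function.LeftInverse.injective (g := HopfAlgebra.antipode k) antipode_antipode)
  refine ⟨canInv hA (δ.twist ((HopfAlgebra.antipode k).lTensor A s)), hS (δ.twist_injective ?_)⟩
  rw [twist_canonLeft, canon_canInv]

/-- For the diagonal coaction on `A ⊗_B A`, the map `a ⊗_B c ↦ a₀ c ⊗ a₁` is colinear, where `H`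
coacts on the first factor of `A ⊗ H`. -/
theorem canonLeft_diagonal (y : A ⊗[k] A) :
    δ.canonLeft.rTensor H (δ.proj.rTensor H ((TensorProduct.assoc k A A H).symm
      (δ.twist.lTensor A (TensorProduct.assoc k A A H (δ.coactLeft y))))) =
    coactFst H δ.coact.toLinearMap (δ.canonLeft (δ.proj y)) := by
  induction y using TensorProduct.induction_on with
  | zero => simp
  | add x y hx hy => simp only [map_add, hx, hy]
  | tmul a c =>
    -- `F(a' ⊗ (h ⊗ h')) = (a' c₀ ⊗ h) ⊗ h' c₁`
    let F : A ⊗[k] (H ⊗[k] H) →ₗ[k] (A ⊗[k] H) ⊗[k] H :=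
      (TensorProduct.rightComm k A H H).toLinearMap ∘ₗ
        (LinearMap.mulRight k (δ.coact c)).rTensor H ∘ₗ
          (TensorProduct.assoc k A H H).symm.toLinearMap ∘ₗ
            (TensorProduct.comm k H H).toLinearMap.lTensor A
    have hF : ∀ a' h h', F (a' ⊗ₜ (h ⊗ₜ h')) =
        TensorProduct.rightComm k A H H (((a' ⊗ₜ h') * δ.coact c) ⊗ₜ h) := fun _ _ _ => rfl
    have h₁ : ∀ s : A ⊗[k] H, δ.canonLeft.rTensor H (δ.proj.rTensor H
        ((TensorProduct.assoc k A A H).symm (δ.twist.lTensor A (TensorProduct.assoc k A A H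
          (((TensorProduct.mk k A A).flip c).rTensor H s))))) =
        F (TensorProduct.assoc k A H H (δ.coact.toLinearMap.rTensor H s)) := by
      intro s
      induction s using TensorProduct.induction_on with
      | zero => simp
      | add x y hx hy => simp only [map_add, hx, hy]
      | tmul a' h =>
        change δ.canonLeft.rTensor H (δ.proj.rTensor H ((TensorProduct.assoc k A A H).symm
          (a' ⊗ₜ (((1 : A) ⊗ₜ[k] h) * δ.coact c)))) =
          F (TensorProduct.assoc k A H H (δ.coact a' ⊗ₜ h))
        have h₂ : ∀ t, F (TensorProduct.assoc k A H H (t ⊗ₜ h)) =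
            (LinearMap.mulLeft k t ∘ₗ (TensorProduct.mk k A H).flip 1).rTensor H
              (((1 : A) ⊗ₜ[k] h) * δ.coact c) := by
          intro t
          induction t using TensorProduct.induction_on with
          | zero => simp
          | add x y hx hy =>
            rw [TensorProduct.add_tmul, map_add, map_add, hx, hy, ← LinearMap.add_apply,
              ← LinearMap.rTensor_add]
            congr 2
            ext
            simp [add_mul]
          | tmul a'' h' =>
            rw [TensorProduct.assoc_tmul, hF]
            induction δ.coact c using TensorProduct.induction_on with
            | zero => simp
            | add x y hx hy => simp only [map_add, TensorProduct.add_tmul, mul_add, hx, hy]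
            | tmul => simp
        rw [h₂]
        induction ((1 : A) ⊗ₜ[k] h) * δ.coact c using TensorProduct.induction_on with
        | zero => simp
        | add x y hx hy => simp only [map_add, TensorProduct.tmul_add, hx, hy]
        | tmul => rfl
    have h₂ : ∀ s : A ⊗[k] H, coactFst H δ.coact.toLinearMap (s * (c ⊗ₜ[k] (1 : H))) =
        F ((TensorProduct.comm k H H).toLinearMap.lTensor A
          (TensorProduct.assoc k A H H (δ.coact.toLinearMap.rTensor H s))) := by
      intro s
      induction s using TensorProduct.induction_on with
      | zero => simp
      | add x y hx hy => simp only [map_add, add_mul, hx, hy]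
      | tmul a' h =>
        rw [Algebra.TensorProduct.tmul_mul_tmul, mul_one]
        change TensorProduct.rightComm k A H H (δ.coact (a' * c) ⊗ₜ h) =
          F ((TensorProduct.comm k H H).toLinearMap.lTensor A
            (TensorProduct.assoc k A H H (δ.coact a' ⊗ₜ h)))
        rw [map_mul]
        induction δ.coact a' using TensorProduct.induction_on with
        | zero => simp
        | add x y hx hy => simp only [map_add, add_mul, TensorProduct.add_tmul, hx, hy]
        | tmul => rfl
    rw [coactLeft_tmul, h₁, proj_tmul, canonLeft_selfMk, h₂, δ.coassoc,
      ← LinearMap.lTensor_comp_apply, Coalgebra.comm_comp_comul]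

/-- The descent datum is trivial on the elements of `A ⊗_B A` that correspond to `B ⊗ H`. -/
theorem selfDesc_eq_unitR (s : δ.coinv ⊗[k] H) (v : (δ.self.tensor δ.self).carrier)
    (hv : δ.canonLeft v = δ.coinv.val.toLinearMap.rTensor H s) :
    selfDesc hA v = δ.unitR _ v := by
  have hinj : Function.Injective (δ.canonLeft.rTensor H) :=
    Module.Flat.rTensor_preserves_injective_linearMap _ (canonLeft_injective hA)
  apply canonSelf_injective hA
  apply hinj
  obtain ⟨y, rfl⟩ := δ.proj_surjective v
  rw [canonSelf_unitR, selfDesc_proj, canonSelf_projSelf, canon_reassoc_desc, canonLeft_diagonal,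
    LinearMap.rTensor_tmul, hv]
  clear hv
  induction s using TensorProduct.induction_on with
  | zero => simp
  | add x y hx hy => simp only [map_add, TensorProduct.add_tmul, hx, hy]
  | tmul b h =>
    change TensorProduct.rightComm k A H H (δ.coact (b : A) ⊗ₜ h) = _
    rw [coact_coinv]
    rfl

variable (δ) in
/-- The map `A^{□e} ⊗_B A → (A^{□e} ⊗_{B^e} B) ⊗_B A`, `x ⊗_B c ↦ (x ⊗ 1) ⊗_B c`. -/
noncomputable def boxUnit : (δ.boxBimod.tensor δ.self).carrier →ₗ[k]
    ((δ.boxTensor (unit k δ.coinv)).tensor δ.self).carrier :=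
  tmap (M := δ.boxBimod) (M' := δ.boxTensor (unit k δ.coinv)) (N := δ.self) (N' := δ.self)
    ((δ.boxMk (unit k δ.coinv)).flip (1 : δ.coinv)) LinearMap.id (fun _ _ => rfl) (fun _ _ => rfl)

/-- The map `A ⊗_B A → (A^{□e} ⊗_{B^e} B) ⊗_B A` that is induced by the isomorphism
`A ⊗ A ≅ A^{□e} ⊗_B A`. -/
noncomputable def unitInclInv : (δ.self.tensor δ.self).carrier →ₗ[k]
    ((δ.boxTensor (unit k δ.coinv)).tensor δ.self).carrier :=
  tensorLift (M := δ.self) (N := δ.self) (TensorProduct.curry (δ.boxUnit ∘ₗ boxMulInv hA))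
    (fun a b c => by
      change δ.boxUnit (boxMulInv hA ((δ.rightB (op b)).rTensor A (a ⊗ₜ c))) =
        δ.boxUnit (boxMulInv hA ((δ.leftB b).lTensor A (a ⊗ₜ c)))
      rw [boxMulInv_map hA _ (δ.innerFst b) (fun c x => innerFst_right b c x) (fun _ => rfl),
        boxMulInv_map hA _ (δ.innerSnd b) (fun c x => innerSnd_right b c x) (fun _ => rfl)]
      · induction boxMulInv hA (a ⊗ₜ c) using tensor_induction with
        | add x y hx hy => simp only [map_add, hx, hy]
        | tmul x d =>
          refine congrArg (fun t => tmul _ δ.self t d)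
            ((boxMk_innerFst (unit k δ.coinv) b x (1 : δ.coinv)).trans
            (Eq.trans ?_ (boxMk_innerSnd (unit k δ.coinv) b x (1 : δ.coinv)).symm))
          exact congrArg (δ.boxMk (unit k δ.coinv) x) ((mul_one b).trans (one_mul b).symm)
      · intro c y
        rw [← LinearMap.lTensor_comp_apply, ← LinearMap.lTensor_comp_apply]
        congr 2
        exact LinearMap.ext fun a => (mul_assoc (b : A) a c).symm
      · intro c y
        change ((δ.rightB (op b)).rTensor A ∘ₗ (LinearMap.mulRight k c).lTensor A) y =
          ((LinearMap.mulRight k c).lTensor A ∘ₗ (δ.rightB (op b)).rTensor A) y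
        rw [LinearMap.rTensor_comp_lTensor, LinearMap.lTensor_comp_rTensor])

theorem unitInclInv_proj (y : A ⊗[k] A) :
    unitInclInv hA (δ.proj y) = δ.boxUnit (boxMulInv hA y) := by
  induction y using TensorProduct.induction_on with
  | zero => simp
  | add x y hx hy => simp only [map_add, hx, hy]
  | tmul => rfl

theorem unitInclInv_unitIncl (z : (δ.boxTensor (unit k δ.coinv)).carrier) :
    unitInclInv hA (δ.unitIncl z) = δ.unitR _ z := by
  induction z using boxTensor_induction with
  | add x y hx hy => simp only [map_add, hx, hy]
  | mk x b =>
    refine (unitInclInv_proj hA _).trans ?_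
    rw [boxMulInv_coe]
    refine congrArg (fun t => tmul _ δ.self t (1 : A))
      ((boxMk_innerFst (unit k δ.coinv) b x (1 : δ.coinv)).trans ?_)
    exact congrArg (δ.boxMk (unit k δ.coinv) x) (mul_one (M := δ.coinv) b)

theorem unitIncl_injective (hA : δ.IsFaithfullyFlatGalois) : Function.Injective δ.unitIncl := by
  intro z w h
  apply unitR_injective hA
  rw [← unitInclInv_unitIncl hA, ← unitInclInv_unitIncl hA, h]

theorem selfDesc_unitIncl (z : (δ.boxTensor (unit k δ.coinv)).carrier) :
    selfDesc hA (δ.unitIncl z) = δ.unitR _ (δ.unitIncl z) := by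
  induction z using boxTensor_induction with
  | add x y hx hy => simp only [map_add, hx, hy]
  | mk x b =>
    refine (selfDesc_proj hA _).trans ?_
    rw [(mem_box_iff hA _).1 (δ.innerFst b x).2]
    rfl

theorem unitIncl_surjective_act (hA : δ.IsFaithfullyFlatGalois)
    (v : (δ.self.tensor δ.self).carrier) :
    ∃ u, δ.selfAct (tmap (M := δ.boxTensor (unit k δ.coinv)) (M' := δ.self.tensor δ.self)
      (N := δ.self) (N' := δ.self) δ.unitIncl LinearMap.id unitIncl_right (fun _ _ => rfl) u) =
        v := by
  obtain ⟨y, rfl⟩ := δ.proj_surjective v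
  obtain ⟨u, rfl⟩ := (boxMul_bijective hA).2 y
  refine ⟨δ.boxUnit u, ?_⟩
  induction u using tensor_induction with
  | add x y hx hy => simp only [map_add, hx, hy]
  | tmul x c =>
    rw [boxMul_tmul]
    refine (selfAct_proj δ _ c).trans ?_
    change δ.proj ((LinearMap.mulRight k c).lTensor A
      ((δ.rightB (op 1)).rTensor A x.1)) = _
    rw [MulOpposite.op_one, map_one]
    exact congrArg (fun t => δ.proj ((LinearMap.mulRight k c).lTensor A t))
      (LinearMap.rTensor_id_apply _ _ x.1)

/-- On `∑ (a ⊗ a') ⊗ b`, both sides are `∑ a₀ b a' ⊗ a₁`. -/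
theorem canonLeft_unitIncl (z : (δ.boxTensor (unit k δ.coinv)).carrier) :
    δ.canonLeft (δ.unitIncl z) =
      δ.coinv.val.toLinearMap.rTensor H (δ.unitAction.coext z) := by
  induction z using boxTensor_induction with
  | add x y hx hy =>
    rw [map_add, map_add, hx, hy, map_add]
    exact (map_add _ _ _).symm
  | mk x b =>
    change δ.coinv at b
    have h₁ : ∀ y : A ⊗[k] A, δ.canonLeft (δ.proj ((δ.rightB (op b)).rTensor A y)) =
        (sandwich (b : A)).rTensor H (δ.coactLeft y) := by
      intro y
      induction y using TensorProduct.induction_on with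
      | zero => simp
      | add x y hx hy => simp only [map_add, hx, hy]
      | tmul a a' =>
        change δ.coact (a * (b : A)) * (a' ⊗ₜ[k] (1 : H)) = _
        rw [coactLeft_tmul, map_mul, coact_coinv]
        induction δ.coact a using TensorProduct.induction_on with
        | zero => simp
        | add x y hx hy => simp only [map_add, add_mul, hx, hy]
        | tmul c h => simp
    refine (h₁ x.1).trans ?_
    refine Eq.trans ?_ (congrArg _ (BoxAction.coext_boxMk δ.unitAction x b).symm)
    rw [← boxCoact_spec, ← LinearMap.rTensor_comp_apply]
    exact LinearMap.rTensor_comp_apply H δ.coinv.val.toLinearMap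
      (δ.boxAct.flip b) (δ.boxCoact x)

/-- The canonical map `φ_B : A^{□e} ⊗_{B^e} B → B ⊗ H` is bijective: followed by the inclusion
`B ⊗ H → A ⊗ H`, it is the restriction of the bijection `a ⊗_B c ↦ a₀ c ⊗ a₁` to the elements of
`A ⊗_B A` on which the descent datum is trivial. -/
theorem unitAction_coext_bijective (hA : δ.IsFaithfullyFlatGalois) :
    Function.Bijective δ.unitAction.coext := by
  have hinj : Function.Injective (δ.coinv.val.toLinearMap.rTensor H) :=
    Module.Flat.rTensor_preserves_injective_linearMap _ Subtype.val_injective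
  refine ⟨fun z w h => unitIncl_injective hA (canonLeft_injective hA ?_), fun s => ?_⟩
  · rw [canonLeft_unitIncl, canonLeft_unitIncl, h]
  · obtain ⟨v, hv⟩ := canonLeft_surjective hA (δ.coinv.val.toLinearMap.rTensor H s)
    obtain ⟨z, rfl⟩ := mem_range_of_descent hA (selfDesc hA) (selfDesc_right hA) δ.selfAct
      (fun v hv c => by
        rw [selfDesc_selfAct, hv]
        exact congrArg (tmul _ δ.self v) (one_mul c))
      δ.unitIncl unitIncl_right (selfDesc_unitIncl hA) (unitIncl_surjective_act hA) v
      (selfDesc_eq_unitR hA s v hv)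
    exact ⟨z, hinj ((canonLeft_unitIncl z).symm.trans hv)⟩

end ComoduleAlgebra

/-! ### Stable Morita contexts -/

namespace ComoduleAlgebra
open Bimodule

variable {k : Type u} {H : Type w} {A : Type v} [Field k] [Ring H] [HopfAlgebra k H]
  [Ring A] [Algebra k A] {δ : ComoduleAlgebra k H A} {M M' N N' : Bimodule k δ.coinv}

/-- For a Morita context, the map
`(m ⊗ h) ⊗_B (n ⊗ h') ↦ ε(h') m β(n ⊗ m') ⊗ h`. -/
noncomputable def contractH (X : StrictMoritaContext k δ.coinv) (m' : X.M.carrier) :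
    BTensor (X.M.rightH H) (X.N.leftH H) →ₗ[k] X.M.carrier ⊗[k] H :=
  BTensor.lift ((X.M.rightH H).toLinearMap ∘ₗ (MulOpposite.opLinearEquiv k).toLinearMap ∘ₗ
      X.β.val ∘ₗ (tmul X.N X.M).flip m' ∘ₗ counitR X.N.carrier).flip
    (fun s c t => by
      change X.M.rightH H (op (X.β.val (tmul X.N X.M (counitR _ t) m')))
        (X.M.rightH H (op c) s) =
          X.M.rightH H (op (X.β.val (tmul X.N X.M (counitR _ (X.N.leftH H c t)) m'))) s
      rw [counitR_leftH, tensor_val_left, MulOpposite.op_mul, map_mul]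
      rfl)

theorem contractH_kappa (X : StrictMoritaContext k δ.coinv) (m' : X.M.carrier)
    (z : (X.M.tensor X.N).carrier) (h : H) :
    contractH X m' (kappa X.M X.N H (z ⊗ₜ h)) = X.M.left (X.α.val z) m' ⊗ₜ h := by
  have h₁ : ∀ t : H ⊗[k] H, contractH X m' (kappaTwo X.M X.N H (z ⊗ₜ t)) =
      X.M.left (X.α.val z) m' ⊗ₜ
        TensorProduct.rid k H ((Coalgebra.counit (R := k) (A := H)).lTensor H t) := by
    intro t
    induction z using tensor_induction with
    | add x y hx hy =>
      simp only [map_add, TensorProduct.add_tmul, LinearMap.add_apply, hx, hy]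
    | tmul m n =>
      induction t using TensorProduct.induction_on with
      | zero => simp
      | add x y hx hy => simp only [map_add, TensorProduct.tmul_add, hx, hy]
      | tmul h h' =>
        rw [kappaTwo_tmul]
        change X.M.right (op (X.β.val (tmul X.N X.M (counitR _ (n ⊗ₜ h')) m'))) m ⊗ₜ h = _
        rw [← X.assoc_left, counitR_tmul]
        simp [TensorProduct.smul_tmul']
  rw [kappa_eq, LinearMap.lTensor_tmul, h₁, Coalgebra.lTensor_counit_comul, TensorProduct.rid_tmul,
    one_smul]

theorem boxTensorMap_symm (f : M.Iso N) (z : (δ.boxTensor M).carrier) :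
    δ.boxTensorMap f.symm (δ.boxTensorMap f z) = z := by
  induction z using boxTensor_induction with
  | add x y hx hy => simp only [map_add, hx, hy]
  | mk x m => rw [boxTensorMap_boxMk, boxTensorMap_boxMk, Iso.symm_apply_apply]

theorem boxTensorMap_symm' (f : M.Iso N) (z : (δ.boxTensor N).carrier) :
    δ.boxTensorMap f (δ.boxTensorMap f.symm z) = z := by
  induction z using boxTensor_induction with
  | add x y hx hy => simp only [map_add, hx, hy]
  | mk x m => rw [boxTensorMap_boxMk, boxTensorMap_boxMk, Iso.apply_symm_apply]

/-- The map `x ⊗_B y ↦ (x ⊗ l) ⊗_B y m`. -/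
noncomputable def BoxAction.slidePair (a : δ.BoxAction M) {L : Bimodule k δ.coinv} (l : L.carrier)
    (m : M.carrier) : (δ.boxBimod.tensor δ.boxBimod).carrier →ₗ[k]
      ((δ.boxTensor L).tensor M).carrier :=
  tmap (M := δ.boxBimod) (M' := δ.boxTensor L) (N := δ.boxBimod) ((δ.boxMk L).flip l) (a.on m)
    (fun _ _ => rfl) (a.on_left m)

theorem BoxAction.slidePair_right (a : δ.BoxAction M) {L : Bimodule k δ.coinv} (l : L.carrier)
    (m : M.carrier) (b : δ.coinv) (z : (δ.boxBimod.tensor δ.boxBimod).carrier) :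
    a.slidePair l m ((δ.boxBimod.tensor δ.boxBimod).right (op b) z) =
      ((δ.boxTensor L).tensor M).right (op b) (a.slidePair l m z) :=
  tmap_right (M := δ.boxBimod) (M' := δ.boxTensor L) (N := δ.boxBimod) _ _ _ _
    (fun b => a.on_right m (op b)) b z

/-- The transport of a bilinear map `A^{□e} ⊗_{B^e} M → M` along `f : M ≅ N`. -/
noncomputable def BoxAction.transport (a : δ.BoxAction M) (f : M.Iso N) : δ.BoxAction N where
  act := f.toLinearEquiv.toLinearMap ∘ₗ a.act ∘ₗ δ.boxTensorMap f.symm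
  map_left b z := by
    induction z using boxTensor_induction with
    | add x y hx hy => simp only [map_add, hx, hy]
    | mk x n => exact (congrArg f (a.on_left (f.symm n) b x)).trans (f.left' b _)
  map_right b z := by
    induction z using boxTensor_induction with
    | add x y hx hy => simp only [map_add, hx, hy]
    | mk x n => exact (congrArg f (a.on_right (f.symm n) b x)).trans (f.right' b _)

theorem BoxAction.equivariant_transport (a : δ.BoxAction M) (f : M.Iso N) :
    a.Equivariant (a.transport f) f := fun x m =>
  congrArg (fun m => f (a.on m x)) (f.symm_apply_apply m).symm

variable [Coalgebra.IsCocomm k H]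

variable (δ) in
/-- The map `x ⊗_B y ↦ x y(b)`, for the action `(∑ a ⊗ a')(b) = ∑ a b a'` of `A^{□e}` on `B`. -/
noncomputable def actSnd (b : δ.coinv) : (δ.boxBimod.tensor δ.boxBimod).carrier →ₗ[k] δ.box :=
  tensorLift (M := δ.boxBimod) (N := δ.boxBimod) (δ.boxBimod.right.toLinearMap ∘ₗ
      (MulOpposite.opLinearEquiv k).toLinearMap ∘ₗ δ.boxAct.flip b).flip
    (fun x c y => by
      change δ.boxBimod.right (op (δ.boxAct y b)) (δ.boxBimod.right (op c) x) =
        δ.boxBimod.right (op (δ.boxAct (δ.boxBimod.left c y) b)) x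
      rw [boxAct_left, MulOpposite.op_mul, map_mul]
      rfl)

theorem actSnd_tmul (b : δ.coinv) (x y : δ.box) :
    δ.actSnd b (tmul δ.boxBimod δ.boxBimod x y) = δ.boxBimod.right (op (δ.boxAct y b)) x := rfl

/-- The counit property `x₁ x₂(b) = x b` of the comultiplication of `A^{□e}`, where `b` acts on the
second factor of `x`. -/
theorem actSnd_boxComul (hA : δ.IsFaithfullyFlatGalois) (b : δ.coinv) (x : δ.box) :
    δ.actSnd b (boxComul hA x) = δ.innerSnd b x := by
  have h₁ : ∀ z, (δ.actSnd b z : A ⊗[k] A) = (sandwich (b : A)).lTensor A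
      (TensorProduct.assoc k A A A (δ.mid (δ.boxBoxIncl z))) := by
    intro z
    induction z using tensor_induction with
    | add x y hx hy => simp only [map_add, Submodule.coe_add, hx, hy]
    | tmul x y =>
      rw [boxBoxIncl_tmul, actSnd_tmul]
      change (LinearMap.mulRight k (sandwich (b : A) (y : A ⊗[k] A))).lTensor A x = _
      induction (y : A ⊗[k] A) using TensorProduct.induction_on with
      | zero => simp
      | add y z hy hz =>
        rw [map_add, map_add, map_add, map_add, map_add, ← hy, ← hz, ← LinearMap.add_apply,
          ← LinearMap.lTensor_add]
        congr 2
        ext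
        simp [mul_add]
      | tmul c c' =>
        induction (x : A ⊗[k] A) using TensorProduct.induction_on with
        | zero => simp
        | add x y hx hy => simp only [map_add, LinearMap.add_apply, hx, hy]
        | tmul a a' => simp [mul_assoc]
  apply Subtype.ext
  rw [h₁, boxBoxIncl_boxComul, mid_spl, innerSnd_coe]
  induction (x : A ⊗[k] A) using TensorProduct.induction_on with
  | zero => simp
  | add x y hx hy => simp only [map_add, hx, hy]
  | tmul a a' => simp

variable {a : δ.BoxAction M} {b : δ.BoxAction N} {f : M.Iso N}

theorem BoxAction.Equivariant.coext_map (h : a.Equivariant b f) (z : (δ.boxTensor M).carrier) :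
    b.coext (δ.boxTensorMap f z) = f.toLinearEquiv.toLinearMap.rTensor H (a.coext z) := by
  rw [coext_apply, coext_apply, boxTensorCoact_map, ← LinearMap.rTensor_comp_apply,
    ← LinearMap.rTensor_comp_apply]
  congr 2
  exact LinearMap.ext fun z => (h.act_eq z).symm

theorem BoxAction.Equivariant.coext_bijective (h : a.Equivariant b f)
    (hb : Function.Bijective b.coext) : Function.Bijective a.coext := by
  have h₁ : Function.Bijective (f.toLinearEquiv.toLinearMap.rTensor H) :=
    (f.toLinearEquiv.rTensor H).bijective
  have h₂ : f.toLinearEquiv.toLinearMap.rTensor H ∘ a.coext = b.coext ∘ δ.boxTensorMap f :=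
    funext fun z => (h.coext_map z).symm
  rw [← h₁.of_comp_iff', h₂]
  exact hb.comp ⟨Function.LeftInverse.injective (boxTensorMap_symm f),
    Function.RightInverse.surjective (boxTensorMap_symm' f)⟩

section Context

variable (hA : δ.IsFaithfullyFlatGalois) {X : StrictMoritaContext k δ.coinv}
  {p : δ.BoxAction X.M} {q : δ.BoxAction X.N}

/-- If the maps `A^{□e} ⊗_{B^e} M → M` and `A^{□e} ⊗_{B^e} N → N` are compatible with `α`, then
`A^{□e} ⊗_{B^e} M → M ⊗ H` is surjective. -/
theorem BoxAction.coext_surjective (hα : (p.tensor hA q).Equivariant δ.unitAction X.α) :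
    Function.Surjective p.coext := by
  have h₁ : ∀ m' w, ∃ z, p.coext z = contractH X m' (p.coextTensor q w) := by
    intro m' w
    induction w using tensor_induction with
    | add x y hx hy =>
      obtain ⟨z, hz⟩ := hx
      obtain ⟨z', hz'⟩ := hy
      exact ⟨z + z', by rw [map_add, map_add, map_add, hz, hz']⟩
    | tmul z z' => exact ⟨_, p.coext_right (X.β.val (tmul X.N X.M (counitR _ (q.coext z')) m')) z⟩
  intro s
  induction s using TensorProduct.induction_on with
  | zero => exact ⟨0, map_zero _⟩
  | add x y hx hy =>
    obtain ⟨z, hz⟩ := hx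
    obtain ⟨z', hz'⟩ := hy
    exact ⟨z + z', by rw [map_add, hz, hz']⟩
  | tmul m h =>
    obtain ⟨w, hw⟩ := (hα.coext_bijective (unitAction_coext_bijective hA)).2
      (X.α.symm (1 : δ.coinv) ⊗ₜ h)
    obtain ⟨z, hz⟩ := h₁ m (splitMap X.M X.N hA w)
    refine ⟨z, ?_⟩
    rw [hz, ← kappa_coext_tensor, hw, contractH_kappa]
    have h₂ : X.α.val (X.α.symm (1 : δ.coinv)) = 1 := X.α.apply_symm_apply (1 : δ.coinv)
    rw [h₂, map_one]
    rfl

/-- The map `x ⊗ (l ⊗_B m) ↦ (x₁ ⊗ l) ⊗_B x₂ m`. -/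
noncomputable def BoxAction.slide (a : δ.BoxAction M) (L : Bimodule k δ.coinv) :
    (δ.boxTensor (L.tensor M)).carrier →ₗ[k] ((δ.boxTensor L).tensor M).carrier :=
  tmap (M := δ.boxTensor L) (M' := δ.boxTensor L) (N := δ.boxTensor M) (N' := M) LinearMap.id a.act
    (fun _ _ => rfl) a.map_left ∘ₗ splitMap L M hA

theorem BoxAction.slide_boxMk (a : δ.BoxAction M) {L : Bimodule k δ.coinv} (x : δ.box)
    (l : L.carrier) (m : M.carrier) : a.slide hA L (δ.boxMk (L.tensor M) x (tmul L M l m)) =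
      a.slidePair l m (boxComul hA x) := by
  change tmap (M := δ.boxTensor L) (M' := δ.boxTensor L) (N := δ.boxTensor M) (N' := M)
    LinearMap.id a.act (fun _ _ => rfl) a.map_left (boxIns L M l m (boxComul hA x)) = _
  induction boxComul hA x using tensor_induction with
  | add x y hx hy => simp only [map_add, hx, hy]
  | tmul x y => rfl

theorem BoxAction.slide_right (a : δ.BoxAction M) {L : Bimodule k δ.coinv} (b : δ.coinv)
    (z : (δ.boxTensor (L.tensor M)).carrier) :
    a.slide hA L ((δ.boxTensor (L.tensor M)).right (op b) z) =
      ((δ.boxTensor L).tensor M).right (op b) (a.slide hA L z) := by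
  induction z using boxTensor_tensor_induction with
  | add x y hx hy => simp only [map_add, hx, hy]
  | mk x l m => rw [boxTensor_right, slide_boxMk, slide_boxMk, boxComul_right, slidePair_right]

/-- If the coextension of the map `A^{□e} ⊗_{B^e} L → L` is bijective and `f : L ⊗_B M ≅ M` is
compatible with the given maps, then the kernel of the coextension for `M` is contained in the
kernel of `x ⊗ (l ⊗_B m) ↦ (x₁ ⊗ l) ⊗_B x₂ m`. -/
theorem BoxAction.slide_eq_zero {L : Bimodule k δ.coinv} {a : δ.BoxAction M} {c : δ.BoxAction L}
    (hc : Function.Bijective c.coext) {f : (L.tensor M).Iso M}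
    (hf : (c.tensor hA a).Equivariant a f) (z : (δ.boxTensor (L.tensor M)).carrier)
    (hz : a.coext (δ.boxTensorMap f z) = 0) : a.slide hA L z = 0 := by
  have h₁ : (c.tensor hA a).coext z = 0 := by
    have hinj : Function.Injective (f.toLinearEquiv.toLinearMap.rTensor H) :=
      (f.toLinearEquiv.rTensor H).injective
    apply hinj
    rw [← hf.coext_map, hz, map_zero]
  have h₂ : c.coextTensor a (splitMap L M hA z) = 0 := by
    rw [← kappa_coext_tensor, h₁, map_zero]
  let F : ((δ.boxTensor L).tensor M).carrier →ₗ[k] BTensor (L.rightH H) M.left :=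
    BTensor.map (LinearEquiv.ofBijective c.coext hc).toLinearMap (LinearEquiv.refl k _).toLinearMap
      c.coext_right (fun _ _ => rfl)
  have hF : Function.Injective F :=
    (BTensor.map_bijective (LinearEquiv.ofBijective c.coext hc) (LinearEquiv.refl k _)
      c.coext_right (fun _ _ => rfl)).1
  let G : BTensor (L.rightH H) (M.leftH H) →ₗ[k] BTensor (L.rightH H) M.left :=
    BTensor.map LinearMap.id (counitR M.carrier) (fun _ _ => rfl) (counitR_leftH (M := M))
  have hFG : ∀ w, F (tmap (M := δ.boxTensor L) (M' := δ.boxTensor L) (N := δ.boxTensor M)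
      (N' := M) LinearMap.id a.act (fun _ _ => rfl) a.map_left w) = G (c.coextTensor a w) := by
    intro w
    induction w using tensor_induction with
    | add x y hx hy => simp only [map_add, hx, hy]
    | tmul y z =>
      exact congrArg (BTensor.mk (L.rightH H) M.left (c.coext y)) (a.counitR_coext z).symm
  apply hF
  exact (hFG _).trans ((congrArg G h₂).trans ((map_zero G).trans (map_zero F).symm))

/-- The map `(x ⊗ (m ⊗_B n)) ⊗_B m' ↦ (x₁ ⊗ m) β(x₂ n ⊗ m')`. -/
noncomputable def BoxAction.unslide (q : δ.BoxAction X.N) :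
    ((δ.boxTensor (X.M.tensor X.N)).tensor X.M).carrier →ₗ[k] (δ.boxTensor X.M).carrier :=
  (rightUnitor (δ.boxTensor X.M)).toLinearEquiv.toLinearMap ∘ₗ
    ((Iso.refl (δ.boxTensor X.M)).tensor X.β).toLinearEquiv.toLinearMap ∘ₗ
      (assoc (δ.boxTensor X.M) X.N X.M).toLinearEquiv.toLinearMap ∘ₗ
        tmap (M := δ.boxTensor (X.M.tensor X.N)) (M' := (δ.boxTensor X.M).tensor X.N) (N := X.M)
          (N' := X.M) (q.slide hA X.M) LinearMap.id (q.slide_right hA) (fun _ _ => rfl)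

/-- Coassociativity and the counit property of the comultiplication of `A^{□e}` show that
`(x₁ ⊗ m) β(x₂ n ⊗ x₃ m') = x ⊗ m β(n ⊗ m')`. -/
theorem BoxAction.unslide_slide (hβ : (q.tensor hA p).Equivariant δ.unitAction X.β)
    (z : (δ.boxTensor ((X.M.tensor X.N).tensor X.M)).carrier) :
    BoxAction.unslide hA q (p.slide hA (X.M.tensor X.N) z) =
      δ.boxTensorMap ((X.α.tensor (Iso.refl X.M)).trans (leftUnitor X.M)) z := by
  induction z using boxTensor_tensor_induction with
  | add x y hx hy => simp only [map_add, hx, hy]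
  | mk x w m' =>
  induction w using tensor_induction with
  | add x y hx hy => simp only [map_add, LinearMap.add_apply, hx, hy]
  | tmul m n =>
    let Q : (δ.boxBimod.tensor (δ.boxBimod.tensor δ.boxBimod)).carrier →ₗ[k]
        ((δ.boxTensor X.M).tensor (X.N.tensor X.M)).carrier :=
      tmap (M := δ.boxBimod) (M' := δ.boxTensor X.M) (N := δ.boxBimod.tensor δ.boxBimod)
        ((δ.boxMk X.M).flip m) (q.onPair p n m') (fun _ _ => rfl) (q.onPair_left p n m')
    let R : ((δ.boxTensor X.M).tensor (X.N.tensor X.M)).carrier →ₗ[k] (δ.boxTensor X.M).carrier :=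
      (rightUnitor (δ.boxTensor X.M)).toLinearEquiv.toLinearMap ∘ₗ
        ((Iso.refl (δ.boxTensor X.M)).tensor X.β).toLinearEquiv.toLinearMap
    let P : ((δ.boxBimod.tensor δ.boxBimod).tensor δ.boxBimod).carrier →ₗ[k]
        (((δ.boxTensor X.M).tensor X.N).tensor X.M).carrier :=
      tmap (M := δ.boxBimod.tensor δ.boxBimod) (M' := (δ.boxTensor X.M).tensor X.N)
        (N := δ.boxBimod) (q.slidePair m n) (p.on m') (q.slidePair_right m n) (p.on_left m')
    have h₁ : ∀ u, BoxAction.unslide hA q (p.slidePair (tmul X.M X.N m n) m' u) =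
        R (assoc (δ.boxTensor X.M) X.N X.M (P (comulFst hA u))) := by
      intro u
      induction u using tensor_induction with
      | add x y hx hy => simp only [map_add, hx, hy]
      | tmul x y =>
        exact congrArg (fun t => R (assoc (δ.boxTensor X.M) X.N X.M
          (tmul ((δ.boxTensor X.M).tensor X.N) X.M t (p.on m' y)))) (q.slide_boxMk hA x m n)
    have h₂ : ∀ u, assoc (δ.boxTensor X.M) X.N X.M
        (P ((assoc δ.boxBimod δ.boxBimod δ.boxBimod).symm u)) = Q u := by
      intro u
      induction u using tensor_induction with
      | add x y hx hy => simp only [map_add, hx, hy]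
      | tmul x y =>
      induction y using tensor_induction with
      | add y z hy hz => simp only [map_add, hy, hz]
      | tmul y z => rfl
    have h₃ : ∀ u, R (Q (comulSnd hA u)) =
        δ.boxMk X.M (δ.actSnd (X.β.val (tmul X.N X.M n m')) u) m := by
      intro u
      induction u using tensor_induction with
      | add x y hx hy => simp only [map_add, LinearMap.add_apply, hx, hy]
      | tmul x y =>
        have h := hβ y (tmul X.N X.M n m')
        rw [tensor_on] at h
        exact congrArg (fun c : δ.coinv => (δ.boxTensor X.M).right (op c) (δ.boxMk X.M x m)) h
    rw [slide_boxMk, h₁, comulFst_boxComul, h₂, h₃, actSnd_boxComul, boxMk_innerSnd,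
      ← X.assoc_left]
    rfl

/-- If the maps `A^{□e} ⊗_{B^e} M → M` and `A^{□e} ⊗_{B^e} N → N` are compatible with `α` and `β`,
then `A^{□e} ⊗_{B^e} M → M ⊗ H` is bijective. -/
theorem BoxAction.coext_bijective (hα : (p.tensor hA q).Equivariant δ.unitAction X.α)
    (hβ : (q.tensor hA p).Equivariant δ.unitAction X.β) : Function.Bijective p.coext := by
  refine ⟨(injective_iff_map_eq_zero _).2 fun z hz => ?_, coext_surjective hA hα⟩
  let f := (X.α.tensor (Iso.refl X.M)).trans (leftUnitor X.M)
  have hf : ((p.tensor hA q).tensor hA p).Equivariant p f :=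
    (Equivariant.tensor hA hα (Equivariant.refl p)).trans (equivariant_leftUnitor hA p)
  have h := slide_eq_zero hA (hα.coext_bijective (unitAction_coext_bijective hA)) hf
    (δ.boxTensorMap f.symm z) (by rw [boxTensorMap_symm', hz])
  rw [← boxTensorMap_symm' f z, ← unslide_slide hA hβ, h, map_zero]

/-- A strict Morita context is `H`-stable if and only if there are bilinear maps
`A^{□e} ⊗_{B^e} M → M` and `A^{□e} ⊗_{B^e} N → N` that are compatible with `α` and `β`. -/
theorem isHStable_iff : IsHStable hA X ↔ ∃ (p : δ.BoxAction X.M) (q : δ.BoxAction X.N),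
    (p.tensor hA q).Equivariant δ.unitAction X.α ∧
      (q.tensor hA p).Equivariant δ.unitAction X.β := by
  constructor
  · rintro ⟨φ, ψ, h₁, h₂⟩
    exact ⟨φ.action, ψ.action, (isCompatible_iff hA _ _ _).1 h₁, (isCompatible_iff hA _ _ _).1 h₂⟩
  · rintro ⟨p, q, h₁, h₂⟩
    have hq : Function.Bijective q.coext := BoxAction.coext_bijective (X := X.inv) hA h₂ h₁
    refine ⟨p.toStableIso (BoxAction.coext_bijective hA h₁ h₂), q.toStableIso hq,
      (isCompatible_iff hA _ _ _).2 ?_, (isCompatible_iff hA _ _ _).2 ?_⟩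
    · rw [BoxAction.action_toStableIso, BoxAction.action_toStableIso]
      exact h₁
    · rw [BoxAction.action_toStableIso, BoxAction.action_toStableIso]
      exact h₂

/-- Compatibility with isomorphisms `M ⊗_B N ≅ B` is invariant under transport. -/
theorem BoxAction.Equivariant.transport {a : δ.BoxAction M} {b : δ.BoxAction N}
    {α : (M.tensor N).Iso (unit k δ.coinv)} (h : (a.tensor hA b).Equivariant δ.unitAction α)
    {α' : (M'.tensor N').Iso (unit k δ.coinv)} (μ : M.Iso M') (ν : N.Iso N')
    (hα : ∀ m n, α.val (tmul M N m n) = α'.val (tmul M' N' (μ m) (ν n))) :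
    ((a.transport μ).tensor hA (b.transport ν)).Equivariant δ.unitAction α' := by
  have h₁ : ∀ z, α z = α' ((μ.tensor ν) z) := by
    intro z
    induction z using tensor_induction with
    | add x y hx hy => simp only [map_add, hx, hy]
    | tmul m n => exact hα m n
  have h₂ : ∀ w, α ((μ.tensor ν).symm w) = α' w := fun w => by
    rw [h₁, Iso.apply_symm_apply]
  have h₃ := (Equivariant.tensor hA (equivariant_transport a μ)
    (equivariant_transport b ν)).symm.trans h
  exact fun x w => ((h₂ _).symm.trans (h₃ x w)).trans
    (congrArg (fun c => δ.unitAction.on c x) (h₂ w))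

theorem IsHStable.of_isomorphic {X Y : StrictMoritaContext k δ.coinv} (h : IsHStable hA X)
    (hXY : X.Isomorphic Y) : IsHStable hA Y := by
  obtain ⟨p, q, h₁, h₂⟩ := (isHStable_iff hA).1 h
  obtain ⟨μ, ν, hα, hβ⟩ := hXY
  exact (isHStable_iff hA).2 ⟨p.transport μ, q.transport ν, h₁.transport hA μ ν hα,
    h₂.transport hA ν μ hβ⟩

theorem IsHStable.one : IsHStable hA (StrictMoritaContext.one k δ.coinv) :=
  (isHStable_iff hA).2 ⟨δ.unitAction, δ.unitAction,
    BoxAction.equivariant_leftUnitor hA δ.unitAction,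
    BoxAction.equivariant_leftUnitor hA δ.unitAction⟩

theorem IsHStable.mul {X Y : StrictMoritaContext k δ.coinv} (hX : IsHStable hA X)
    (hY : IsHStable hA Y) : IsHStable hA (X.mul Y) := by
  obtain ⟨p, q, h₁, h₂⟩ := (isHStable_iff hA).1 hX
  obtain ⟨p', q', h₁', h₂'⟩ := (isHStable_iff hA).1 hY
  exact (isHStable_iff hA).2 ⟨p.tensor hA p', q'.tensor hA q, h₁.contract hA h₁',
    h₂'.contract hA h₂⟩

theorem IsHStable.inv {X : StrictMoritaContext k δ.coinv} (hX : IsHStable hA X) :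
    IsHStable hA X.inv := by
  obtain ⟨φ, ψ, h₁, h₂⟩ := hX
  exact ⟨ψ, φ, h₂, h₁⟩

/-- The group `Pic(B)^H` of classes of `H`-stable strict Morita contexts. -/
def stablePic : Subgroup (Pic k δ.coinv) where
  carrier := {c | Quotient.liftOn c (IsHStable hA) fun _ _ h =>
    propext ⟨fun h' => h'.of_isomorphic hA h, fun h' => h'.of_isomorphic hA h.symm⟩}
  mul_mem' := by
    rintro ⟨X⟩ ⟨Y⟩ hX hY
    exact IsHStable.mul hA hX hY
  one_mem' := IsHStable.one hA
  inv_mem' := by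
    rintro ⟨X⟩ hX
    exact IsHStable.inv hA hX

end Context

end ComoduleAlgebra

end HopfPic

theorem theorem5p10 {k H A : Type*} [Field k] [Ring H] [HopfAlgebra k H]
    [Coalgebra.IsCocomm k H] [Ring A] [Algebra k A] (δ : HopfPic.ComoduleAlgebra k H A)
    (hA : δ.IsFaithfullyFlatGalois) :
    ∃ S : Subgroup (HopfPic.Pic k δ.coinv), ∀ X : HopfPic.StrictMoritaContext k δ.coinv,
      HopfPic.Pic.mk X ∈ S ↔ HopfPic.ComoduleAlgebra.IsHStable hA X :=
  ⟨HopfPic.ComoduleAlgebra.stablePic hA, fun _ => Iff.rfl⟩
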